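/- **Model.** Fix a path loss $\alpha>\gamma>0$, a threshold $\beta\ge 1$, a noise $\mathcal N>0$, $\varepsilon\in(0,1)$ and a growth constant $\kappa$. A network consists of $n$ stations at distinct points of a metric space in which, for all $d>0$ and integers $c\ge 1$, every ball of radius $cd$ is covered by at most $\kappa c^{\gamma}$ balls of radius $d$. All stations have power $P=\mathcal N\beta$ (so the communication range is $1$). If exactly the stations of a set $T$ transmit in a round, then $u$ receives a message from $v$ iff $v\in T$, $u\notin T$ and $$\frac{P\,\mathrm{dist}(v,u)^{-\alpha}}{\mathcal N+\sum_{w\in T\setminus\{v\}}P\,\mathrm{dist}(w,u)^{-\alpha}}\ \ge\ \beta .$$ The communication graph joins two distinct stations iff their distance is at most $1-\varepsilon$; it is assumed connected, and $D$ is its diameter. All stations know $n$, wake up at the same time (spontaneous wake-up) and work in synchronous rounds; initially only a source $s$ knows the broadcast message. Random choices are independent. **Algorithm SBroadcast** with positive constants $c_0,c_1,c_2,c_3,c_\varepsilon,c',C_1,C_2,c,a$ ($c'$ an integer). 1. *StabilizeProbability*, once, on all stations: each station $v$ is active and starts with $p_v=p_{\rm start}=C_1/(2n)$; let $p_{\max}=C_2/c_\varepsilon$.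 While $p_v<p_{\max}$: repeat $c'$ times DensityTest ($\lceil c_0\log n\rceil$ rounds in which each active station $v$ transmits with probability $p_v$) followed by Playoff ($\lceil c_2\log n\rceil$ rounds with probability $c_\varepsilon p_v$); if $v$ received at least $c_1\log n$ messages in this DensityTest and at least $c_3\log n$ in this Playoff, it quits with color $p_v$ and is silent for the rest of this part. After the $c'$ repetitions an active station doubles $p_v$. A station that never quits in the loop gets color $2p_{\max}$. From now on $p_v$ denotes the color of $v$. 2. In one round the source transmits the broadcast message, alone and deterministically. 3. Each station $v$ that knows the message transmits it with probability $p_v/(c\,\varepsilon\log n)$ in each of the $\lceil a\log^2 n\rceil$ rounds that follow the round in which it first received it (for the source: the round of step 2). (Probabilities are truncated to $[0,1]$.) **Theorem.** There are values of the constants of the algorithm, and constants $K,\delta>0$, all depending only on $\alpha,\beta,\mathcal N,\varepsilon,\gamma,\kappa$, such that for every network as above with $n$ stations and every source $s$: (a) for every integer $T\ge K\,(D\log n+\log^2 n)$, with probability at least $1-1/n$ all stations know the broadcast message after $T$ rounds of SBroadcast (the rounds of StabilizeProbability included); (b) with probability at least $1-1/n$ the coloring computed in step 1 has the following property: in any round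 of step 3, for any edge $\{v,u\}$ of the communication graph, if every station within distance $\varepsilon/3$ of $v$ currently relays the message (whatever the states of the other stations), then with probability at least $\delta/\log n$ all stations within distance $\varepsilon/3$ of $u$ know the message after this round. -/

import Mathlib

open scoped NNReal

noncomputable section

namespace SINRBroadcast

/-! ## The SINR model -/

/-- The fixed parameters of the model. `γ` and `κ` are the dimension and the growth constant of the
underlying metric; the communication range is normalized to `1`. -/
structure Model where
  /-- path loss -/
  α : ℝ
  /-- SINR threshold -/
  β : ℝ
  /-- ambient noise -/
  noise : ℝ
  /-- connectivity graph parameter -/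
  ε : ℝ
  /-- dimension of the metric -/
  γ : ℝ
  /-- constant hidden in the bound `O(c ^ γ)` of the bounded growth property -/
  κ : ℝ
  γ_pos : 0 < γ
  γ_lt_α : γ < α
  one_le_β : 1 ≤ β
  noise_pos : 0 < noise
  ε_pos : 0 < ε
  ε_lt_one : ε < 1

/-- The common transmission power `P = 𝒩 β`, for which the communication range is `1`. -/
def Model.power (M : Model) : ℝ := M.noise * M.β

/-- Bounded growth property: for all `d > 0` and `c ≥ 1`, each ball of radius `c * d` is covered
by at most `κ * c ^ γ` balls of radius `d`. -/
def BoundedGrowth (X : Type*) [MetricSpace X] (γ κ : ℝ) : Prop :=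
  ∀ (x : X) (d : ℝ), 0 < d → ∀ c : ℕ, 1 ≤ c →
    ∃ S : Finset X, (S.card : ℝ) ≤ κ * (c : ℝ) ^ γ ∧
      Metric.closedBall x (c * d) ⊆ ⋃ y ∈ S, Metric.closedBall y d

section Channel

variable {X : Type*} [MetricSpace X] {V : Type*}

/-- The communication graph: two stations are adjacent iff their distance is at most `1 - ε`. -/
def commGraph (M : Model) (pos : V ↪ X) : SimpleGraph V where
  Adj v u := v ≠ u ∧ dist (pos v) (pos u) ≤ 1 - M.ε
  symm := ⟨fun _ _ h => ⟨h.1.symm, by rw [dist_comm]; exact h.2⟩⟩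
  loopless := ⟨fun _ h => h.1 rfl⟩

open Classical in
/-- `SINR(v, u, T)` for the sender `v`, the receiver `u` and the set `T` of transmitters. -/
def sinr (M : Model) (pos : V ↪ X) (v u : V) (T : Finset V) : ℝ :=
  M.power * dist (pos v) (pos u) ^ (-M.α) /
    (M.noise + ∑ w ∈ T.erase v, M.power * dist (pos w) (pos u) ^ (-M.α))

/-- When exactly the stations in `T` transmit, `u` receives a message. As `β ≥ 1` and the noise is
positive, the sender is then unique. -/
def Receives (M : Model) (pos : V ↪ X) (T : Finset V) (u : V) : Prop :=
  u ∉ T ∧ ∃ v ∈ T, M.β ≤ sinr M pos v u T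

end Channel

/-! ## Independent transmissions -/

/-- A real number, truncated to `[0, 1]`. -/
def clip (x : ℝ) : ℝ≥0 := min x.toNNReal 1

open Classical in
/-- The random set of transmitters of one round, when each station `v` transmits
with probability `p v` independently of the others. -/
def transmitters {V : Type*} [Fintype V] (p : V → ℝ) : PMF (Finset V) :=
  PMF.ofFintype
    (fun T => (((∏ v ∈ T, clip (p v)) * ∏ v ∈ Finset.univ \ T, (1 - clip (p v)) : ℝ≥0) : ENNReal))
    (by
      have h := Finset.prod_add (fun v => clip (p v)) (fun v => 1 - clip (p v)) Finset.univ
      have h1 : ∀ v, clip (p v) + (1 - clip (p v)) = 1 :=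
        fun v => add_tsub_cancel_of_le (min_le_right _ _)
      rw [Finset.powerset_univ] at h
      simp only [h1, Finset.prod_const_one] at h
      rw [← ENNReal.ofNNReal_finsetSum, ← h, ENNReal.coe_one])

/-- The probability of the event `A`, as a real number. -/
def prob {S : Type*} (μ : PMF S) (A : Set S) : ℝ := (μ.toOuterMeasure A).toReal

/-! ## The algorithm SBroadcast -/

/-- The constants of the algorithm. -/
structure Constants where
  /-- `DensityTest` takes `c₀ log n` rounds -/
  c₀ : ℝ
  /-- `DensityTest` succeeds on `c₁ log n` received messages -/
  c₁ : ℝ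
  /-- `Playoff` takes `c₂ log n` rounds -/
  c₂ : ℝ
  /-- `Playoff` succeeds on `c₃ log n` received messages -/
  c₃ : ℝ
  /-- the factor by which the probabilities are scaled up in `Playoff` -/
  cε : ℝ
  /-- the number of repetitions of the two tests in one phase -/
  c' : ℕ
  /-- the initial probability is `C₁ / (2 n)` -/
  C₁ : ℝ
  /-- the maximal probability is `C₂ / cε` -/
  C₂ : ℝ
  /-- an informed station of color `p` transmits with probability `p / (c ε log n)` -/
  c : ℝ
  /-- an informed station transmits for `a log² n` rounds -/
  a : ℝ
  c₀_pos : 0 < c₀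
  c₁_pos : 0 < c₁
  c₂_pos : 0 < c₂
  c₃_pos : 0 < c₃
  cε_pos : 0 < cε
  c'_pos : 0 < c'
  C₁_pos : 0 < C₁
  C₂_pos : 0 < C₂
  c_pos : 0 < c
  a_pos : 0 < a

namespace Constants

variable (C : Constants) (n : ℕ)

/-- The number of rounds of `DensityTest`. -/
def densityRounds : ℕ := ⌈C.c₀ * Real.log n⌉₊

/-- The number of rounds of `Playoff`. -/
def playoffRounds : ℕ := ⌈C.c₂ * Real.log n⌉₊

/-- The number of rounds of one execution of `DensityTest` followed by `Playoff`. -/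
def iterRounds : ℕ := C.densityRounds n + C.playoffRounds n

/-- The number of rounds of one phase, that is, of one pass of the `while` loop. -/
def phaseRounds : ℕ := C.c' * C.iterRounds n

/-- The initial probability `p_start`. -/
def pStart : ℝ := C.C₁ / (2 * n)

/-- The constant `p_max`. -/
def pMax : ℝ := C.C₂ / C.cε

/-- The value of the probability of the active stations in phase `i` (starting from `0`). -/
def phaseProb (i : ℕ) : ℝ := 2 ^ i * C.pStart n

/-- The number of passes of the loop `while p_v < p_max`. -/
def numPhases : ℕ := sInf {i : ℕ | ¬ C.phaseProb n i < C.pMax}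

/-- The number of rounds of `StabilizeProbability`. -/
def colorRounds : ℕ := C.numPhases n * C.phaseRounds n

/-- The number of rounds for which a station relays the source message. -/
def relayRounds : ℕ := ⌈C.a * Real.log n ^ 2⌉₊

end Constants

/-- The local state of a station. -/
structure Station where
  /-- messages received so far in the current `DensityTest` -/
  densityCount : ℕ
  /-- messages received so far in the current `Playoff` -/
  playoffCount : ℕ
  /-- the color with which the station has quit inside the `while` loop; `none` if it has not -/
  color : Option ℝ
  /-- the first round in which the station relays the source message; `none` as long as it
  does not know the source message -/
  relayFrom : Option ℕ

namespace Station

/-- The station knows the source message. -/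
def Informed (σ : Station) : Prop := σ.relayFrom.isSome

/-- The color assigned by `StabilizeProbability`: a station that has not quit inside the `while`
loop gets `2 p_max`. -/
def finalColor (C : Constants) (σ : Station) : ℝ := σ.color.getD (2 * C.pMax)

/-- Round `t` is among the rounds in which the station relays the source message. -/
def Relaying (C : Constants) (n t : ℕ) (σ : Station) : Prop :=
  ∃ r, σ.relayFrom = some r ∧ r ≤ t ∧ t < r + C.relayRounds n

open Classical in
/-- The probability with which a station transmits in round `t` (rounds are numbered from `0`).
Rounds `t < colorRounds` are the execution of `StabilizeProbability`: the stations that have not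
quit transmit with the probability `p` of the current phase in `DensityTest` and with `cε * p` in
`Playoff`. In round `colorRounds` exactly the source transmits, deterministically.
Afterwards the informed stations relay the message for `relayRounds` rounds each. -/
def transmitProb (M : Model) (C : Constants) (n : ℕ) (isSource : Prop) (t : ℕ)
    (σ : Station) : ℝ :=
  if t < C.colorRounds n then
    if σ.color.isSome then 0
    else if t % C.iterRounds n < C.densityRounds n then C.phaseProb n (t / C.phaseRounds n)
    else C.cε * C.phaseProb n (t / C.phaseRounds n)
  else if t = C.colorRounds n then
    if isSource then 1 else 0
  else if σ.Relaying C n t then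
    σ.finalColor C / (C.c * M.ε * Real.log n)
  else 0

open Classical in
/-- The new local state after round `t`; `heard` tells whether the station received a message in
this round. After the last round of `Playoff` a station that has not quit before quits with its
current probability as color if both tests returned `True`. The messages of `StabilizeProbability`
do not carry the source message; all the messages of later rounds do. -/
def update (C : Constants) (n t : ℕ) (σ : Station) (heard : Prop) : Station :=
  if t < C.colorRounds n then
    let inDensity : Prop := t % C.iterRounds n < C.densityRounds n
    let d : ℕ := σ.densityCount + if inDensity ∧ heard then 1 else 0
    let e : ℕ := σ.playoffCount + if ¬ inDensity ∧ heard then 1 else 0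
    if (t + 1) % C.iterRounds n = 0 then
      { densityCount := 0
        playoffCount := 0
        color :=
          if σ.color = none ∧ C.c₁ * Real.log n ≤ d ∧ C.c₃ * Real.log n ≤ e then
            some (C.phaseProb n (t / C.phaseRounds n))
          else σ.color
        relayFrom := σ.relayFrom }
    else { σ with densityCount := d, playoffCount := e }
  else if σ.relayFrom = none ∧ heard then { σ with relayFrom := some (t + 1) }
  else σ

end Station

section Execution

variable {X : Type*} [MetricSpace X] {V : Type*} [Fintype V]

open Classical in
/-- The initial states: only the source `s` knows the message, which it relays after its
deterministic transmission. -/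
def initState (C : Constants) (s : V) : V → Station := fun v =>
  { densityCount := 0
    playoffCount := 0
    color := none
    relayFrom := if v = s then some (C.colorRounds (Fintype.card V) + 1) else none }

/-- Round `t` of the algorithm with source `s`, from the states `σ` of the stations. -/
def step (M : Model) (C : Constants) (pos : V ↪ X) (s : V) (t : ℕ) (σ : V → Station) :
    PMF (V → Station) :=
  (transmitters fun v => (σ v).transmitProb M C (Fintype.card V) (v = s) t).map
    fun T v => (σ v).update C (Fintype.card V) t (Receives M pos T v)

/-- The distribution of the states of the stations after `t` rounds of SBroadcast. -/
def exec (M : Model) (C : Constants) (pos : V ↪ X) (s : V) : ℕ → PMF (V → Station)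
  | 0 => PMF.pure (initState C s)
  | t + 1 => (exec M C pos s t).bind (step M C pos s t)

end Execution

end SINRBroadcast

end

/-! Reception. Suppose the transmission probabilities have bounded mass in every ball of radius `1 /
6`. As `γ < α`, the expected interference from outside a ball of radius `R ≤ 1` is then `O(R ^
(-α))` (`outerSum_le`). If a set `N` has mass at most `1 / 4` and `S ⊆ N`, then with probability at
least half the mass of `S` exactly one station of `N` transmits, it lies in `S`, and the
interference from outside `N` is at most four times a bound for its mean (`half_sum_le_avgProb`).
When `N` is a ball, every station close enough hears this transmitter
(`receives_of_inter_eq_singleton`).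

Coloring. At all times the active stations have mass at most `K` in each ball of radius `1 / 6`. The
initial probability `K / n` guarantees this, and doubling preserves it once these masses have
dropped to `K / 2`. While a ball has more mass than that, DensityTest succeeds around it, and a
suitably minimal small ball nearby has Playoff mass at least `k` in a sparse surrounding, so all its
stations succeed in Playoff and quit (`Tuned.exists_playoff_ball`). A constant number of repetitions
exhausts the available mass. Hence each phase adds at most `K` to the color mass of a ball, which is
`O(log n)` in total. Conversely, a successful DensityTest certifies mass in the unit ball. The
amplified probabilities of Playoff then make this ball so crowded that senders farther than `ε / 3`
are rarely heard, so a successful Playoff certifies constant mass within `ε / 3`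
(`Tuned.playoff_receives_le`). Chernoff bounds for the message counters turn this into
`GoodColoring` with high probability.

Relaying. Division of the colors by `c ε log n` makes the masses of balls small constants, so the
reception argument applies again: the message crosses an edge with probability at least half the sum
of the rates near its tail. By the lower bound on the colors this is `Ω(1 / log n)` if all stations
there relay, which is (b). For (a), stations near a vertex may start and stop at different times, so
the progress is measured by `exposure`, the accumulated rates. The process `exp (exposure / 2)`,
killed when the next ball is informed, is a supermartingale; large exposure without success is
therefore unlikely (`RelayTuned.eprob_exposure_le`). Small exposure means that most of the mass is
still relaying (`RelayTuned.le_sum_relayProb`). Along a shortest path, a second supermartingale,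
exponential in the remaining distance, then gives the bound `O(D log n + log² n)`, and a union bound
over the targets finishes the proof. -/

namespace SINRBroadcast

/-! ### Expectations and probabilities under a `PMF`, with values in `ℝ≥0∞`. -/

section Mean

open scoped ENNReal

variable {S S' : Type*}

/-- The expectation of an extended nonnegative function under a `PMF`. -/
noncomputable def mean (μ : PMF S) (f : S → ℝ≥0∞) : ℝ≥0∞ := ∑' s, μ s * f s

theorem mean_bind (μ : PMF S) (κ : S → PMF S') (f : S' → ℝ≥0∞) :
    mean (μ.bind κ) f = mean μ fun s => mean (κ s) f := by
  simp only [mean, PMF.bind_apply, ← ENNReal.tsum_mul_left, ← ENNReal.tsum_mul_right]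
  rw [ENNReal.tsum_comm]
  simp only [mul_assoc]

theorem mean_pure (s : S) (f : S → ℝ≥0∞) : mean (PMF.pure s) f = f s := by
  unfold mean
  rw [tsum_eq_single s]
  · simp
  · intro s' h
    simp [h]

theorem mean_map (μ : PMF S) (g : S → S') (f : S' → ℝ≥0∞) :
    mean (μ.map g) f = mean μ fun s => f (g s) := by
  rw [PMF.map, mean_bind]
  simp [mean_pure]

theorem mean_mono {μ : PMF S} {f g : S → ℝ≥0∞} (h : ∀ s ∈ μ.support, f s ≤ g s) :
    mean μ f ≤ mean μ g := by
  refine ENNReal.tsum_le_tsum fun s => ?_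
  by_cases hs : μ s = 0
  · simp [hs]
  · exact mul_le_mul_right (h s ((PMF.mem_support_iff _ _).2 hs)) _

theorem mean_add (μ : PMF S) (f g : S → ℝ≥0∞) :
    mean μ (fun s => f s + g s) = mean μ f + mean μ g := by
  simp only [mean, mul_add]
  exact ENNReal.tsum_add

theorem mean_const (μ : PMF S) (c : ℝ≥0∞) : mean μ (fun _ => c) = c := by
  simp [mean, ENNReal.tsum_mul_right, PMF.tsum_coe]

theorem mean_const_mul (μ : PMF S) (c : ℝ≥0∞) (f : S → ℝ≥0∞) :
    mean μ (fun s => c * f s) = c * mean μ f := by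
  simp only [mean, ← ENNReal.tsum_mul_left]
  congr 1; ext s; ring

theorem mean_sum (μ : PMF S) {ι : Type*} (A : Finset ι) (f : ι → S → ℝ≥0∞) :
    mean μ (fun s => ∑ i ∈ A, f i s) = ∑ i ∈ A, mean μ (f i) := by
  classical
  induction A using Finset.induction_on with
  | empty => simp [mean]
  | insert i A hi ih => simp only [Finset.sum_insert hi, mean_add, ih]

/-- The probability of an event as an extended nonnegative real. -/
noncomputable def eprob (μ : PMF S) (A : Set S) : ℝ≥0∞ := mean μ (A.indicator 1)

theorem prob_eq_toReal_eprob (μ : PMF S) (A : Set S) : prob μ A = (eprob μ A).toReal := by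
  rw [prob, PMF.toOuterMeasure_apply, eprob, mean]
  congr 2
  ext s
  by_cases h : s ∈ A <;> simp [h]

theorem eprob_le_one (μ : PMF S) (A : Set S) : eprob μ A ≤ 1 := by
  rw [← mean_const μ 1]
  exact mean_mono fun s _ => Set.indicator_le_self' (fun _ _ => zero_le) s

theorem eprob_mono {μ : PMF S} {A B : Set S} (h : ∀ s ∈ μ.support, s ∈ A → s ∈ B) :
    eprob μ A ≤ eprob μ B := by
  refine mean_mono fun s hs => ?_
  by_cases hA : s ∈ A
  · simp [hA, h s hs hA]
  · simp [hA]

theorem eprob_compl_anti (μ : PMF S) {A B : Set S} (h : ∀ s, s ∈ A → s ∈ B) :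
    eprob μ Bᶜ ≤ eprob μ Aᶜ :=
  eprob_mono fun s _ hB hA => hB (h s hA)

theorem eprob_compl_eq_zero {μ : PMF S} {A : Set S} (h : ∀ s ∈ μ.support, s ∈ A) :
    eprob μ Aᶜ = 0 := by
  refine le_antisymm ((mean_mono (g := fun _ => 0) fun s hs => ?_).trans
    (mean_const μ 0).le) zero_le
  simp [h s hs]

theorem eprob_le_mean {μ : PMF S} {A : Set S} {f : S → ℝ≥0∞}
    (h : ∀ s ∈ μ.support, s ∈ A → 1 ≤ f s) : eprob μ A ≤ mean μ f := by
  refine mean_mono fun s hs => ?_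
  by_cases hA : s ∈ A
  · simpa [hA] using h s hs hA
  · simp [hA]

theorem eprob_bind (μ : PMF S) (κ : S → PMF S') (A : Set S') :
    eprob (μ.bind κ) A = mean μ fun s => eprob (κ s) A := mean_bind _ _ _

theorem eprob_union_le (μ : PMF S) (A B : Set S) :
    eprob μ (A ∪ B) ≤ eprob μ A + eprob μ B := by
  rw [eprob, eprob, eprob, ← mean_add]
  refine mean_mono fun s _ => ?_
  by_cases hA : s ∈ A <;> by_cases hB : s ∈ B <;> simp [hA, hB]

theorem eprob_iUnion_le (μ : PMF S) {ι : Type*} [Fintype ι] (A : ι → Set S) :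
    eprob μ (⋃ i, A i) ≤ ∑ i, eprob μ (A i) := by
  simp only [eprob]
  rw [← mean_sum]
  refine mean_mono fun s _ => ?_
  by_cases h : s ∈ ⋃ i, A i
  · obtain ⟨i, hi⟩ := Set.mem_iUnion.1 h
    rw [Set.indicator_of_mem h, ← Set.indicator_of_mem hi (1 : S → ℝ≥0∞)]
    exact Finset.single_le_sum (f := fun i => (A i).indicator (1 : S → ℝ≥0∞) s)
      (fun _ _ => zero_le) (Finset.mem_univ i)
  · simp [h]

theorem eprob_add_compl (μ : PMF S) (A : Set S) : eprob μ A + eprob μ Aᶜ = 1 := by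
  rw [eprob, eprob, ← mean_add, ← mean_const μ 1]
  congr 1
  ext s
  by_cases hA : s ∈ A <;> simp [hA]

theorem one_sub_le_prob {μ : PMF S} {A : Set S} {δ : ℝ} (hδ : 0 ≤ δ)
    (h : eprob μ Aᶜ ≤ ENNReal.ofReal δ) : 1 - δ ≤ prob μ A := by
  have h1 := eprob_add_compl μ A
  have hA : eprob μ A ≠ ⊤ := ne_top_of_le_ne_top (by simp) (eprob_le_one μ A)
  have hA' : eprob μ Aᶜ ≠ ⊤ := ne_top_of_le_ne_top (by simp) (eprob_le_one μ Aᶜ)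
  have h2 := congrArg ENNReal.toReal h1
  rw [ENNReal.toReal_add hA hA', ENNReal.toReal_one] at h2
  have h3 : (eprob μ Aᶜ).toReal ≤ δ := ENNReal.toReal_le_of_le_ofReal hδ h
  rw [prob_eq_toReal_eprob]
  linarith

/-- If a kernel leads from `I` to the complement of `J` with probability at most `e`, then the
probability of missing the invariant grows by at most `e`. -/
theorem eprob_bind_compl_le (μ : PMF S) (κ : S → PMF S') (I : Set S) (J : Set S') (e : ℝ≥0∞)
    (h : ∀ s ∈ I, eprob (κ s) Jᶜ ≤ e) : eprob (μ.bind κ) Jᶜ ≤ eprob μ Iᶜ + e := by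
  rw [eprob_bind, eprob, ← mean_const μ e, ← mean_add]
  refine mean_mono fun s _ => ?_
  by_cases hs : s ∈ I
  · simpa [hs] using h s hs
  · simpa [hs] using le_add_right (eprob_le_one (κ s) Jᶜ)

end Mean

/-! ### One round of independent transmissions, as a finite real sum. -/

section Avg

open Classical

variable {V : Type*} [Fintype V]

/-- The probability that exactly the stations of `T` transmit. -/
noncomputable def weight (p : V → ℝ) (T : Finset V) : ℝ :=
  (∏ v ∈ T, (clip (p v) : ℝ)) * ∏ v ∈ Finset.univ \ T, (1 - clip (p v) : ℝ)

theorem clip_le_one (x : ℝ) : clip x ≤ 1 := min_le_right _ _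

theorem coe_clip_le_one (x : ℝ) : (clip x : ℝ) ≤ 1 := by exact_mod_cast clip_le_one x

theorem coe_clip_le {x : ℝ} (hx : 0 ≤ x) : (clip x : ℝ) ≤ x := by
  rw [clip, NNReal.coe_min, Real.coe_toNNReal _ hx]
  exact min_le_left _ _

theorem coe_clip_eq {x : ℝ} (hx : 0 ≤ x) (h1 : x ≤ 1) : (clip x : ℝ) = x := by
  rw [clip, NNReal.coe_min, Real.coe_toNNReal _ hx]
  exact min_eq_left h1

theorem weight_nonneg (p : V → ℝ) (T : Finset V) : 0 ≤ weight p T :=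
  mul_nonneg (Finset.prod_nonneg fun _ _ => NNReal.coe_nonneg _)
    (Finset.prod_nonneg fun _ _ => sub_nonneg.2 (coe_clip_le_one _))

theorem transmitters_apply (p : V → ℝ) (T : Finset V) :
    transmitters p T = ENNReal.ofReal (weight p T) := by
  rw [transmitters, PMF.ofFintype_apply, ENNReal.ofReal]
  congr 1
  rw [← NNReal.coe_inj, Real.coe_toNNReal _ (weight_nonneg p T), weight]
  push_cast [NNReal.coe_sub (clip_le_one _)]
  rfl

/-- The expectation of `f` over the set of transmitters of one round. -/
noncomputable def avg (p : V → ℝ) (f : Finset V → ℝ) : ℝ := ∑ T, weight p T * f T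

theorem mean_transmitters (p : V → ℝ) (f : Finset V → ℝ) (hf : ∀ T, 0 ≤ f T) :
    mean (transmitters p) (fun T => ENNReal.ofReal (f T)) = ENNReal.ofReal (avg p f) := by
  rw [mean, tsum_fintype, avg, ENNReal.ofReal_sum_of_nonneg
    fun T _ => mul_nonneg (weight_nonneg p T) (hf T)]
  refine Finset.sum_congr rfl fun T _ => ?_
  rw [transmitters_apply, ENNReal.ofReal_mul (weight_nonneg p T)]

/-- Independence of the stations enters here: the expectation of a product over stations factorizes.
Pair correlations and the exponential moment below are special choices of `a` and `b`. -/
theorem avg_prod (p : V → ℝ) (a b : V → ℝ) :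
    avg p (fun T => (∏ v ∈ T, a v) * ∏ v ∈ Finset.univ \ T, b v)
      = ∏ v, ((clip (p v) : ℝ) * a v + (1 - clip (p v)) * b v) := by
  rw [Finset.prod_add, Finset.powerset_univ, avg]
  refine Finset.sum_congr rfl fun T _ => ?_
  rw [weight, Finset.prod_mul_distrib, Finset.prod_mul_distrib]
  ring

theorem avg_const (p : V → ℝ) (c : ℝ) : avg p (fun _ => c) = c := by
  have h := avg_prod p (fun _ => 1) (fun _ => 1)
  simp only [Finset.prod_const_one, mul_one, add_sub_cancel] at h
  rw [avg, ← Finset.sum_mul]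
  simp only [avg, mul_one] at h
  rw [h, one_mul]

theorem avg_mono {p : V → ℝ} {f g : Finset V → ℝ} (h : ∀ T, f T ≤ g T) : avg p f ≤ avg p g :=
  Finset.sum_le_sum fun T _ => mul_le_mul_of_nonneg_left (h T) (weight_nonneg p T)

theorem avg_nonneg {p : V → ℝ} {f : Finset V → ℝ} (h : ∀ T, 0 ≤ f T) : 0 ≤ avg p f :=
  Finset.sum_nonneg fun T _ => mul_nonneg (weight_nonneg p T) (h T)

theorem avg_add (p : V → ℝ) (f g : Finset V → ℝ) :
    avg p (fun T => f T + g T) = avg p f + avg p g := by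
  simp only [avg, mul_add, Finset.sum_add_distrib]

theorem avg_sub (p : V → ℝ) (f g : Finset V → ℝ) :
    avg p (fun T => f T - g T) = avg p f - avg p g := by
  simp only [avg, mul_sub, Finset.sum_sub_distrib]

theorem avg_const_mul (p : V → ℝ) (c : ℝ) (f : Finset V → ℝ) :
    avg p (fun T => c * f T) = c * avg p f := by
  simp only [avg, Finset.mul_sum]
  exact Finset.sum_congr rfl fun T _ => by ring

theorem avg_sum (p : V → ℝ) {ι : Type*} (A : Finset ι) (f : ι → Finset V → ℝ) :
    avg p (fun T => ∑ i ∈ A, f i T) = ∑ i ∈ A, avg p (f i) := by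
  simp only [avg, Finset.mul_sum]
  exact Finset.sum_comm

/-- The probability of an event of one round. -/
noncomputable def avgProb (p : V → ℝ) (A : Finset V → Prop) : ℝ :=
  avg p fun T => if A T then 1 else 0

theorem avgProb_nonneg (p : V → ℝ) (A : Finset V → Prop) : 0 ≤ avgProb p A :=
  avg_nonneg fun T => by split_ifs <;> norm_num

theorem avgProb_le_one (p : V → ℝ) (A : Finset V → Prop) : avgProb p A ≤ 1 := by
  rw [← avg_const p 1]
  exact avg_mono fun T => by split_ifs <;> norm_num

theorem avgProb_mono {p : V → ℝ} {A B : Finset V → Prop} (h : ∀ T, A T → B T) :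
    avgProb p A ≤ avgProb p B := by
  refine avg_mono fun T => ?_
  by_cases hA : A T
  · simp [hA, h T hA]
  · simp only [hA, if_false]; split_ifs <;> norm_num

theorem avg_ite (p : V → ℝ) (A : Finset V → Prop) (x y : ℝ) :
    avg p (fun T => if A T then x else y) = y + (x - y) * avgProb p A := by
  rw [avgProb, ← avg_const_mul, ← avg_const p y, ← avg_add]
  congr 1
  ext T
  rw [avg_const]
  split_ifs <;> ring

/-- The indicator of `v ∈ T`. -/
noncomputable def ind (v : V) (T : Finset V) : ℝ := if v ∈ T then 1 else 0

theorem ind_nonneg {V : Type*} (v : V) (T : Finset V) : 0 ≤ ind v T := by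
  unfold ind; split_ifs <;> norm_num

/-- With `b = 0` on `{v, w}` and all other factors `1`, the product in `avg_prod` is the indicator
of `{v, w} ⊆ T`. The product over a finset allows `v = w`, which yields `avg_ind`. -/
theorem avg_pair (p : V → ℝ) (v w : V) :
    avg p (fun T => ind v T * ind w T)
      = ∏ z ∈ ({v, w} : Finset V), (clip (p z) : ℝ) := by
  have h := avg_prod p (fun _ => 1) (fun z => if z ∈ ({v, w} : Finset V) then 0 else 1)
  have e : ∀ z, ((clip (p z) : ℝ) * 1 + (1 - clip (p z)) *
      (if z ∈ ({v, w} : Finset V) then 0 else 1))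
      = if z ∈ ({v, w} : Finset V) then (clip (p z) : ℝ) else 1 := fun z => by
    split_ifs <;> ring
  simp only [e] at h
  rw [Finset.prod_ite_mem, Finset.univ_inter] at h
  rw [← h]
  congr 1
  ext T
  simp only [Finset.prod_const_one, one_mul]
  by_cases hv : v ∈ T
  · by_cases hw : w ∈ T
    · rw [Finset.prod_eq_one]
      · simp [ind, hv, hw]
      · intro z hz
        rw [if_neg]
        rintro hz'
        simp only [Finset.mem_insert, Finset.mem_singleton] at hz'
        simp only [Finset.mem_sdiff] at hz
        rcases hz' with rfl | rfl
        · exact hz.2 hv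
        · exact hz.2 hw
    · rw [Finset.prod_eq_zero (i := w) (by simp [hw]) (by simp)]
      simp [ind, hw]
  · rw [Finset.prod_eq_zero (i := v) (by simp [hv]) (by simp)]
    simp [ind, hv]

theorem avg_ind (p : V → ℝ) (v : V) : avg p (ind v) = clip (p v) := by
  have h := avg_pair p v v
  simp only [Finset.mem_singleton, Finset.insert_eq_of_mem, Finset.prod_singleton] at h
  rw [← h]
  congr 1
  ext T
  unfold ind
  split_ifs <;> norm_num

theorem avg_pair_of_ne (p : V → ℝ) {v w : V} (h : v ≠ w) :
    avg p (fun T => ind v T * ind w T) = clip (p v) * clip (p w) := by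
  rw [avg_pair, Finset.prod_pair h]

theorem avgProb_exists_mem_le (p : V → ℝ) (A : Finset V) :
    avgProb p (fun T => ∃ v ∈ A, v ∈ T) ≤ ∑ v ∈ A, (clip (p v) : ℝ) := by
  simp only [← avg_ind]
  rw [← avg_sum]
  refine avg_mono fun T => ?_
  split_ifs with h
  · obtain ⟨v, hv, hT⟩ := h
    have : ind v T = 1 := by simp [ind, hT]
    rw [← this]
    exact Finset.single_le_sum (f := fun v => ind v T) (fun z _ => ind_nonneg z T) hv
  · exact Finset.sum_nonneg fun z _ => ind_nonneg z T

/-- The Chernoff moment with base `1 / 2`: the factor of a station of `A` is `1 - p / 2 ≤ exp (-p /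
2)`. -/
theorem avg_two_pow_neg_card_le (p : V → ℝ) (A : Finset V) :
    avg p (fun T => (1 / 2 : ℝ) ^ (T ∩ A).card)
      ≤ Real.exp (-(∑ v ∈ A, (clip (p v) : ℝ)) / 2) := by
  have h := avg_prod p (fun z => if z ∈ A then 1 / 2 else 1) (fun _ => 1)
  have e : ∀ T : Finset V, (∏ z ∈ T, (if z ∈ A then (1 / 2 : ℝ) else 1)) *
      ∏ z ∈ Finset.univ \ T, (1 : ℝ) = (1 / 2) ^ (T ∩ A).card := fun T => by
    rw [Finset.prod_ite_mem, Finset.prod_const, Finset.prod_const_one, mul_one]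
  simp only [e] at h
  rw [h, neg_div, Finset.sum_div, ← Finset.sum_neg_distrib, Real.exp_sum]
  have e' : ∀ g : V → ℝ, ∏ v ∈ A, g v = ∏ v, if v ∈ A then g v else 1 := fun g => by
    rw [Finset.prod_ite_mem, Finset.univ_inter]
  rw [e']
  refine Finset.prod_le_prod (fun z _ => ?_) fun z _ => ?_
  · have := coe_clip_le_one (p z)
    have := NNReal.coe_nonneg (clip (p z))
    split_ifs <;> linarith
  · split_ifs
    · have := Real.add_one_le_exp (-(clip (p z) : ℝ) / 2)
      rw [neg_div] at this
      linarith
    · linarith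

/-- At most `m` stations of `A` transmit: a lower tail bound. -/
theorem avgProb_card_le_le (p : V → ℝ) (A : Finset V) (m : ℝ) :
    avgProb p (fun T => ((T ∩ A).card : ℝ) ≤ m)
      ≤ 2 ^ m * Real.exp (-(∑ v ∈ A, (clip (p v) : ℝ)) / 2) := by
  refine le_trans ?_ (mul_le_mul_of_nonneg_left (avg_two_pow_neg_card_le p A)
    (Real.rpow_nonneg zero_le_two m))
  rw [← avg_const_mul]
  refine avg_mono fun T => ?_
  split_ifs with h
  · rw [one_div, inv_pow, ← div_eq_mul_inv, one_le_div (by positivity), ← Real.rpow_natCast]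
    exact Real.rpow_le_rpow_of_exponent_le one_le_two h
  · positivity

end Avg

/-! ### Bounded growth, masses of balls and interference from far away. -/

section Geometry

open Classical

theorem BoundedGrowth.one_le {X : Type*} [MetricSpace X] {γ κ : ℝ} (h : BoundedGrowth X γ κ)
    (x : X) : 1 ≤ κ := by
  obtain ⟨S, hS, hc⟩ := h x 1 one_pos 1 le_rfl
  have hx := hc (Metric.mem_closedBall_self (by norm_num))
  simp only [Set.mem_iUnion] at hx
  obtain ⟨y, hy, -⟩ := hx
  have : 1 ≤ S.card := Finset.card_pos.2 ⟨y, hy⟩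
  have : (1 : ℝ) ≤ S.card := by exact_mod_cast this
  simpa using this.trans hS

theorem sum_biUnion_le {V ι : Type*} {m : V → ℝ} (hm : ∀ v, 0 ≤ m v) (S : Finset ι)
    (f : ι → Finset V) : ∑ v ∈ S.biUnion f, m v ≤ ∑ y ∈ S, ∑ v ∈ f y, m v := by
  induction S using Finset.induction_on with
  | empty => simp
  | insert y S hy ih =>
    rw [Finset.biUnion_insert, Finset.sum_insert hy]
    have := Finset.sum_union_inter (s₁ := f y) (s₂ := S.biUnion f) (f := m)
    have h0 : 0 ≤ ∑ v ∈ f y ∩ S.biUnion f, m v := Finset.sum_nonneg fun v _ => hm v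
    linarith

variable {X : Type*} [MetricSpace X] {V : Type*} [Fintype V] (pos : V ↪ X)

/-- The stations within distance `r` of `x`. -/
noncomputable def near (x : V) (r : ℝ) : Finset V :=
  Finset.univ.filter fun w => dist (pos x) (pos w) ≤ r

theorem mem_near {x w : V} {r : ℝ} : w ∈ near pos x r ↔ dist (pos x) (pos w) ≤ r := by
  simp [near]

theorem near_mono {x : V} {r r' : ℝ} (h : r ≤ r') : near pos x r ⊆ near pos x r' := fun _ hw =>
  (mem_near pos).2 (((mem_near pos).1 hw).trans h)

theorem near_subset {x y : V} {r r' : ℝ} (h : dist (pos y) (pos x) + r ≤ r') :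
    near pos x r ⊆ near pos y r' := by
  intro w hw
  rw [mem_near] at *
  linarith [dist_triangle (pos y) (pos x) (pos w)]

/-- If the balls of radius `2 d` have mass at most `k`, those of radius `c d` have mass at most
`κ c ^ γ k`. -/
theorem sum_near_le {γ κ : ℝ} (hX : BoundedGrowth X γ κ) {m : V → ℝ} (hm : ∀ v, 0 ≤ m v)
    {x : V} {d k : ℝ} (hd : 0 < d) {c : ℕ} (hc : 1 ≤ c) (hk : 0 ≤ k)
    (h : ∀ y, dist (pos x) (pos y) ≤ c * d → ∑ w ∈ near pos y (2 * d), m w ≤ k) :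
    ∑ w ∈ near pos x (c * d), m w ≤ κ * (c : ℝ) ^ γ * k := by
  obtain ⟨S, hS, hcov⟩ := hX (pos x) d hd c hc
  have h1 : near pos x (c * d) ⊆ S.biUnion fun y =>
      (near pos x (c * d)).filter fun w => dist (pos w) y ≤ d := fun w hw => by
    have : pos w ∈ Metric.closedBall (pos x) (c * d) := by
      rw [Metric.mem_closedBall, dist_comm]
      exact (mem_near pos).1 hw
    have := hcov this
    simp only [Set.mem_iUnion] at this
    obtain ⟨y, hy, hwy⟩ := this
    exact Finset.mem_biUnion.2 ⟨y, hy, Finset.mem_filter.2 ⟨hw, hwy⟩⟩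
  have h2 : ∀ y ∈ S, ∑ w ∈ (near pos x (c * d)).filter (fun w => dist (pos w) y ≤ d), m w ≤ k := by
    intro y _
    rcases ((near pos x (c * d)).filter fun w => dist (pos w) y ≤ d).eq_empty_or_nonempty
      with he | ⟨w₀, hw₀⟩
    · rw [he, Finset.sum_empty]; exact hk
    · obtain ⟨hw₀, hy₀⟩ := Finset.mem_filter.1 hw₀
      -- The balls of the cover need not be centered at stations. A nonempty one lies in the ball of
      -- twice the radius around any of its stations, hence the radius `2 * d` in the hypothesis.
      refine le_trans (Finset.sum_le_sum_of_subset_of_nonneg (fun w hw => ?_)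
        fun w _ _ => hm w) (h w₀ ((mem_near pos).1 hw₀))
      rw [mem_near]
      have := (Finset.mem_filter.1 hw).2
      linarith [dist_triangle_right (pos w₀) (pos w) y]
  calc ∑ w ∈ near pos x (c * d), m w
      ≤ ∑ w ∈ S.biUnion fun y =>
          (near pos x (c * d)).filter fun w => dist (pos w) y ≤ d, m w :=
        Finset.sum_le_sum_of_subset_of_nonneg h1 fun w _ _ => hm w
    _ ≤ ∑ y ∈ S, ∑ w ∈ (near pos x (c * d)).filter (fun w => dist (pos w) y ≤ d), m w :=
        sum_biUnion_le hm _ _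
    _ ≤ ∑ _y ∈ S, k := Finset.sum_le_sum h2
    _ = S.card * k := by rw [Finset.sum_const, nsmul_eq_mul]
    _ ≤ κ * (c : ℝ) ^ γ * k := mul_le_mul_of_nonneg_right hS hk

/-- The constant of the bound for the interference caused outside a ball. -/
noncomputable def Model.outerConst (M : Model) : ℝ :=
  M.κ * 12 ^ M.γ + M.κ * 24 ^ M.γ * (1 - 2 ^ (M.γ - M.α))⁻¹

theorem Model.two_rpow_lt_one (M : Model) : (2 : ℝ) ^ (M.γ - M.α) < 1 :=
  Real.rpow_lt_one_of_one_lt_of_neg one_lt_two (by linarith [M.γ_lt_α])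

theorem Model.outerConst_pos (M : Model) (hκ : 1 ≤ M.κ) : 0 < M.outerConst := by
  have := M.two_rpow_lt_one
  have h : 0 < (1 - (2 : ℝ) ^ (M.γ - M.α))⁻¹ := inv_pos.2 (by linarith)
  unfold outerConst
  positivity

/-- The path loss of the stations outside a ball, weighted with their masses. -/
noncomputable def outerSum (α : ℝ) (m : V → ℝ) (x : V) (R : ℝ) : ℝ :=
  ∑ z ∈ (near pos x R)ᶜ, m z * dist (pos x) (pos z) ^ (-α)

theorem outerSum_anti {α : ℝ} {m : V → ℝ} (hm : ∀ v, 0 ≤ m v) (x : V) {R R' : ℝ} (h : R ≤ R') :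
    outerSum pos α m x R' ≤ outerSum pos α m x R :=
  Finset.sum_le_sum_of_subset_of_nonneg (Finset.compl_subset_compl.2 (near_mono pos h))
    fun z _ _ => mul_nonneg (hm z) (Real.rpow_nonneg dist_nonneg _)

/-- Split the outside into the annuli with radii `2 ^ i` and `2 ^ (i + 1)`. Covering by balls of
radius `1 / 12` bounds the mass of such an annulus by `κ (24 * 2 ^ i) ^ γ K`, and the path loss
there is at most `2 ^ (-α i)`. The resulting geometric series has ratio `2 ^ (γ - α) < 1`. -/
theorem outerSum_one_le (M : Model) (hX : BoundedGrowth X M.γ M.κ) {m : V → ℝ}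
    (hm : ∀ v, 0 ≤ m v) {K : ℝ} (hK : 0 ≤ K)
    (h : ∀ y, ∑ w ∈ near pos y (1 / 6), m w ≤ K) (x : V) :
    outerSum pos M.α m x 1 ≤ M.κ * 24 ^ M.γ * (1 - 2 ^ (M.γ - M.α))⁻¹ * K := by
  have hα := M.γ_pos.trans M.γ_lt_α
  have hκ : 1 ≤ M.κ := hX.one_le (pos x)
  have hj : ∀ z : V, ∃ j : ℕ, 1 ≤ dist (pos x) (pos z) →
      (2 : ℝ) ^ j ≤ dist (pos x) (pos z) ∧ dist (pos x) (pos z) ≤ 2 ^ (j + 1) := fun z => by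
    by_cases hz : 1 ≤ dist (pos x) (pos z)
    · obtain ⟨j, h1, h2⟩ := exists_nat_pow_near hz one_lt_two
      exact ⟨j, fun _ => ⟨h1, h2.le⟩⟩
    · exact ⟨0, fun h => absurd h hz⟩
  choose j hj using hj
  set J := Finset.univ.sup j + 1 with hJ
  have h1 : outerSum pos M.α m x 1 ≤
      ∑ i ∈ Finset.range J, ((2 : ℝ) ^ (-M.α)) ^ i * ∑ z ∈ near pos x (2 ^ (i + 1)), m z := by
    calc outerSum pos M.α m x 1
        ≤ ∑ z ∈ (near pos x 1)ᶜ, ∑ i ∈ Finset.range J,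
            if z ∈ near pos x (2 ^ (i + 1)) then ((2 : ℝ) ^ (-M.α)) ^ i * m z else 0 := by
          refine Finset.sum_le_sum fun z hz => ?_
          have hz1 : 1 ≤ dist (pos x) (pos z) := by
            rw [Finset.mem_compl, mem_near, not_le] at hz
            exact hz.le
          obtain ⟨h2, h3⟩ := hj z hz1
          have hmem : j z ∈ Finset.range J :=
            Finset.mem_range.2 (Nat.lt_succ_of_le (Finset.le_sup (Finset.mem_univ z)))
          refine le_trans ?_ (Finset.single_le_sum (f := fun i =>
            if z ∈ near pos x (2 ^ (i + 1)) then ((2 : ℝ) ^ (-M.α)) ^ i * m z else 0)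
            (fun i _ => ?_) hmem)
          · rw [if_pos ((mem_near pos).2 h3), mul_comm]
            refine mul_le_mul_of_nonneg_right ?_ (hm z)
            rw [← Real.rpow_natCast, ← Real.rpow_mul zero_le_two, mul_comm (-M.α),
              Real.rpow_mul zero_le_two, Real.rpow_natCast]
            exact Real.rpow_le_rpow_of_nonpos (by positivity) h2 (by linarith)
          · have := hm z
            split_ifs <;> positivity
      _ = ∑ i ∈ Finset.range J, ∑ z ∈ (near pos x 1)ᶜ,
            if z ∈ near pos x (2 ^ (i + 1)) then ((2 : ℝ) ^ (-M.α)) ^ i * m z else 0 :=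
          Finset.sum_comm
      _ ≤ _ := by
          refine Finset.sum_le_sum fun i _ => ?_
          rw [Finset.sum_ite_mem, Finset.mul_sum]
          exact Finset.sum_le_sum_of_subset_of_nonneg Finset.inter_subset_right
            fun z _ _ => mul_nonneg (by positivity) (hm z)
  have h2 : ∀ i : ℕ, ∑ z ∈ near pos x (2 ^ (i + 1)), m z
      ≤ M.κ * 24 ^ M.γ * K * ((2 : ℝ) ^ M.γ) ^ i := fun i => by
    have := sum_near_le pos hX hm (x := x) (d := 1 / 12) (k := K) (by norm_num)
      (c := 24 * 2 ^ i) (by have := Nat.one_le_two_pow (n := i); omega) hK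
      (fun y _ => by norm_num; simpa using h y)
    have e : ((24 * 2 ^ i : ℕ) : ℝ) * (1 / 12) = 2 ^ (i + 1) := by push_cast; ring
    rw [e] at this
    refine this.trans (le_of_eq ?_)
    push_cast
    rw [Real.mul_rpow (by norm_num) (by positivity), ← Real.rpow_natCast,
      ← Real.rpow_mul zero_le_two, mul_comm (i : ℝ), Real.rpow_mul zero_le_two, Real.rpow_natCast]
    ring
  calc outerSum pos M.α m x 1
      ≤ ∑ i ∈ Finset.range J, M.κ * 24 ^ M.γ * K * ((2 : ℝ) ^ (M.γ - M.α)) ^ i := by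
        refine h1.trans (Finset.sum_le_sum fun i _ => ?_)
        refine (mul_le_mul_of_nonneg_left (h2 i) (by positivity)).trans (le_of_eq ?_)
        rw [sub_eq_add_neg, Real.rpow_add two_pos, mul_pow]
        ring
    _ ≤ M.κ * 24 ^ M.γ * K * (1 - 2 ^ (M.γ - M.α))⁻¹ := by
        rw [← Finset.mul_sum]
        refine mul_le_mul_of_nonneg_left ?_ (by positivity)
        rw [← tsum_geometric_of_lt_one (by positivity) M.two_rpow_lt_one]
        exact (summable_geometric_of_lt_one (by positivity) M.two_rpow_lt_one).sum_le_tsum _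
          fun _ _ => by positivity
    _ = _ := by ring

/-- Between the radii `R` and `1` the path loss is at most `R ^ (-α)` and the mass is at most that
of the unit ball. The bound for the rest is absorbed because `R ^ (-α) ≥ 1`. -/
theorem outerSum_le (M : Model) (hX : BoundedGrowth X M.γ M.κ) {m : V → ℝ}
    (hm : ∀ v, 0 ≤ m v) {K : ℝ} (hK : 0 ≤ K)
    (h : ∀ y, ∑ w ∈ near pos y (1 / 6), m w ≤ K) (x : V) {R : ℝ} (hR : 0 < R) (hR1 : R ≤ 1) :
    outerSum pos M.α m x R ≤ K * M.outerConst * R ^ (-M.α) := by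
  have hα := M.γ_pos.trans M.γ_lt_α
  have hκ : 1 ≤ M.κ := hX.one_le (pos x)
  have h1 := outerSum_one_le pos M hX hm hK h x
  have h2 := sum_near_le pos hX hm (x := x) (d := 1 / 12) (k := K) (by norm_num)
      (c := 12) (by norm_num) hK (fun y _ => by norm_num; simpa using h y)
  norm_num at h2
  have hR' : 1 ≤ R ^ (-M.α) := Real.one_le_rpow_of_pos_of_le_one_of_nonpos hR hR1 (by linarith)
  have h3 : outerSum pos M.α m x R ≤ R ^ (-M.α) * ∑ w ∈ near pos x 1, m w
      + outerSum pos M.α m x 1 := by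
    have hs : (near pos x R)ᶜ ⊆ (near pos x 1 \ near pos x R) ∪ (near pos x 1)ᶜ := fun z hz => by
      simp only [Finset.mem_union, Finset.mem_sdiff, Finset.mem_compl] at *
      tauto
    have hn : ∀ z, 0 ≤ m z * dist (pos x) (pos z) ^ (-M.α) := fun z =>
      mul_nonneg (hm z) (Real.rpow_nonneg dist_nonneg _)
    refine (Finset.sum_le_sum_of_subset_of_nonneg hs fun z _ _ => hn z).trans ?_
    rw [Finset.sum_union (Finset.disjoint_left.2 fun z hz hz' =>
      (Finset.mem_compl.1 hz') (Finset.mem_sdiff.1 hz).1)]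
    refine add_le_add ?_ le_rfl
    rw [Finset.mul_sum]
    refine (Finset.sum_le_sum fun z hz => ?_).trans (Finset.sum_le_sum_of_subset_of_nonneg
      Finset.sdiff_subset fun z _ _ => mul_nonneg (by positivity) (hm z))
    rw [mul_comm]
    refine mul_le_mul_of_nonneg_right ?_ (hm z)
    have := (Finset.mem_sdiff.1 hz).2
    rw [mem_near, not_le] at this
    exact Real.rpow_le_rpow_of_nonpos hR this.le (by linarith)
  have hc : 0 ≤ M.κ * 24 ^ M.γ * (1 - 2 ^ (M.γ - M.α))⁻¹ * K := by
    have := M.two_rpow_lt_one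
    have h : 0 < (1 - (2 : ℝ) ^ (M.γ - M.α))⁻¹ := inv_pos.2 (by linarith)
    positivity
  calc outerSum pos M.α m x R
      ≤ R ^ (-M.α) * (M.κ * 12 ^ M.γ * K)
        + R ^ (-M.α) * (M.κ * 24 ^ M.γ * (1 - 2 ^ (M.γ - M.α))⁻¹ * K) := by
        refine h3.trans (add_le_add (mul_le_mul_of_nonneg_left h2 (by positivity)) ?_)
        exact h1.trans (le_mul_of_one_le_left hc hR')
    _ = _ := by unfold Model.outerConst; ring

end Geometry

/-! ### Sufficient and necessary conditions for the reception of a message. -/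

section Reception

open Classical

variable {X : Type*} [MetricSpace X] {V : Type*} [Fintype V] (pos : V ↪ X)

/-- With probability at least half of the mass of `S`, exactly one station of `N` transmits, this
station is in `S`, and the stations outside `N` cause little interference. -/
theorem half_sum_le_avgProb {p : V → ℝ} (hp : ∀ v, 0 ≤ p v) {S N : Finset V} (hSN : S ⊆ N)
    (hN : ∑ v ∈ N, p v ≤ 1 / 4) {g : V → ℝ} (hg : ∀ v, 0 ≤ g v) {θ : ℝ} (hθ : 0 < θ)
    (hout : ∑ z ∈ Nᶜ, p z * g z ≤ θ / 4) :
    (∑ v ∈ S, p v) / 2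
      ≤ avgProb p fun T => ∃ v ∈ S, T ∩ N = {v} ∧ ∑ z ∈ T \ N, g z ≤ θ := by
  -- As `N` has mass at most `1 / 4`, no probability is truncated there.
  have hclip : ∀ v ∈ N, (clip (p v) : ℝ) = p v := fun v hv => by
    refine coe_clip_eq (hp v) ?_
    linarith [Finset.single_le_sum (f := p) (fun z _ => hp z) hv]
  -- A Bonferroni-type inequality: from the indicator that `v` transmits, subtract the pairs inside
  -- `N` and the outside interference in units of `θ`. If the event fails, each summand is
  -- nonpositive; if it holds, only one summand is nonzero and it is at most `1`. In expectation,
  -- each of the two corrections costs at most a quarter of `p v`.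
  have key : ∀ T : Finset V,
      ∑ v ∈ S, (ind v T - ∑ w ∈ N.erase v, ind v T * ind w T
        - ∑ z ∈ Nᶜ, g z / θ * (ind v T * ind z T))
      ≤ if ∃ v ∈ S, T ∩ N = {v} ∧ ∑ z ∈ T \ N, g z ≤ θ then 1 else 0 := by
    intro T
    have hI : ∑ z ∈ Nᶜ, g z / θ * ind z T = (∑ z ∈ T \ N, g z) / θ := by
      rw [Finset.sum_div]
      simp only [ind, mul_ite, mul_one, mul_zero]
      rw [Finset.sum_ite_mem]
      refine Finset.sum_congr ?_ fun _ _ => rfl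
      ext z; simp [and_comm]
    have ht : ∀ v, (ind v T - ∑ w ∈ N.erase v, ind v T * ind w T
        - ∑ z ∈ Nᶜ, g z / θ * (ind v T * ind z T))
        = ind v T * (1 - ∑ w ∈ N.erase v, ind w T - (∑ z ∈ T \ N, g z) / θ) := fun v => by
      rw [← hI, mul_sub, mul_sub, Finset.mul_sum, Finset.mul_sum, mul_one]
      congr 1
      exact Finset.sum_congr rfl fun z _ => by ring
    simp only [ht]
    have hG : 0 ≤ (∑ z ∈ T \ N, g z) / θ := div_nonneg (Finset.sum_nonneg fun z _ => hg z) hθ.le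
    have hW : ∀ v, 0 ≤ ∑ w ∈ N.erase v, ind w T := fun v =>
      Finset.sum_nonneg fun w _ => ind_nonneg w T
    split_ifs with h
    · obtain ⟨v, hv, hT, -⟩ := h
      have hvT : ∀ w ∈ S, w ∈ T → w = v := fun w hw hwT => by
        have : w ∈ T ∩ N := Finset.mem_inter.2 ⟨hwT, hSN hw⟩
        rwa [hT, Finset.mem_singleton] at this
      rw [Finset.sum_eq_single_of_mem v hv fun w hw hne => by
        rw [ind, if_neg fun h => hne (hvT w hw h), zero_mul]]
      have h1 : ind v T ≤ 1 := by unfold ind; split_ifs <;> norm_num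
      have h0 := ind_nonneg v T
      have := hW v
      nlinarith
    · refine Finset.sum_nonpos fun v hv => ?_
      by_cases hvT : v ∈ T
      · rw [ind, if_pos hvT, one_mul]
        by_cases hTN : T ∩ N = {v}
        · have : ¬ ∑ z ∈ T \ N, g z ≤ θ := fun h' => h ⟨v, hv, hTN, h'⟩
          have : 1 ≤ (∑ z ∈ T \ N, g z) / θ := by
            rw [le_div_iff₀ hθ]; linarith
          linarith [hW v]
        · have : ∃ w ∈ N.erase v, w ∈ T := by
            by_contra! hc
            refine hTN (Finset.eq_singleton_iff_unique_mem.2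
              ⟨Finset.mem_inter.2 ⟨hvT, hSN hv⟩, fun w hw => ?_⟩)
            obtain ⟨hw, hwN⟩ := Finset.mem_inter.1 hw
            by_contra hne
            exact hc w (Finset.mem_erase.2 ⟨hne, hwN⟩) hw
          obtain ⟨w, hw, hwT⟩ := this
          have h1 := Finset.single_le_sum (f := fun w => ind w T) (fun z _ => ind_nonneg z T) hw
          have h2 : ind w T = 1 := by simp [ind, hwT]
          simp only [h2] at h1
          linarith
      · rw [ind, if_neg hvT, zero_mul]
  refine le_trans ?_ (avg_mono fun T => by convert key T)
  rw [avg_sum, Finset.sum_div]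
  refine Finset.sum_le_sum fun v hv => ?_
  rw [avg_sub, avg_sub, avg_ind, avg_sum, avg_sum]
  simp only [avg_const_mul]
  have h1 : ∑ w ∈ N.erase v, avg p (fun T => ind v T * ind w T) ≤ p v * (1 / 4) := by
    calc ∑ w ∈ N.erase v, avg p (fun T => ind v T * ind w T)
        = ∑ w ∈ N.erase v, p v * p w := by
          refine Finset.sum_congr rfl fun w hw => ?_
          rw [avg_pair_of_ne p (Finset.ne_of_mem_erase hw).symm, hclip v (hSN hv),
            hclip w (Finset.mem_of_mem_erase hw)]
      _ ≤ p v * (1 / 4) := by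
          rw [← Finset.mul_sum]
          refine mul_le_mul_of_nonneg_left (le_trans ?_ hN) (hp v)
          exact Finset.sum_le_sum_of_subset_of_nonneg (Finset.erase_subset _ _) fun z _ _ => hp z
  have h2 : ∑ z ∈ Nᶜ, g z / θ * avg p (fun T => ind v T * ind z T) ≤ p v * (1 / 4) := by
    calc ∑ z ∈ Nᶜ, g z / θ * avg p (fun T => ind v T * ind z T)
        ≤ ∑ z ∈ Nᶜ, p v / θ * (p z * g z) := by
          refine Finset.sum_le_sum fun z hz => ?_
          rw [avg_pair_of_ne p fun h : v = z => (Finset.mem_compl.1 hz) (h ▸ hSN hv), hclip v (hSN hv)]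
          have := mul_le_mul_of_nonneg_left (coe_clip_le (hp z))
            (mul_nonneg (div_nonneg (hg z) hθ.le) (hp v))
          calc _ = g z / θ * p v * (clip (p z)) := by ring
            _ ≤ _ := this
            _ = _ := by ring
      _ ≤ p v / θ * (θ / 4) := by
          rw [← Finset.mul_sum]
          exact mul_le_mul_of_nonneg_left hout (div_nonneg (hp v) hθ.le)
      _ = p v * (1 / 4) := by field_simp
  rw [hclip v (hSN hv)]
  linarith

/-- Since `w` is within `R / 2` of `x`, a transmitter outside the ball of radius `R` is at least
half as far from `w` as from `x`, so the interference at `w` is at most `2 ^ α θ` times the power.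
As the power is `𝒩 β`, dividing the SINR condition by it leaves exactly the hypothesis `hd`, in
which the summand `1` stands for the noise. -/
theorem receives_of_inter_eq_singleton (M : Model) {T : Finset V} {x v w : V} {R θ : ℝ}
    (hT : T ∩ near pos x R = {v})
    (hI : ∑ z ∈ T \ near pos x R, dist (pos x) (pos z) ^ (-M.α) ≤ θ)
    (hw : dist (pos x) (pos w) ≤ R / 2) (hwv : w ≠ v)
    (hd : 1 + M.β * 2 ^ M.α * θ ≤ dist (pos v) (pos w) ^ (-M.α)) :
    Receives M pos T w := by
  have hα := M.γ_pos.trans M.γ_lt_α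
  have hβ := M.one_le_β
  have hP : 0 < M.power := mul_pos M.noise_pos (by linarith)
  have hR : 0 ≤ R := by linarith [dist_nonneg (x := pos x) (y := pos w)]
  have hwN : w ∈ near pos x R := (mem_near pos).2 (by linarith)
  have hvT : v ∈ T ∩ near pos x R := hT ▸ Finset.mem_singleton_self v
  have hmem : ∀ z ∈ T, z ∈ near pos x R → z = v := fun z hz hz' => by
    have : z ∈ T ∩ near pos x R := Finset.mem_inter.2 ⟨hz, hz'⟩
    rwa [hT, Finset.mem_singleton] at this
  refine ⟨fun h => hwv (hmem w h hwN), v, (Finset.mem_inter.1 hvT).1, ?_⟩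
  have hsum : ∑ z ∈ T.erase v, M.power * dist (pos z) (pos w) ^ (-M.α)
      ≤ M.power * (2 ^ M.α * θ) := by
    rw [← Finset.mul_sum]
    refine mul_le_mul_of_nonneg_left ?_ hP.le
    refine le_trans ?_ (mul_le_mul_of_nonneg_left hI (by positivity))
    rw [Finset.mul_sum]
    have hsub : T.erase v ⊆ T \ near pos x R := fun z hz => by
      obtain ⟨h1, h2⟩ := Finset.mem_erase.1 hz
      exact Finset.mem_sdiff.2 ⟨h2, fun h => h1 (hmem z h2 h)⟩
    refine (Finset.sum_le_sum fun z hz => ?_).trans (Finset.sum_le_sum_of_subset_of_nonneg hsub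
      fun z _ _ => by positivity)
    have hz' := (Finset.mem_sdiff.1 (hsub hz)).2
    rw [mem_near, not_le] at hz'
    have h1 : dist (pos x) (pos z) / 2 ≤ dist (pos z) (pos w) := by
      have := dist_triangle (pos x) (pos w) (pos z)
      rw [dist_comm (pos w)] at this
      linarith
    have h2 : (2 : ℝ) ^ M.α * dist (pos x) (pos z) ^ (-M.α)
        = (dist (pos x) (pos z) / 2) ^ (-M.α) := by
      rw [Real.div_rpow dist_nonneg zero_le_two, Real.rpow_neg zero_le_two, div_inv_eq_mul,
        mul_comm]
    rw [h2]
    exact Real.rpow_le_rpow_of_nonpos (by linarith) h1 (by linarith)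
  unfold sinr
  have hden : 0 < M.noise + ∑ z ∈ T.erase v, M.power * dist (pos z) (pos w) ^ (-M.α) :=
    add_pos_of_pos_of_nonneg M.noise_pos (Finset.sum_nonneg fun z _ => by positivity)
  rw [le_div_iff₀ hden]
  calc M.β * (M.noise + ∑ z ∈ T.erase v, M.power * dist (pos z) (pos w) ^ (-M.α))
      ≤ M.β * (M.noise + M.power * (2 ^ M.α * θ)) := by gcongr
    _ = M.power * (1 + M.β * 2 ^ M.α * θ) := by unfold Model.power; ring
    _ ≤ _ := mul_le_mul_of_nonneg_left hd hP.le

/-- The sender of a received message is within distance `1`, and only few other stations within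
distance `1` transmit. -/
theorem Receives.exists_sender {M : Model} {T : Finset V} {u : V} (h : Receives M pos T u) :
    ∃ v ∈ T, v ≠ u ∧ dist (pos u) (pos v) ≤ 1 ∧
      ((T ∩ near pos u 1).card : ℝ) ≤ dist (pos u) (pos v) ^ (-M.α) + 1 := by
  have hα := M.γ_pos.trans M.γ_lt_α
  have hβ := M.one_le_β
  have hP : 0 < M.power := mul_pos M.noise_pos (by linarith)
  obtain ⟨hu, v, hv, hs⟩ := h
  have hvu : v ≠ u := fun h => hu (h ▸ hv)
  have hpos : ∀ z ∈ T, 0 < dist (pos u) (pos z) := fun z hz =>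
    dist_pos.2 fun h => hu (pos.injective h ▸ hz)
  have hden : 0 < M.noise + ∑ z ∈ T.erase v, M.power * dist (pos z) (pos u) ^ (-M.α) :=
    add_pos_of_pos_of_nonneg M.noise_pos (Finset.sum_nonneg fun z _ => by positivity)
  have hcard : (((T.erase v) ∩ near pos u 1).card : ℝ) * M.power
      ≤ ∑ z ∈ T.erase v, M.power * dist (pos z) (pos u) ^ (-M.α) := by
    rw [← nsmul_eq_mul, ← Finset.sum_const]
    refine (Finset.sum_le_sum fun z hz => ?_).trans (Finset.sum_le_sum_of_subset_of_nonneg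
      Finset.inter_subset_left fun z _ _ => by positivity)
    obtain ⟨hz1, hz2⟩ := Finset.mem_inter.1 hz
    refine le_mul_of_one_le_right hP.le ?_
    rw [dist_comm]
    exact Real.one_le_rpow_of_pos_of_le_one_of_nonpos (hpos z (Finset.mem_of_mem_erase hz1))
      ((mem_near pos).1 hz2) (by linarith)
  -- Each competing transmitter in the unit ball contributes at least the full power to the
  -- interference. Dividing by the power `𝒩 β` and using `β ≥ 1` gives the count.
  have hmain : 1 + (((T.erase v) ∩ near pos u 1).card : ℝ) ≤ dist (pos u) (pos v) ^ (-M.α) := by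
    unfold sinr at hs
    rw [le_div_iff₀ hden, dist_comm] at hs
    have h1 : M.β * (M.noise + (((T.erase v) ∩ near pos u 1).card : ℝ) * M.power)
        ≤ M.power * dist (pos u) (pos v) ^ (-M.α) := le_trans (by gcongr) hs
    have h2 : M.power * (1 + (((T.erase v) ∩ near pos u 1).card : ℝ))
        ≤ M.β * (M.noise + (((T.erase v) ∩ near pos u 1).card : ℝ) * M.power) := by
      have := le_mul_of_one_le_left
        (mul_nonneg (Nat.cast_nonneg ((T.erase v) ∩ near pos u 1).card) hP.le) hβ
      unfold Model.power at *
      nlinarith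
    exact le_of_mul_le_mul_left (h2.trans h1) hP
  refine ⟨v, hv, hvu, ?_, ?_⟩
  · by_contra! hc
    have := Real.rpow_lt_one_of_one_lt_of_neg hc (z := -M.α) (by linarith)
    linarith [Nat.cast_nonneg (α := ℝ) ((T.erase v) ∩ near pos u 1).card]
  · have hc : (T ∩ near pos u 1).card ≤ ((T.erase v) ∩ near pos u 1).card + 1 := by
      rw [Finset.erase_inter]
      have := Finset.pred_card_le_card_erase (s := T ∩ near pos u 1) (a := v)
      omega
    have : ((T ∩ near pos u 1).card : ℝ) ≤ ((T.erase v) ∩ near pos u 1).card + 1 := by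
      exact_mod_cast hc
    linarith

end Reception

/-- The relations between the constants of the algorithm, a bound `K` for the density of the active
stations in balls of radius `1 / 6`, the density `k` of the balls whose stations succeed in
`Playoff`, and the ratio `L` between the radii of an area without other transmissions and of such a
ball; the tests go wrong with probability at most `n ^ (-E)`. -/
structure Tuned (M : Model) (C : Constants) (K k : ℝ) (L : ℕ) (E : ℝ) : Prop where
  K_pos : 0 < K
  k_pos : 0 < k
  two_le_L : 2 ≤ L
  density_near : M.κ * 8 ^ M.γ * K ≤ 1 / 4
  density_outer : 1 + M.β * 2 ^ M.α * (4 * (K * M.outerConst * (2 / 3) ^ (-M.α))) ≤ 2 ^ M.α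
  playoff_near : M.κ * (4 * L : ℝ) ^ M.γ * k ≤ 1 / 4
  playoff_outer : (1 / (12 * L) : ℝ) ^ M.α
    + 4 * M.β * 4 ^ M.α * (C.cε * K * M.outerConst) * (L : ℝ) ^ (-M.α) ≤ 1
  playoff_dense : M.κ * (8 * L : ℝ) ^ M.γ * k < C.cε * K / 2
  playoff_silent : 2 ^ ((M.ε / 3) ^ (-M.α) + 1) * Real.exp (-(C.cε * K / 256)) ≤ k / 128
  C₁_eq : C.C₁ = 2 * K
  C₂_eq : C.C₂ = k / 8
  pMax_le : C.pMax ≤ K / 4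
  repetitions : M.κ * 4 ^ M.γ * K < C.c' * (k / C.cε)
  c₁_eq : C.c₁ = K / 8 / 4 * C.c₀
  c₃_eq : C.c₃ = k / 4 / 4 * C.c₂
  one_le_c₀ : 1 ≤ C.c₀ * Real.log 2
  one_le_c₂ : 1 ≤ C.c₂ * Real.log 2
  density_tail : 24 * E ≤ K / 8 * C.c₀
  playoff_tail : 24 * E ≤ k / 4 * C.c₂
  log_le_E : Real.log (40 * C.c') ≤ (E - 3) * Real.log 2

/-! ### Success probabilities of single rounds of DensityTest and Playoff. -/

section Tests

open Classical

variable {X : Type*} [MetricSpace X] {V : Type*} [Fintype V] (pos : V ↪ X)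
  {M : Model} {C : Constants} {K k : ℝ} {L : ℕ} {E : ℝ}

/-- In a dense ball, `DensityTest` rounds are successful with constant probability. -/
theorem Tuned.le_density_receives (hT : Tuned M C K k L E) (hX : BoundedGrowth X M.γ M.κ)
    {act : V → ℝ} (h0 : ∀ v, 0 ≤ act v) (hmax : ∀ v, act v ≤ C.pMax)
    (h : ∀ y, ∑ w ∈ near pos y (1 / 6), act w ≤ K) {x u : V}
    (hx : K / 2 ≤ ∑ w ∈ near pos x (1 / 6), act w) (hu : dist (pos x) (pos u) ≤ 1 / 3) :
    K / 8 ≤ avgProb act fun T => Receives M pos T u := by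
  have hα := M.γ_pos.trans M.γ_lt_α
  have hβ := M.one_le_β
  have hκ := hX.one_le (pos x)
  have hΩ := M.outerConst_pos hκ
  have hK := hT.K_pos
  have hN : ∑ w ∈ near pos x (2 / 3), act w ≤ 1 / 4 := by
    have := sum_near_le pos hX h0 (x := x) (d := 1 / 12) (k := K) (by norm_num)
      (c := 8) (by norm_num) hK.le (fun y _ => by norm_num; simpa using h y)
    norm_num at this
    exact this.trans hT.density_near
  have hout := outerSum_le pos M hX h0 hK.le h x (R := 2 / 3) (by norm_num) (by norm_num)
  set θ := 4 * (K * M.outerConst * (2 / 3) ^ (-M.α)) with hθ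
  have hθ0 : 0 < θ := by positivity
  have hS : (near pos x (1 / 6)).erase u ⊆ near pos x (2 / 3) :=
    (Finset.erase_subset _ _).trans (near_mono pos (by norm_num))
  have hmain := half_sum_le_avgProb h0 hS hN
    (g := fun z => dist (pos x) (pos z) ^ (-M.α)) (fun z => by positivity) hθ0
    (by rw [hθ]; unfold outerSum at hout; linarith)
  -- The receiver `u` cannot be the sender. Removing it costs at most `pMax ≤ K / 4`.
  have hsum : K / 4 ≤ ∑ w ∈ (near pos x (1 / 6)).erase u, act w := by
    by_cases hm : u ∈ near pos x (1 / 6)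
    · have := Finset.add_sum_erase _ act hm
      linarith [hmax u, hT.pMax_le]
    · rw [Finset.erase_eq_of_notMem hm]; linarith
  refine le_trans (by linarith) (hmain.trans (avgProb_mono fun T hTr => ?_))
  obtain ⟨v, hv, hTv, hI⟩ := hTr
  obtain ⟨hvu, hv⟩ := Finset.mem_erase.1 hv
  rw [mem_near] at hv
  refine receives_of_inter_eq_singleton pos M hTv hI (by linarith) hvu.symm ?_
  refine hT.density_outer.trans ?_
  have hd : dist (pos v) (pos u) ≤ 1 / 2 := by
    linarith [dist_triangle_left (pos v) (pos u) (pos x)]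
  have hd0 : 0 < dist (pos v) (pos u) := dist_pos.2 fun h => hvu (pos.injective h)
  calc (2 : ℝ) ^ M.α = (1 / 2) ^ (-M.α) := by
        rw [Real.rpow_neg (by norm_num), one_div, Real.inv_rpow zero_le_two, inv_inv]
    _ ≤ _ := Real.rpow_le_rpow_of_nonpos hd0 hd (by linarith)

theorem Tuned.k_le (hT : Tuned M C K k L E) (hκ : 1 ≤ M.κ) : k ≤ 1 / 4 := by
  refine le_trans (le_mul_of_one_le_left hT.k_pos.le ?_) hT.playoff_near
  have hL2 : (2 : ℝ) ≤ L := by exact_mod_cast hT.two_le_L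
  have hL : (1 : ℝ) ≤ L := by linarith
  exact one_le_mul_of_one_le_of_one_le hκ (Real.one_le_rpow (by linarith) M.γ_pos.le)

theorem Tuned.cε_mul_pMax (hT : Tuned M C K k L E) : C.cε * C.pMax = k / 8 := by
  have := C.cε_pos
  rw [Constants.pMax, hT.C₂_eq]
  field_simp

/-- The station of a ball that is farthest from its center. -/
theorem exists_near_eq (y : V) {r : ℝ} (hr : 0 ≤ r) :
    ∃ w, dist (pos y) (pos w) ≤ r ∧ near pos y (dist (pos y) (pos w)) = near pos y r := by
  obtain ⟨w, hw, hmax⟩ := (near pos y r).exists_max_image (fun w => dist (pos y) (pos w))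
    ⟨y, (mem_near pos).2 (by simpa using hr)⟩
  rw [mem_near] at hw
  exact ⟨w, hw, (near_mono pos hw).antisymm fun z hz => (mem_near pos).2 (hmax z hz)⟩

/-- In a dense ball there is a smaller ball all of whose stations are successful in `Playoff`
rounds with constant probability. -/
theorem Tuned.exists_playoff_ball (hT : Tuned M C K k L E) (hX : BoundedGrowth X M.γ M.κ)
    {act : V → ℝ} (h0 : ∀ v, 0 ≤ act v) (hmax : ∀ v, act v ≤ C.pMax)
    (h : ∀ y, ∑ w ∈ near pos y (1 / 6), act w ≤ K) {x : V}
    (hx : K / 2 ≤ ∑ w ∈ near pos x (1 / 6), act w) :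
    ∃ (y : V) (r : ℝ), near pos y r ⊆ near pos x (1 / 3) ∧
      k ≤ ∑ w ∈ near pos y r, C.cε * act w ∧
      ∀ u ∈ near pos y r, k / 4 ≤ avgProb (fun v => C.cε * act v) fun T => Receives M pos T u := by
  have hα := M.γ_pos.trans M.γ_lt_α
  have hβ := M.one_le_β
  have hκ := hX.one_le (pos x)
  have hΩ := M.outerConst_pos hκ
  have hK := hT.K_pos
  have hk := hT.k_pos
  have hε := C.cε_pos
  have hL2 : (2 : ℝ) ≤ L := by exact_mod_cast hT.two_le_L
  have hL : (1 : ℝ) ≤ L := by linarith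
  set q : V → ℝ := fun v => C.cε * act v with hq
  have hq0 : ∀ v, 0 ≤ q v := fun v => mul_nonneg hε.le (h0 v)
  have hqk : ∀ v, q v ≤ k / 8 := fun v => by
    rw [← hT.cε_mul_pMax]
    exact mul_le_mul_of_nonneg_left (hmax v) hε.le
  have hqsum : ∀ A : Finset V, ∑ w ∈ A, q w = C.cε * ∑ w ∈ A, act w := fun A =>
    (Finset.mul_sum _ _ _).symm
  -- a small ball of sufficient mass
  obtain ⟨y₀, hy₀, hm₀⟩ : ∃ y, dist (pos x) (pos y) ≤ 1 / 6 ∧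
      k ≤ ∑ w ∈ near pos y (2 * (1 / (48 * L))), q w := by
    by_contra! hc
    have hL8 : ((8 * L : ℕ) : ℝ) * (1 / (48 * L)) = 1 / 6 := by
      push_cast; field_simp; norm_num
    have := sum_near_le pos hX hq0 (x := x) (d := 1 / (48 * L)) (k := k) (by positivity)
      (c := 8 * L) (by have := hT.two_le_L; omega) hk.le (fun y hy => by
        rw [hL8] at hy; exact (hc y hy).le)
    rw [hL8, hqsum] at this
    push_cast at this
    have h1 := hT.playoff_dense
    have h2 := mul_le_mul_of_nonneg_left hx hε.le
    linarith
  -- Only distances between stations matter as radii, so the minimum below is over the finite set `V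
  -- × V`.
  obtain ⟨w₀, hw₀, hw₀'⟩ := exists_near_eq pos y₀ (r := 2 * (1 / (48 * L))) (by positivity)
  -- minimize the radius, penalizing the distance
  let φ : V × V → ℝ := fun a => 4 * L * dist (pos a.1) (pos a.2) + dist (pos y₀) (pos a.1)
  obtain ⟨⟨y, w⟩, hyw, hmin⟩ := (Finset.univ.filter fun a : V × V =>
    k ≤ ∑ z ∈ near pos a.1 (dist (pos a.1) (pos a.2)), q z).exists_min_image φ
    ⟨(y₀, w₀), Finset.mem_filter.2 ⟨Finset.mem_univ _, by rw [hw₀']; exact hm₀⟩⟩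
  replace hyw := (Finset.mem_filter.1 hyw).2
  simp only at hyw
  set ρ := dist (pos y) (pos w) with hρ
  -- A ball of radius `0` is a single station, of Playoff mass at most `k / 8 < k`.
  have hρ0 : 0 < ρ := by
    refine lt_of_le_of_ne dist_nonneg fun h0' => ?_
    rw [← h0'] at hyw
    have : near pos y 0 ⊆ {y} := fun z hz => by
      rw [mem_near] at hz
      rw [Finset.mem_singleton]
      exact (pos.injective (dist_le_zero.1 hz)).symm
    have := Finset.sum_le_sum_of_subset_of_nonneg this fun z _ _ => hq0 z
    rw [Finset.sum_singleton] at this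
    linarith [hqk y]
  have hφ : 4 * L * ρ + dist (pos y₀) (pos y) ≤ 1 / 6 := by
    have h1 := hmin (y₀, w₀) (Finset.mem_filter.2 ⟨Finset.mem_univ _, by rw [hw₀']; exact hm₀⟩)
    simp only [φ, dist_self, add_zero] at h1
    refine h1.trans ((mul_le_mul_of_nonneg_left hw₀ (by positivity)).trans (le_of_eq ?_))
    field_simp; norm_num
  have hLρ : ρ ≤ L * ρ := le_mul_of_one_le_left hρ0.le hL
  -- Minimality of `φ`: a ball of radius `ρ / 2` around `z` with mass above `k` would save at least
  -- `4 L (ρ / 2) = 2 L ρ` in the first term and cost at most `L ρ` in the second. Thus the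
  -- surrounding of radius `L ρ` is sparse at scale `ρ / 2`, whence its total mass is at most `κ (4
  -- L) ^ γ k ≤ 1 / 4`.
  have hsmall : ∀ z, dist (pos y) (pos z) ≤ L * ρ → ∑ v ∈ near pos z (2 * (ρ / 4)), q v ≤ k := by
    intro z hz
    by_contra! hc
    obtain ⟨w', hw', hw''⟩ := exists_near_eq pos z (r := 2 * (ρ / 4)) (by positivity)
    have h1 := hmin (z, w') (Finset.mem_filter.2 ⟨Finset.mem_univ _, by rw [hw'']; exact hc.le⟩)
    simp only [φ] at h1
    have h2 := dist_triangle (pos y₀) (pos y) (pos z)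
    have h3 := mul_le_mul_of_nonneg_left hw' (by positivity : (0 : ℝ) ≤ 4 * L)
    have h4 : 0 < L * ρ := by positivity
    nlinarith
  have hN : ∑ v ∈ near pos y (L * ρ), q v ≤ 1 / 4 := by
    have hL4 : ((4 * L : ℕ) : ℝ) * (ρ / 4) = L * ρ := by push_cast; ring
    have := sum_near_le pos hX hq0 (x := y) (d := ρ / 4) (k := k) (by positivity)
      (c := 4 * L) (by have := hT.two_le_L; omega) hk.le (fun z hz => by
        rw [hL4] at hz; exact hsmall z hz)
    rw [hL4] at this
    push_cast at this
    exact this.trans hT.playoff_near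
  have hLρ1 : L * ρ ≤ 1 / 24 := by
    linarith [dist_nonneg (x := pos y₀) (y := pos y)]
  have hout := outerSum_le pos M hX hq0 (K := C.cε * K) (by positivity)
    (fun z => by rw [hqsum]; exact mul_le_mul_of_nonneg_left (h z) hε.le) y (R := L * ρ)
    (by positivity) (by linarith)
  set θ := 4 * (C.cε * K * M.outerConst * (L * ρ) ^ (-M.α)) with hθ
  have hθ0 : 0 < θ := by positivity
  refine ⟨y, ρ, near_subset pos ?_, hyw, fun u hu => ?_⟩
  · have := dist_triangle (pos x) (pos y₀) (pos y)
    linarith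
  have hS : (near pos y ρ).erase u ⊆ near pos y (L * ρ) :=
    (Finset.erase_subset _ _).trans (near_mono pos hLρ)
  have hmain := half_sum_le_avgProb hq0 hS hN
    (g := fun z => dist (pos y) (pos z) ^ (-M.α)) (fun z => by positivity) hθ0
    (by rw [hθ]; unfold outerSum at hout; linarith)
  have hsum : k / 2 ≤ ∑ w ∈ (near pos y ρ).erase u, q w := by
    have := Finset.add_sum_erase _ q hu
    linarith [hqk u]
  refine le_trans (by linarith) (hmain.trans (avgProb_mono fun T hTr => ?_))
  obtain ⟨v, hv, hTv, hI⟩ := hTr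
  obtain ⟨hvu, hv⟩ := Finset.mem_erase.1 hv
  rw [mem_near] at hv hu
  have hd : dist (pos v) (pos u) ≤ 2 * ρ := by
    linarith [dist_triangle_left (pos v) (pos u) (pos y)]
  have hd0 : 0 < dist (pos v) (pos u) := dist_pos.2 fun h => hvu (pos.injective h)
  refine receives_of_inter_eq_singleton pos M hTv hI (by nlinarith) hvu.symm ?_
  refine le_trans ?_ (Real.rpow_le_rpow_of_nonpos hd0 hd (by linarith))
  -- From `4 L ρ ≤ 1 / 6` follows `2 ρ ≤ 1 / (12 L)`. Relative to the signal `(2 ρ) ^ (-α)`, noise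
  -- and interference are therefore bounded by the two terms of `playoff_outer`, in which `ρ` no
  -- longer occurs.
  have e1 : 1 ≤ (2 * ρ) ^ (-M.α) * (1 / (12 * L) : ℝ) ^ M.α := by
    rw [Real.rpow_neg (by positivity), inv_mul_eq_div, one_le_div (by positivity)]
    refine Real.rpow_le_rpow (by positivity) ?_ hα.le
    rw [le_div_iff₀ (by positivity)]
    linarith [dist_nonneg (x := pos y₀) (y := pos y)]
  have e2 : (2 * ρ) ^ (-M.α) * (4 * M.β * 4 ^ M.α * (C.cε * K * M.outerConst) * (L : ℝ) ^ (-M.α))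
      = M.β * 2 ^ M.α * θ := by
    have e3 : (4 : ℝ) ^ M.α = 2 ^ M.α * 2 ^ M.α := by
      rw [← Real.mul_rpow zero_le_two zero_le_two]; norm_num
    have e4 : (2 : ℝ) ^ (-M.α) * 2 ^ M.α = 1 := by
      rw [← Real.rpow_add two_pos, neg_add_cancel, Real.rpow_zero]
    rw [hθ, Real.mul_rpow zero_le_two hρ0.le, Real.mul_rpow (by positivity) hρ0.le, e3]
    linear_combination (ρ ^ (-M.α) * (4 * M.β * 2 ^ M.α * (C.cε * K * M.outerConst) *
      (L : ℝ) ^ (-M.α))) * e4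
  have e5 := mul_le_mul_of_nonneg_left hT.playoff_outer
    (Real.rpow_nonneg (by positivity) (-M.α) : 0 ≤ (2 * ρ) ^ (-M.α))
  rw [mul_add, e2, mul_one] at e5
  linarith

/-- A station receives no more messages than the neighbors within distance `1` send. -/
theorem avgProb_receives_le (M : Model) {p : V → ℝ} (hp : ∀ v, 0 ≤ p v) (u : V) :
    avgProb p (fun T => Receives M pos T u) ≤ ∑ w ∈ near pos u 1, p w := by
  refine (avgProb_mono fun T h => ?_).trans ((avgProb_exists_mem_le p (near pos u 1)).trans
    (Finset.sum_le_sum fun w _ => coe_clip_le (hp w)))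
  obtain ⟨v, hv, -, hd, -⟩ := h.exists_sender pos
  exact ⟨v, (mem_near pos).2 hd, hv⟩

/-- If `u` hears a message while nobody within `ε / 3` transmits, the sender is farther than `ε /
3`, and the SINR condition leaves room for at most `(ε / 3) ^ (-α) + 1` transmitters in the unit
ball. The expected number there is at least `cε K / 128`, so the lower tail bound makes this case
improbable. -/
theorem Tuned.playoff_receives_le (hT : Tuned M C K k L E) (hκ : 1 ≤ M.κ)
    {act : V → ℝ} (h0 : ∀ v, 0 ≤ act v) (hmax : ∀ v, act v ≤ C.pMax) {u : V}
    (hu : K / 128 ≤ ∑ w ∈ near pos u 1, act w) :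
    avgProb (fun v => C.cε * act v) (fun T => Receives M pos T u)
      ≤ C.cε * ∑ w ∈ near pos u (M.ε / 3), act w + k / 128 := by
  have hα := M.γ_pos.trans M.γ_lt_α
  have hε := C.cε_pos
  set q : V → ℝ := fun v => C.cε * act v with hq
  have hq0 : ∀ v, 0 ≤ q v := fun v => mul_nonneg hε.le (h0 v)
  have hq1 : ∀ v, (clip (q v) : ℝ) = q v := fun v => by
    refine coe_clip_eq (hq0 v) ?_
    have := mul_le_mul_of_nonneg_left (hmax v) hε.le
    rw [hT.cε_mul_pMax] at this
    linarith [hT.k_le hκ]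
  have h1 := avgProb_exists_mem_le q (near pos u (M.ε / 3))
  have h2 := avgProb_card_le_le q (near pos u 1) ((M.ε / 3) ^ (-M.α) + 1)
  simp only [hq1] at h1 h2
  rw [hq, ← Finset.mul_sum] at h1
  have h3 : 2 ^ ((M.ε / 3) ^ (-M.α) + 1) * Real.exp (-(∑ v ∈ near pos u 1, q v) / 2)
      ≤ k / 128 := by
    refine le_trans (mul_le_mul_of_nonneg_left (Real.exp_le_exp.2 ?_) (by positivity))
      hT.playoff_silent
    rw [hq, ← Finset.mul_sum]
    have := mul_le_mul_of_nonneg_left hu hε.le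
    linarith
  refine le_trans ?_ (add_le_add h1 (h2.trans h3))
  unfold avgProb
  rw [← avg_add]
  refine avg_mono fun T => ?_
  by_cases hr : Receives M pos T u
  · obtain ⟨v, hv, hvu, hd, hc⟩ := hr.exists_sender pos
    by_cases hnear : ∃ w ∈ near pos u (M.ε / 3), w ∈ T
    · simp only [hr, if_true, if_pos hnear]
      split_ifs <;> norm_num
    · have hfar : M.ε / 3 < dist (pos u) (pos v) := by
        by_contra! h'
        exact hnear ⟨v, (mem_near pos).2 h', hv⟩
      have hcard : ((T ∩ near pos u 1).card : ℝ) ≤ (M.ε / 3) ^ (-M.α) + 1 := by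
        have := Real.rpow_le_rpow_of_nonpos (by linarith [M.ε_pos] : 0 < M.ε / 3) hfar.le
          (by linarith : -M.α ≤ 0)
        linarith
      simp only [hr, if_true, if_neg hnear, if_pos hcard]
      norm_num
  · simp only [hr, if_false]
    split_ifs <;> norm_num

end Tests

/-! ### Executions from a given state. -/

section Run

variable {X : Type*} [MetricSpace X] {V : Type*} [Fintype V]

/-- The distribution of the states of the stations after `j` rounds from round `t₀` on, when they
are `σ₀` at the beginning. -/
noncomputable def run (M : Model) (C : Constants) (pos : V ↪ X) (s : V) (t₀ : ℕ)
    (σ₀ : V → Station) : ℕ → PMF (V → Station)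
  | 0 => PMF.pure σ₀
  | j + 1 => (run M C pos s t₀ σ₀ j).bind (step M C pos s (t₀ + j))

variable (M : Model) (C : Constants) (pos : V ↪ X) (s : V)

theorem exec_add (t₀ j : ℕ) :
    exec M C pos s (t₀ + j) = (exec M C pos s t₀).bind fun σ => run M C pos s t₀ σ j := by
  induction j with
  | zero => simp [run]
  | succ j ih => rw [← add_assoc, exec, ih, PMF.bind_bind]; rfl

theorem mean_step (t : ℕ) (σ : V → Station) (f : (V → Station) → ℝ) (hf : ∀ σ, 0 ≤ f σ) :
    mean (step M C pos s t σ) (fun σ' => ENNReal.ofReal (f σ'))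
      = ENNReal.ofReal (avg (fun v => (σ v).transmitProb M C (Fintype.card V) (v = s) t)
        fun T => f fun v => (σ v).update C (Fintype.card V) t (Receives M pos T v)) := by
  rw [step, mean_map, mean_transmitters]
  exact fun T => hf _

theorem exists_update_of_mem_support_step {t : ℕ} {σ σ' : V → Station}
    (h : σ' ∈ (step M C pos s t σ).support) :
    ∃ T : Finset V, σ' = fun v => (σ v).update C (Fintype.card V) t (Receives M pos T v) := by
  rw [step, PMF.support_map] at h
  obtain ⟨T, -, rfl⟩ := h
  exact ⟨T, rfl⟩

/-- Handles the deterministic invariants, those preserved whatever set of stations transmits. -/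
theorem run_support_induction {t₀ : ℕ} {σ₀ : V → Station} (I : ℕ → (V → Station) → Prop)
    (h0 : I 0 σ₀) {J : ℕ}
    (hs : ∀ j < J, ∀ σ, I j σ → ∀ T : Finset V,
      I (j + 1) fun v => (σ v).update C (Fintype.card V) (t₀ + j) (Receives M pos T v)) :
    ∀ j ≤ J, ∀ σ ∈ (run M C pos s t₀ σ₀ j).support, I j σ := by
  intro j
  induction j with
  | zero =>
    intro _ σ hσ
    rw [run, PMF.support_pure, Set.mem_singleton_iff] at hσ
    rwa [hσ]
  | succ j ih =>
    intro hj σ hσ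
    rw [run, PMF.mem_support_bind_iff] at hσ
    obtain ⟨σ', h1, h2⟩ := hσ
    obtain ⟨T, rfl⟩ := exists_update_of_mem_support_step M C pos s h2
    exact hs j hj σ' (ih (Nat.le_of_succ_le hj) σ' h1) T

end Run

/-! ### The state change inside and at the end of an iteration. -/

section Update

open Classical

variable {C : Constants} {n t : ℕ}

theorem Station.update_of_mod_ne_zero (h : t < C.colorRounds n)
    (h' : (t + 1) % C.iterRounds n ≠ 0) (σ : Station) (heard : Prop) :
    σ.update C n t heard =
      { σ with
        densityCount := σ.densityCount +
          if t % C.iterRounds n < C.densityRounds n ∧ heard then 1 else 0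
        playoffCount := σ.playoffCount +
          if ¬ t % C.iterRounds n < C.densityRounds n ∧ heard then 1 else 0 } := by
  rw [Station.update, if_pos h]
  simp only [if_neg h']

theorem Station.update_of_mod_eq_zero (h : t < C.colorRounds n)
    (h' : (t + 1) % C.iterRounds n = 0) (σ : Station) (heard : Prop) :
    σ.update C n t heard =
      { densityCount := 0
        playoffCount := 0
        color :=
          if σ.color = none ∧ C.c₁ * Real.log n ≤ ((σ.densityCount +
              if t % C.iterRounds n < C.densityRounds n ∧ heard then 1 else 0 : ℕ) : ℝ) ∧
            C.c₃ * Real.log n ≤ ((σ.playoffCount +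
              if ¬ t % C.iterRounds n < C.densityRounds n ∧ heard then 1 else 0 : ℕ) : ℝ) then
            some (C.phaseProb n (t / C.phaseRounds n))
          else σ.color
        relayFrom := σ.relayFrom } := by
  rw [Station.update, if_pos h]
  simp only [if_pos h']

end Update

/-! ### Exponential moments of the message counters in one iteration of the two tests. -/

section Iteration

open Classical

variable {X : Type*} [MetricSpace X] {V : Type*} [Fintype V]

/-- The transmission probability of the stations that have not quit, in a phase of probability
`p`. -/
noncomputable def act (p : ℝ) (σ : V → Station) (v : V) : ℝ := if (σ v).color = none then p else 0

variable (M : Model) (C : Constants) (pos : V ↪ X)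

/-- The probability that `u` receives a message in a round of `DensityTest`. -/
noncomputable def densityProb (p : ℝ) (σ : V → Station) (u : V) : ℝ :=
  avgProb (act p σ) fun T => Receives M pos T u

/-- The probability that `u` receives a message in a round of `Playoff`. -/
noncomputable def playoffProb (p : ℝ) (σ : V → Station) (u : V) : ℝ :=
  avgProb (fun v => C.cε * act p σ v) fun T => Receives M pos T u

theorem densityProb_nonneg (p : ℝ) (σ : V → Station) (u : V) : 0 ≤ densityProb M pos p σ u :=
  avgProb_nonneg _ _

theorem densityProb_le_one (p : ℝ) (σ : V → Station) (u : V) : densityProb M pos p σ u ≤ 1 :=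
  avgProb_le_one _ _

theorem playoffProb_nonneg (p : ℝ) (σ : V → Station) (u : V) : 0 ≤ playoffProb M C pos p σ u :=
  avgProb_nonneg _ _

theorem playoffProb_le_one (p : ℝ) (σ : V → Station) (u : V) : playoffProb M C pos p σ u ≤ 1 :=
  avgProb_le_one _ _

/-- The first round of repetition `l` of phase `i`. -/
noncomputable def Constants.iterStart (n i l : ℕ) : ℕ := (i * C.c' + l) * C.iterRounds n

variable {C}

theorem Constants.iterStart_add_lt {n i l j : ℕ} (hi : i < C.numPhases n) (hl : l < C.c')
    (hj : j < C.iterRounds n) : C.iterStart n i l + j < C.colorRounds n := by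
  unfold iterStart colorRounds phaseRounds
  rw [← mul_assoc]
  calc (i * C.c' + l) * C.iterRounds n + j < (i * C.c' + l + 1) * C.iterRounds n := by
        rw [add_mul _ 1, one_mul]; omega
    _ ≤ C.numPhases n * C.c' * C.iterRounds n := by
        refine Nat.mul_le_mul_right _ ?_
        calc i * C.c' + l + 1 ≤ (i + 1) * C.c' := by rw [add_mul, one_mul]; omega
          _ ≤ _ := Nat.mul_le_mul_right _ hi

theorem Constants.iterStart_add_mod {n i l j : ℕ} (hj : j < C.iterRounds n) :
    (C.iterStart n i l + j) % C.iterRounds n = j := by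
  rw [iterStart, Nat.mul_add_mod_self_right, Nat.mod_eq_of_lt hj]

theorem Constants.iterStart_add_div {n i l j : ℕ} (hl : l < C.c') (hj : j < C.iterRounds n) :
    (C.iterStart n i l + j) / C.phaseRounds n = i := by
  have hlt : l * C.iterRounds n + j < C.phaseRounds n := by
    unfold phaseRounds
    calc l * C.iterRounds n + j < (l + 1) * C.iterRounds n := by rw [add_mul, one_mul]; omega
      _ ≤ _ := Nat.mul_le_mul_right _ hl
  have e : C.iterStart n i l + j = (l * C.iterRounds n + j) + i * C.phaseRounds n := by
    unfold iterStart phaseRounds; ring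
  rw [e, Nat.add_mul_div_right _ _ (by omega), Nat.div_eq_of_lt hlt, zero_add]

/-- Colors change only at the end of an iteration, so all rounds of one test use the same
transmission probabilities, determined by the initial state `σ₀`. -/
theorem transmitProb_iteration {s : V} {σ₀ σ : V → Station} {i l j : ℕ}
    (hi : i < C.numPhases (Fintype.card V)) (hl : l < C.c') (hj : j < C.iterRounds (Fintype.card V))
    (hc : ∀ v, (σ v).color = (σ₀ v).color) :
    (fun v => (σ v).transmitProb M C (Fintype.card V) (v = s)
        (C.iterStart (Fintype.card V) i l + j))
      = if j < C.densityRounds (Fintype.card V) then act (C.phaseProb (Fintype.card V) i) σ₀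
        else fun v => C.cε * act (C.phaseProb (Fintype.card V) i) σ₀ v := by
  ext v
  rw [Station.transmitProb, if_pos (Constants.iterStart_add_lt hi hl hj),
    Constants.iterStart_add_mod hj, Constants.iterStart_add_div hl hj, hc v]
  unfold act
  cases h : (σ₀ v).color <;> split_ifs <;> simp_all

/-- The factor by which the moment `x ^ densityCount * y ^ playoffCount` grows in round `j` of an
iteration. -/
noncomputable def momentFactor (D : ℕ) (rD rP x y : ℝ) (j : ℕ) : ℝ :=
  if j < D then 1 + (x - 1) * rD else 1 + (y - 1) * rP

theorem avg_moment {s : V} {σ₀ σ : V → Station} {i l j : ℕ}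
    (hi : i < C.numPhases (Fintype.card V)) (hl : l < C.c') (hj : j < C.iterRounds (Fintype.card V))
    (hc : ∀ v, (σ v).color = (σ₀ v).color) (u : V) (x y : ℝ) (d e : ℕ) :
    avg (fun v => (σ v).transmitProb M C (Fintype.card V) (v = s)
        (C.iterStart (Fintype.card V) i l + j)) (fun T =>
      x ^ (d + if j < C.densityRounds (Fintype.card V) ∧ Receives M pos T u then 1 else 0) *
      y ^ (e + if ¬ j < C.densityRounds (Fintype.card V) ∧ Receives M pos T u then 1 else 0))
      = x ^ d * y ^ e * momentFactor (C.densityRounds (Fintype.card V))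
        (densityProb M pos (C.phaseProb (Fintype.card V) i) σ₀ u)
        (playoffProb M C pos (C.phaseProb (Fintype.card V) i) σ₀ u) x y j := by
  rw [transmitProb_iteration M hi hl hj hc, momentFactor]
  by_cases hd : j < C.densityRounds (Fintype.card V)
  · simp only [hd, if_true, true_and, not_true_eq_false, false_and, if_false, add_zero]
    rw [densityProb, ← avg_ite, ← avg_const_mul]
    congr 1
    ext T
    split_ifs <;> ring
  · simp only [hd, if_false, false_and, not_false_eq_true, true_and, add_zero]
    rw [playoffProb, ← avg_ite, ← avg_const_mul]
    congr 1
    ext T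
    split_ifs <;> ring

theorem momentFactor_nonneg {D : ℕ} {rD rP x y : ℝ} (hD : 0 ≤ rD) (hD1 : rD ≤ 1) (hP : 0 ≤ rP)
    (hP1 : rP ≤ 1) (hx : 0 ≤ x) (hy : 0 ≤ y) (j : ℕ) : 0 ≤ momentFactor D rD rP x y j := by
  unfold momentFactor
  split_ifs <;> nlinarith

/-- No counter is running. -/
def Clean (σ : V → Station) : Prop := ∀ v, (σ v).densityCount = 0 ∧ (σ v).playoffCount = 0

theorem run_color_eq {s : V} {σ₀ : V → Station} {i l j : ℕ}
    (hi : i < C.numPhases (Fintype.card V)) (hl : l < C.c') (hj : j < C.iterRounds (Fintype.card V)) :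
    ∀ σ ∈ (run M C pos s (C.iterStart (Fintype.card V) i l) σ₀ j).support,
      ∀ v, (σ v).color = (σ₀ v).color ∧ (σ v).relayFrom = (σ₀ v).relayFrom := by
  refine run_support_induction M C pos s
    (I := fun _ σ => ∀ v, (σ v).color = (σ₀ v).color ∧ (σ v).relayFrom = (σ₀ v).relayFrom)
    (fun v => ⟨rfl, rfl⟩) (J := j) (fun j' hj' σ h T v => ?_) j le_rfl
  beta_reduce
  rw [Station.update_of_mod_ne_zero (Constants.iterStart_add_lt hi hl (hj'.trans hj))]
  · exact h v
  · rw [add_assoc, Constants.iterStart_add_mod (by omega)]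
    omega

/-- Each round multiplies the conditional moment by a factor that depends only on `σ₀`. The last
round is excluded because it resets the counters. -/
theorem mean_run_moment {s : V} {σ₀ : V → Station} (hclean : Clean σ₀) {i l : ℕ}
    (hi : i < C.numPhases (Fintype.card V)) (hl : l < C.c') (u : V) {x y : ℝ} (hx : 0 ≤ x)
    (hy : 0 ≤ y) (j : ℕ) (hj : j < C.iterRounds (Fintype.card V)) :
    mean (run M C pos s (C.iterStart (Fintype.card V) i l) σ₀ j)
        (fun σ => ENNReal.ofReal (x ^ (σ u).densityCount * y ^ (σ u).playoffCount))
      = ENNReal.ofReal (∏ r ∈ Finset.range j, momentFactor (C.densityRounds (Fintype.card V))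
        (densityProb M pos (C.phaseProb (Fintype.card V) i) σ₀ u)
        (playoffProb M C pos (C.phaseProb (Fintype.card V) i) σ₀ u) x y r) := by
  induction j with
  | zero => simp [run, mean_pure, (hclean u).1, (hclean u).2]
  | succ j ih =>
    have hj' : j < C.iterRounds (Fintype.card V) := by omega
    have hF := momentFactor_nonneg (D := C.densityRounds (Fintype.card V))
      (densityProb_nonneg M pos (C.phaseProb (Fintype.card V) i) σ₀ u)
      (densityProb_le_one M pos _ σ₀ u)
      (playoffProb_nonneg M C pos (C.phaseProb (Fintype.card V) i) σ₀ u)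
      (playoffProb_le_one M C pos _ σ₀ u) hx hy j
    rw [run, mean_bind, Finset.prod_range_succ, mul_comm, ENNReal.ofReal_mul hF, ← ih hj',
      ← mean_const_mul]
    have hcol := run_color_eq M pos (s := s) (σ₀ := σ₀) hi hl hj'
    have key : ∀ σ ∈ (run M C pos s (C.iterStart (Fintype.card V) i l) σ₀ j).support,
        mean (step M C pos s (C.iterStart (Fintype.card V) i l + j) σ)
          (fun σ => ENNReal.ofReal (x ^ (σ u).densityCount * y ^ (σ u).playoffCount))
        = ENNReal.ofReal (momentFactor (C.densityRounds (Fintype.card V))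
          (densityProb M pos (C.phaseProb (Fintype.card V) i) σ₀ u)
          (playoffProb M C pos (C.phaseProb (Fintype.card V) i) σ₀ u) x y j)
          * ENNReal.ofReal (x ^ (σ u).densityCount * y ^ (σ u).playoffCount) := by
      intro σ hσ
      rw [mean_step _ _ _ _ _ _ (fun σ => x ^ (σ u).densityCount * y ^ (σ u).playoffCount)
        (fun σ => by positivity), ← ENNReal.ofReal_mul hF, mul_comm (momentFactor _ _ _ _ _ _),
        ← avg_moment M pos (s := s) hi hl hj' (fun v => (hcol σ hσ v).1)]
      congr 2
      ext T
      beta_reduce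
      rw [Station.update_of_mod_ne_zero (Constants.iterStart_add_lt hi hl hj')]
      · simp only [Constants.iterStart_add_mod hj']
      · rw [add_assoc, Constants.iterStart_add_mod (by omega)]
        omega
    exact le_antisymm (mean_mono fun σ hσ => (key σ hσ).le) (mean_mono fun σ hσ => (key σ hσ).ge)

/-- The moment of the final counts, on which the decision to quit depends. As they are never stored,
the last round is averaged over its transmitters before the update. -/
theorem avg_iteration_last {s : V} {σ₀ : V → Station} (hclean : Clean σ₀) {i l : ℕ}
    (hi : i < C.numPhases (Fintype.card V)) (hl : l < C.c') (u : V) {x y : ℝ} (hx : 0 ≤ x)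
    (hy : 0 ≤ y) {j : ℕ} (hj : j + 1 = C.iterRounds (Fintype.card V)) :
    mean (run M C pos s (C.iterStart (Fintype.card V) i l) σ₀ j) (fun σ =>
      ENNReal.ofReal (avg (fun v => (σ v).transmitProb M C (Fintype.card V) (v = s)
          (C.iterStart (Fintype.card V) i l + j)) (fun T =>
        x ^ ((σ u).densityCount +
          if j < C.densityRounds (Fintype.card V) ∧ Receives M pos T u then 1 else 0) *
        y ^ ((σ u).playoffCount +
          if ¬ j < C.densityRounds (Fintype.card V) ∧ Receives M pos T u then 1 else 0))))
      = ENNReal.ofReal ((1 + (x - 1) * densityProb M pos (C.phaseProb (Fintype.card V) i) σ₀ u)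
          ^ C.densityRounds (Fintype.card V)
        * (1 + (y - 1) * playoffProb M C pos (C.phaseProb (Fintype.card V) i) σ₀ u)
          ^ C.playoffRounds (Fintype.card V)) := by
  have hj' : j < C.iterRounds (Fintype.card V) := by omega
  have hF := momentFactor_nonneg (D := C.densityRounds (Fintype.card V))
      (densityProb_nonneg M pos (C.phaseProb (Fintype.card V) i) σ₀ u)
      (densityProb_le_one M pos _ σ₀ u)
      (playoffProb_nonneg M C pos (C.phaseProb (Fintype.card V) i) σ₀ u)
      (playoffProb_le_one M C pos _ σ₀ u) hx hy
  have hcol := run_color_eq M pos (s := s) (σ₀ := σ₀) hi hl hj'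
  have hprod : (1 + (x - 1) * densityProb M pos (C.phaseProb (Fintype.card V) i) σ₀ u)
          ^ C.densityRounds (Fintype.card V)
        * (1 + (y - 1) * playoffProb M C pos (C.phaseProb (Fintype.card V) i) σ₀ u)
          ^ C.playoffRounds (Fintype.card V)
      = ∏ r ∈ Finset.range (j + 1), momentFactor (C.densityRounds (Fintype.card V))
        (densityProb M pos (C.phaseProb (Fintype.card V) i) σ₀ u)
        (playoffProb M C pos (C.phaseProb (Fintype.card V) i) σ₀ u) x y r := by
    rw [hj, Constants.iterRounds, Finset.prod_range_add]
    congr 1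
    · rw [Finset.prod_congr rfl fun r hr => ?_, Finset.prod_const, Finset.card_range]
      rw [momentFactor, if_pos (Finset.mem_range.1 hr)]
    · rw [Finset.prod_congr rfl fun r hr => ?_, Finset.prod_const, Finset.card_range]
      rw [momentFactor, if_neg (by omega)]
  rw [hprod, Finset.prod_range_succ, mul_comm, ENNReal.ofReal_mul (hF j),
    ← mean_run_moment M pos (s := s) hclean hi hl u hx hy j hj', ← mean_const_mul]
  have key : ∀ σ ∈ (run M C pos s (C.iterStart (Fintype.card V) i l) σ₀ j).support, _ = _ :=
    fun σ hσ => congrArg ENNReal.ofReal (avg_moment M pos (s := s) hi hl hj'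
      (fun v => (hcol σ hσ v).1) u x y (σ u).densityCount (σ u).playoffCount)
  refine le_antisymm (mean_mono fun σ hσ => ?_) (mean_mono fun σ hσ => ?_)
  · rw [key σ hσ, ← ENNReal.ofReal_mul (hF j), mul_comm]
  · rw [key σ hσ, ← ENNReal.ofReal_mul (hF j), mul_comm]

theorem ite_one_zero_le {P : Prop} [Decidable P] {a : ℝ} (ha : 0 ≤ a) (h : P → 1 ≤ a) :
    (if P then 1 else 0) ≤ a := by
  split_ifs with hP
  · exact h hP
  · exact ha

/-- Exponential moment bound for the outcome of an iteration at a station that has not quit. -/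
theorem eprob_run_color_le {s : V} {σ₀ : V → Station} (hclean : Clean σ₀) {i l : ℕ}
    (hi : i < C.numPhases (Fintype.card V)) (hl : l < C.c')
    (hR : 0 < C.iterRounds (Fintype.card V)) (u : V) (hu : (σ₀ u).color = none)
    (F : Option ℝ → Prop) {x y a b : ℝ} (hx : 0 ≤ x) (hy : 0 ≤ y) (ha : 0 ≤ a) (hb : 0 ≤ b)
    (hF : ∀ d e : ℕ, F (if C.c₁ * Real.log (Fintype.card V) ≤ d ∧
        C.c₃ * Real.log (Fintype.card V) ≤ e then some (C.phaseProb (Fintype.card V) i) else none) →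
      1 ≤ a * x ^ d + b * y ^ e) :
    eprob (run M C pos s (C.iterStart (Fintype.card V) i l) σ₀ (C.iterRounds (Fintype.card V)))
        {σ | F (σ u).color}
      ≤ ENNReal.ofReal (a * (1 + (x - 1) *
          densityProb M pos (C.phaseProb (Fintype.card V) i) σ₀ u) ^
            C.densityRounds (Fintype.card V) +
        b * (1 + (y - 1) * playoffProb M C pos (C.phaseProb (Fintype.card V) i) σ₀ u) ^
            C.playoffRounds (Fintype.card V)) := by
  obtain ⟨j, hj⟩ : ∃ j, C.iterRounds (Fintype.card V) = j + 1 := ⟨_, (Nat.succ_pred_eq_of_pos hR).symm⟩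
  have hj' : j < C.iterRounds (Fintype.card V) := by omega
  have hcol := run_color_eq M pos (s := s) (σ₀ := σ₀) hi hl hj'
  -- Base `1` for one counter makes it disappear, so the two tests are bounded separately.
  have h1 := avg_iteration_last M pos (s := s) hclean hi hl u hx zero_le_one hj.symm
  have h2 := avg_iteration_last M pos (s := s) hclean hi hl u zero_le_one hy hj.symm
  simp only [sub_self, zero_mul, add_zero, one_pow, mul_one, one_mul] at h1 h2
  have hD0 : 0 ≤ 1 + (x - 1) * densityProb M pos (C.phaseProb (Fintype.card V) i) σ₀ u := by
    nlinarith [densityProb_nonneg M pos (C.phaseProb (Fintype.card V) i) σ₀ u,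
      densityProb_le_one M pos (C.phaseProb (Fintype.card V) i) σ₀ u]
  have hP0 : 0 ≤ 1 + (y - 1) * playoffProb M C pos (C.phaseProb (Fintype.card V) i) σ₀ u := by
    nlinarith [playoffProb_nonneg M C pos (C.phaseProb (Fintype.card V) i) σ₀ u,
      playoffProb_le_one M C pos (C.phaseProb (Fintype.card V) i) σ₀ u]
  rw [ENNReal.ofReal_add (by positivity) (by positivity), ENNReal.ofReal_mul ha,
    ENNReal.ofReal_mul hb, ← h1, ← h2, ← mean_const_mul, ← mean_const_mul, ← mean_add]
  conv_lhs => rw [hj, run, eprob_bind]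
  refine mean_mono fun σ hσ => ?_
  rw [← ENNReal.ofReal_mul ha, ← ENNReal.ofReal_mul hb,
    ← ENNReal.ofReal_add (mul_nonneg ha (avg_nonneg fun T => by positivity))
      (mul_nonneg hb (avg_nonneg fun T => by positivity)),
    ← avg_const_mul, ← avg_const_mul, ← avg_add]
  have hind : ({σ | F (σ u).color} : Set (V → Station)).indicator (1 : (V → Station) → ENNReal)
      = fun σ => ENNReal.ofReal (if F (σ u).color then 1 else 0) := by
    ext σ
    by_cases h : F (σ u).color <;> simp [h]
  rw [eprob, hind, mean_step _ _ _ _ _ _ (fun σ => if F (σ u).color then 1 else 0)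
    (fun σ => by split_ifs <;> norm_num)]
  refine ENNReal.ofReal_le_ofReal (avg_mono fun T => ?_)
  beta_reduce
  rw [Station.update_of_mod_eq_zero (Constants.iterStart_add_lt hi hl hj')
    (by rw [add_assoc, ← hj, Constants.iterStart]; simp)]
  simp only [Constants.iterStart_add_mod hj', Constants.iterStart_add_div hl hj', (hcol σ hσ u).1,
    hu, true_and]
  exact ite_one_zero_le (by positivity) (hF _ _)

end Iteration

/-! ### Numerical Chernoff bounds. -/

section Tails

/-- Rounding up at most doubles the number `c ℓ` of rounds, so the moment is at most `exp (h c ℓ /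
8)`. The threshold `h c ℓ / 4` gains `(log 2) / 4`, and `(log 2) / 4 - 1 / 8 > 1 / 24`. -/
theorem upper_tail_le {h c ℓ r E : ℝ} (hh : 0 < h) (hc : 0 < c) (hℓ : 0 ≤ ℓ) (h1 : 1 ≤ c * ℓ)
    (hr0 : 0 ≤ r) (hr : r ≤ h / 16) (hE : 24 * E ≤ h * c) :
    2 ^ (-(h / 4 * c * ℓ)) * (1 + (2 - 1) * r) ^ ⌈c * ℓ⌉₊ ≤ Real.exp (-(E * ℓ)) := by
  have hR : (⌈c * ℓ⌉₊ : ℝ) ≤ 2 * (c * ℓ) := by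
    have := Nat.ceil_lt_add_one (by linarith : 0 ≤ c * ℓ)
    linarith
  have h2 : (1 + (2 - 1) * r) ^ ⌈c * ℓ⌉₊ ≤ Real.exp (h / 16 * (2 * (c * ℓ))) := by
    calc (1 + (2 - 1) * r) ^ ⌈c * ℓ⌉₊ ≤ Real.exp r ^ ⌈c * ℓ⌉₊ := by
          refine pow_le_pow_left₀ (by linarith) ?_ _
          linarith [Real.add_one_le_exp r]
      _ = Real.exp (⌈c * ℓ⌉₊ * r) := (Real.exp_nat_mul _ _).symm
      _ ≤ _ := by
          refine Real.exp_le_exp.2 ?_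
          rw [mul_comm]
          exact mul_le_mul hr hR (by positivity) (by positivity)
  have h3 : (2 : ℝ) ^ (-(h / 4 * c * ℓ)) = Real.exp (-(Real.log 2 * (h / 4 * c * ℓ))) := by
    rw [Real.rpow_def_of_pos two_pos, mul_neg]
  rw [h3]
  refine (mul_le_mul_of_nonneg_left h2 (Real.exp_pos _).le).trans ?_
  rw [← Real.exp_add]
  refine Real.exp_le_exp.2 ?_
  have hl := Real.log_two_gt_d9
  have h4 : 0 ≤ h * c * ℓ := by positivity
  have h5 := mul_le_mul_of_nonneg_right hE hℓ
  nlinarith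

/-- Here the moment is at most `exp (-(h c ℓ / 2))`, and `1 / 2 - (log 2) / 4 > 1 / 24`. -/
theorem lower_tail_le {h c ℓ r E : ℝ} (hh : 0 < h) (hc : 0 < c) (hℓ : 0 ≤ ℓ)
    (hr : h ≤ r) (hr1 : r ≤ 1) (hE : 24 * E ≤ h * c) :
    2 ^ (h / 4 * c * ℓ) * (1 + (1 / 2 - 1) * r) ^ ⌈c * ℓ⌉₊ ≤ Real.exp (-(E * ℓ)) := by
  have hR : c * ℓ ≤ (⌈c * ℓ⌉₊ : ℝ) := Nat.le_ceil _
  have h2 : (1 + (1 / 2 - 1) * r) ^ ⌈c * ℓ⌉₊ ≤ Real.exp (-(h / 2 * (c * ℓ))) := by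
    calc (1 + (1 / 2 - 1) * r) ^ ⌈c * ℓ⌉₊ ≤ Real.exp (-(h / 2)) ^ ⌈c * ℓ⌉₊ := by
          refine pow_le_pow_left₀ (by linarith) ?_ _
          linarith [Real.add_one_le_exp (-(h / 2))]
      _ = Real.exp (⌈c * ℓ⌉₊ * -(h / 2)) := (Real.exp_nat_mul _ _).symm
      _ ≤ _ := by
          refine Real.exp_le_exp.2 ?_
          nlinarith
  have h3 : (2 : ℝ) ^ (h / 4 * c * ℓ) = Real.exp (Real.log 2 * (h / 4 * c * ℓ)) := by
    rw [Real.rpow_def_of_pos two_pos]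
  rw [h3]
  refine (mul_le_mul_of_nonneg_left h2 (Real.exp_pos _).le).trans ?_
  rw [← Real.exp_add]
  refine Real.exp_le_exp.2 ?_
  have hl := Real.log_two_lt_d9
  have h4 : 0 ≤ h * c * ℓ := by positivity
  have h5 := mul_le_mul_of_nonneg_right hE hℓ
  nlinarith

end Tails

/-! ### The tests of one iteration rarely go wrong. -/

section Outcome

open Classical

variable {X : Type*} [MetricSpace X] {V : Type*} [Fintype V]

/-- The possible outcomes of an iteration. -/
structure IterOutcome (p : ℝ) (σ₀ σ : V → Station) : Prop where
  clean : Clean σ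
  relayFrom_eq : ∀ u, (σ u).relayFrom = (σ₀ u).relayFrom
  color_eq : ∀ u, (σ₀ u).color ≠ none → (σ u).color = (σ₀ u).color
  color_new : ∀ u, (σ₀ u).color = none → (σ u).color = none ∨ (σ u).color = some p

/-- The outcomes of an iteration in which the tests do not go wrong. -/
structure IterGood (M : Model) (C : Constants) (pos : V ↪ X) (K k p : ℝ) (σ₀ σ : V → Station) :
    Prop extends IterOutcome p σ₀ σ where
  density_of_quit : ∀ u, (σ₀ u).color = none → (σ u).color ≠ none →
    K / 8 / 16 < densityProb M pos p σ₀ u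
  playoff_of_quit : ∀ u, (σ₀ u).color = none → (σ u).color ≠ none →
    k / 4 / 16 < playoffProb M C pos p σ₀ u
  quit : ∀ u, (σ₀ u).color = none → K / 8 ≤ densityProb M pos p σ₀ u →
    k / 4 ≤ playoffProb M C pos p σ₀ u → (σ u).color ≠ none

variable {M : Model} {C : Constants} (pos : V ↪ X) {K k : ℝ} {L : ℕ} {E : ℝ}

theorem run_iterOutcome {s : V} {σ₀ : V → Station} {i l : ℕ}
    (hi : i < C.numPhases (Fintype.card V)) (hl : l < C.c')
    (hR : 0 < C.iterRounds (Fintype.card V)) :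
    ∀ σ ∈ (run M C pos s (C.iterStart (Fintype.card V) i l) σ₀
      (C.iterRounds (Fintype.card V))).support,
      IterOutcome (C.phaseProb (Fintype.card V) i) σ₀ σ := by
  intro σ hσ
  obtain ⟨j, hj⟩ : ∃ j, C.iterRounds (Fintype.card V) = j + 1 :=
    ⟨_, (Nat.succ_pred_eq_of_pos hR).symm⟩
  have hj' : j < C.iterRounds (Fintype.card V) := by omega
  rw [hj, run, PMF.mem_support_bind_iff] at hσ
  obtain ⟨σ', h1, h2⟩ := hσ
  obtain ⟨T, rfl⟩ := exists_update_of_mem_support_step M C pos s h2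
  have hcol := run_color_eq M pos (s := s) (σ₀ := σ₀) hi hl hj' σ' h1
  have hup : ∀ v, (σ' v).update C (Fintype.card V) (C.iterStart (Fintype.card V) i l + j)
      (Receives M pos T v) = _ := fun v =>
    Station.update_of_mod_eq_zero (Constants.iterStart_add_lt hi hl hj')
      (by rw [add_assoc, ← hj, Constants.iterStart]; simp) (σ' v) (Receives M pos T v)
  refine ⟨fun v => ?_, fun v => ?_, fun v hv => ?_, fun v hv => ?_⟩
  · rw [hup]; exact ⟨rfl, rfl⟩
  · rw [hup]; exact (hcol v).2
  · rw [hup]; simp [(hcol v).1, hv]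
  · rw [hup]
    simp only [Constants.iterStart_add_mod hj', Constants.iterStart_add_div hl hj', (hcol v).1, hv,
      true_and]
    exact (ite_eq_or_eq _ _ _).symm

/-- Each station has three ways to go wrong: quitting with a small success probability in
DensityTest, the same for Playoff, and staying although both probabilities are large. The last means
that one of two counters is too small, so a station costs four tails. The success probabilities are
functions of `σ₀`; where the condition on them fails, the event is empty. -/
theorem Tuned.eprob_not_iterGood_le (hT : Tuned M C K k L E) (hn : 2 ≤ Fintype.card V) {s : V}
    {σ₀ : V → Station} (hclean : Clean σ₀) {i l : ℕ}
    (hi : i < C.numPhases (Fintype.card V)) (hl : l < C.c') :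
    eprob (run M C pos s (C.iterStart (Fintype.card V) i l) σ₀ (C.iterRounds (Fintype.card V)))
        {σ | IterGood M C pos K k (C.phaseProb (Fintype.card V) i) σ₀ σ}ᶜ
      ≤ ENNReal.ofReal (4 * Fintype.card V * Real.exp (-(E * Real.log (Fintype.card V)))) := by
  have hK := hT.K_pos
  have hk := hT.k_pos
  have hn' : (2 : ℝ) ≤ Fintype.card V := by exact_mod_cast hn
  have hlog : Real.log 2 ≤ Real.log (Fintype.card V) := Real.log_le_log two_pos hn'
  have hlog0 : 0 ≤ Real.log (Fintype.card V) := (Real.log_nonneg one_le_two).trans hlog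
  have h0 : 1 ≤ C.c₀ * Real.log (Fintype.card V) :=
    hT.one_le_c₀.trans (mul_le_mul_of_nonneg_left hlog C.c₀_pos.le)
  have h2 : 1 ≤ C.c₂ * Real.log (Fintype.card V) :=
    hT.one_le_c₂.trans (mul_le_mul_of_nonneg_left hlog C.c₂_pos.le)
  have hR : 0 < C.iterRounds (Fintype.card V) := by
    unfold Constants.iterRounds Constants.densityRounds
    have : 0 < ⌈C.c₀ * Real.log (Fintype.card V)⌉₊ := Nat.ceil_pos.2 (by linarith)
    omega
  set p := C.phaseProb (Fintype.card V) i with hp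
  set ℓ := Real.log (Fintype.card V) with hℓ
  set μ := run M C pos s (C.iterStart (Fintype.card V) i l) σ₀ (C.iterRounds (Fintype.card V))
    with hμ
  set e := Real.exp (-(E * ℓ)) with he
  have he0 : 0 < e := Real.exp_pos _
  let B₁ : V → Set (V → Station) := fun u => {σ | (σ₀ u).color = none ∧ (σ u).color ≠ none ∧
    densityProb M pos p σ₀ u ≤ K / 8 / 16}
  let B₂ : V → Set (V → Station) := fun u => {σ | (σ₀ u).color = none ∧ (σ u).color ≠ none ∧
    playoffProb M C pos p σ₀ u ≤ k / 4 / 16}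
  let B₃ : V → Set (V → Station) := fun u => {σ | (σ₀ u).color = none ∧ (σ u).color = none ∧
    K / 8 ≤ densityProb M pos p σ₀ u ∧ k / 4 ≤ playoffProb M C pos p σ₀ u}
  have hsub : eprob μ {σ | IterGood M C pos K k p σ₀ σ}ᶜ ≤ eprob μ (⋃ u, B₁ u ∪ B₂ u ∪ B₃ u) := by
    refine eprob_mono fun σ hσ hbad => ?_
    by_contra hgood
    refine hbad ⟨run_iterOutcome pos hi hl hR σ hσ, fun u h1 h2 => ?_, fun u h1 h2 => ?_,
      fun u h1 h2 h3 h4 => ?_⟩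
    · by_contra! h3
      exact hgood (Set.mem_iUnion.2 ⟨u, Or.inl (Or.inl ⟨h1, h2, h3⟩)⟩)
    · by_contra! h3
      exact hgood (Set.mem_iUnion.2 ⟨u, Or.inl (Or.inr ⟨h1, h2, h3⟩)⟩)
    · exact hgood (Set.mem_iUnion.2 ⟨u, Or.inr ⟨h1, h4, h2, h3⟩⟩)
  have hquit : ∀ d e : ℕ, (if C.c₁ * ℓ ≤ d ∧ C.c₃ * ℓ ≤ e then some p else none) ≠ none →
      C.c₁ * ℓ ≤ d ∧ C.c₃ * ℓ ≤ e := fun d e h => by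
    by_contra hc
    simp [hc] at h
  have hpow : ∀ (t : ℝ) (d : ℕ), t ≤ d → (1 : ℝ) ≤ 2 ^ (-t) * 2 ^ d := fun t d h => by
    rw [← Real.rpow_natCast 2 d, ← Real.rpow_add two_pos]
    exact Real.one_le_rpow one_le_two (by linarith)
  have hpow' : ∀ (t : ℝ) (d : ℕ), ¬ t ≤ d → (1 : ℝ) ≤ 2 ^ t * (1 / 2) ^ d := fun t d h => by
    rw [one_div, inv_pow, ← Real.rpow_natCast 2 d, ← Real.rpow_neg zero_le_two,
      ← Real.rpow_add two_pos]
    exact Real.one_le_rpow one_le_two (by linarith)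
  have e₁ : ∀ u, eprob μ (B₁ u) ≤ ENNReal.ofReal e := fun u => by
    by_cases hu : (σ₀ u).color = none ∧ densityProb M pos p σ₀ u ≤ K / 8 / 16
    · refine (eprob_mono (B := {σ | (σ u).color ≠ none}) fun σ _ h => h.2.1).trans
        ((eprob_run_color_le M pos hclean hi hl hR u hu.1 (fun o => o ≠ none) (x := 2) (y := 1)
          (a := 2 ^ (-(C.c₁ * ℓ))) (b := 0) zero_le_two zero_le_one (by positivity) le_rfl
          fun d e' h => ?_).trans (ENNReal.ofReal_le_ofReal ?_))
      · rw [zero_mul, add_zero]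
        exact hpow _ _ (hquit d e' h).1
      · rw [zero_mul, add_zero, hT.c₁_eq]
        exact upper_tail_le (by positivity) C.c₀_pos hlog0 h0 (densityProb_nonneg _ _ _ _ _) hu.2
          hT.density_tail
    · refine (eprob_mono (B := ∅) fun σ _ h => hu ⟨h.1, h.2.2⟩).trans ?_
      simp [eprob, mean]
  have e₂ : ∀ u, eprob μ (B₂ u) ≤ ENNReal.ofReal e := fun u => by
    by_cases hu : (σ₀ u).color = none ∧ playoffProb M C pos p σ₀ u ≤ k / 4 / 16
    · refine (eprob_mono (B := {σ | (σ u).color ≠ none}) fun σ _ h => h.2.1).trans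
        ((eprob_run_color_le M pos hclean hi hl hR u hu.1 (fun o => o ≠ none) (x := 1) (y := 2)
          (b := 2 ^ (-(C.c₃ * ℓ))) (a := 0) zero_le_one zero_le_two le_rfl (by positivity)
          fun d e' h => ?_).trans (ENNReal.ofReal_le_ofReal ?_))
      · rw [zero_mul, zero_add]
        exact hpow _ _ (hquit d e' h).2
      · rw [zero_mul, zero_add, hT.c₃_eq]
        exact upper_tail_le (by positivity) C.c₂_pos hlog0 h2 (playoffProb_nonneg _ _ _ _ _ _) hu.2
          hT.playoff_tail
    · refine (eprob_mono (B := ∅) fun σ _ h => hu ⟨h.1, h.2.2⟩).trans ?_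
      simp [eprob, mean]
  have e₃ : ∀ u, eprob μ (B₃ u) ≤ ENNReal.ofReal (e + e) := fun u => by
    by_cases hu : (σ₀ u).color = none ∧ K / 8 ≤ densityProb M pos p σ₀ u ∧
        k / 4 ≤ playoffProb M C pos p σ₀ u
    · refine (eprob_mono (B := {σ | (σ u).color = none}) fun σ _ h => h.2.1).trans
        ((eprob_run_color_le M pos hclean hi hl hR u hu.1 (fun o => o = none) (x := 1 / 2)
          (y := 1 / 2) (a := 2 ^ (C.c₁ * ℓ)) (b := 2 ^ (C.c₃ * ℓ)) (by norm_num) (by norm_num)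
          (by positivity) (by positivity) fun d e' h => ?_).trans (ENNReal.ofReal_le_ofReal ?_))
      · by_cases hd : C.c₁ * ℓ ≤ d
        · have he' : ¬ C.c₃ * ℓ ≤ e' := fun he' => by simp [hd, he', ← hℓ] at h
          have := hpow' _ _ he'
          have : (0 : ℝ) ≤ 2 ^ (C.c₁ * ℓ) * (1 / 2) ^ d := by positivity
          linarith
        · have := hpow' _ _ hd
          have : (0 : ℝ) ≤ 2 ^ (C.c₃ * ℓ) * (1 / 2) ^ e' := by positivity
          linarith
      · rw [hT.c₁_eq, hT.c₃_eq]
        exact add_le_add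
          (lower_tail_le (by positivity) C.c₀_pos hlog0 hu.2.1 (densityProb_le_one _ _ _ _ _)
            hT.density_tail)
          (lower_tail_le (by positivity) C.c₂_pos hlog0 hu.2.2 (playoffProb_le_one _ _ _ _ _ _)
            hT.playoff_tail)
    · refine (eprob_mono (B := ∅) fun σ _ h => hu ⟨h.1, h.2.2⟩).trans ?_
      simp [eprob, mean]
  calc eprob μ {σ | IterGood M C pos K k p σ₀ σ}ᶜ
      ≤ ∑ u, eprob μ (B₁ u ∪ B₂ u ∪ B₃ u) := hsub.trans (eprob_iUnion_le _ _)
    _ ≤ ∑ _u : V, ENNReal.ofReal (4 * e) := by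
        refine Finset.sum_le_sum fun u _ => ?_
        refine (eprob_union_le _ _ _).trans ((add_le_add ((eprob_union_le _ _ _).trans
          (add_le_add (e₁ u) (e₂ u))) (e₃ u)).trans (le_of_eq ?_))
        rw [← ENNReal.ofReal_add he0.le he0.le, ← ENNReal.ofReal_add (by positivity) (by positivity)]
        congr 1; ring
    _ = ENNReal.ofReal (4 * Fintype.card V * e) := by
        rw [Finset.sum_const, Finset.card_univ, nsmul_eq_mul, ← ENNReal.ofReal_natCast,
          ← ENNReal.ofReal_mul (by positivity)]
        congr 1; ring

end Outcome

/-! ### Invariants of StabilizeProbability and the quality of the coloring. -/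

section Coloring

open Classical

variable {X : Type*} [MetricSpace X] {V : Type*} [Fintype V]

/-- The properties of the states at the beginning of repetition `l` of phase `i`. -/
structure ColorInv (M : Model) (C : Constants) (pos : V ↪ X) (s : V) (K k : ℝ) (i l : ℕ)
    (σ : V → Station) : Prop where
  clean : Clean σ
  relayFrom_eq : ∀ v, (σ v).relayFrom = (initState C s v).relayFrom
  color_nonneg : ∀ v c, (σ v).color = some c → 0 ≤ c
  act_le : ∀ x, ∑ w ∈ near pos x (1 / 6), act (C.phaseProb (Fintype.card V) i) σ w ≤ K
  progress : ∀ x, ∑ w ∈ near pos x (1 / 6), act (C.phaseProb (Fintype.card V) i) σ w ≤ K / 2 ∨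
    ∑ w ∈ near pos x (1 / 3), act (C.phaseProb (Fintype.card V) i) σ w
      ≤ M.κ * 4 ^ M.γ * K - l * (k / C.cε)
  upper : ∀ x, ∑ w ∈ near pos x (1 / 6), (σ w).color.getD (C.phaseProb (Fintype.card V) i)
    ≤ (i + 1) * K
  lower : ∀ v, (σ v).color ≠ none → k / (128 * C.cε) ≤ ∑ w ∈ near pos v (M.ε / 3),
    (σ w).color.getD (min (C.phaseProb (Fintype.card V) i) (2 * C.pMax))

/-- The properties of the coloring computed by `StabilizeProbability`. -/
structure GoodColoring (M : Model) (C : Constants) (pos : V ↪ X) (K k : ℝ) (σ : V → Station) :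
    Prop where
  nonneg : ∀ v, 0 ≤ (σ v).finalColor C
  upper : ∀ x, ∑ w ∈ near pos x (1 / 6), (σ w).finalColor C
    ≤ 10 * K * Real.log (Fintype.card V)
  lower : ∀ v, k / (128 * C.cε) ≤ ∑ w ∈ near pos v (M.ε / 3), (σ w).finalColor C

variable {M : Model} {C : Constants} (pos : V ↪ X) {K k : ℝ} {L : ℕ} {E : ℝ} {s : V}

theorem Constants.phaseProb_pos (C : Constants) {n : ℕ} (hn : 0 < n) (i : ℕ) :
    0 < C.phaseProb n i := by
  have := C.C₁_pos
  have : (0 : ℝ) < n := by exact_mod_cast hn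
  unfold phaseProb pStart
  positivity

theorem Constants.phaseProb_succ (C : Constants) (n i : ℕ) :
    C.phaseProb n (i + 1) = 2 * C.phaseProb n i := by
  unfold phaseProb; ring

theorem Constants.phaseProb_lt {C : Constants} {n i : ℕ} (hi : i < C.numPhases n) :
    C.phaseProb n i < C.pMax :=
  not_not.1 (Nat.notMem_of_lt_sInf hi)

theorem Constants.pMax_pos (C : Constants) : 0 < C.pMax := div_pos C.C₂_pos C.cε_pos

theorem Tuned.phaseProb_eq (hT : Tuned M C K k L E) (n i : ℕ) :
    C.phaseProb n i = 2 ^ i * (K / n) := by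
  rw [Constants.phaseProb, Constants.pStart, hT.C₁_eq, mul_div_mul_left _ _ two_ne_zero]

/-- After `log₂ n` doublings `K / n` has grown to at least `K ≥ pMax`. This shows that the loop
ends, i.e. that the infimum in `numPhases` is taken over a nonempty set, and bounds it. -/
theorem Tuned.pMax_le_phaseProb_clog (hT : Tuned M C K k L E) {n : ℕ} (hn : 0 < n) :
    C.pMax ≤ C.phaseProb n (Nat.clog 2 n) := by
  have hK := hT.K_pos
  have hn' : (0 : ℝ) < n := by exact_mod_cast hn
  have h1 : (n : ℝ) ≤ 2 ^ Nat.clog 2 n := by exact_mod_cast Nat.le_pow_clog one_lt_two n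
  have h2 : K ≤ C.phaseProb n (Nat.clog 2 n) := by
    rw [hT.phaseProb_eq]
    calc K = n * (K / n) := by field_simp
      _ ≤ _ := mul_le_mul_of_nonneg_right h1 (by positivity)
  linarith [hT.pMax_le]

theorem Tuned.pMax_le_phaseProb_numPhases (hT : Tuned M C K k L E) {n : ℕ} (hn : 0 < n) :
    C.pMax ≤ C.phaseProb n (C.numPhases n) := by
  have : C.numPhases n ∈ {i : ℕ | ¬ C.phaseProb n i < C.pMax} :=
    Nat.sInf_mem ⟨_, not_lt.2 (hT.pMax_le_phaseProb_clog hn)⟩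
  exact not_lt.1 this

theorem Tuned.numPhases_add_one_le (hT : Tuned M C K k L E) {n : ℕ} (hn : 2 ≤ n) :
    (C.numPhases n + 1 : ℝ) ≤ 5 * Real.log n := by
  have h1 : C.numPhases n ≤ Nat.clog 2 n :=
    Nat.sInf_le (not_lt.2 (hT.pMax_le_phaseProb_clog (by omega)))
  have hn' : (2 : ℝ) ≤ n := by exact_mod_cast hn
  have hlog : Real.log 2 ≤ Real.log n := Real.log_le_log two_pos hn'
  have hl := Real.log_two_gt_d9
  obtain ⟨c, hc⟩ : ∃ c, Nat.clog 2 n = c + 1 :=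
    ⟨_, (Nat.succ_pred_eq_of_pos (Nat.clog_pos one_lt_two hn)).symm⟩
  have h2 : 2 ^ c < n := by
    have := Nat.pow_pred_clog_lt_self one_lt_two hn
    rwa [hc] at this
  have h3 : c * Real.log 2 ≤ Real.log n := by
    rw [← Real.log_pow]
    exact Real.log_le_log (by positivity) (by exact_mod_cast h2.le)
  have h4 : (C.numPhases n : ℝ) ≤ c + 1 := by exact_mod_cast hc ▸ h1
  have h5 : (0 : ℝ) ≤ c := Nat.cast_nonneg c
  -- As `log n ≥ log 2`, the value `c + 2 ≤ log n / log 2 + 2` is at most `3 log n / log 2 < 5 log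
  -- n`.
  nlinarith

theorem act_nonneg {V : Type*} {p : ℝ} (hp : 0 ≤ p) (σ : V → Station) (v : V) : 0 ≤ act p σ v := by
  unfold act; split_ifs <;> simp [hp]

theorem act_le {V : Type*} {p : ℝ} (hp : 0 ≤ p) (σ : V → Station) (v : V) : act p σ v ≤ p := by
  unfold act; split_ifs <;> simp [hp]

theorem Tuned.colorInv_init (hT : Tuned M C K k L E) (hX : BoundedGrowth X M.γ M.κ) :
    ColorInv M C pos s K k 0 0 (initState C s) := by
  have hn : 0 < Fintype.card V := Fintype.card_pos_iff.2 ⟨s⟩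
  have hn' : (0 : ℝ) < Fintype.card V := by exact_mod_cast hn
  have hK := hT.K_pos
  have hp : C.phaseProb (Fintype.card V) 0 = K / Fintype.card V := by simp [hT.phaseProb_eq]
  have hp0 : 0 ≤ C.phaseProb (Fintype.card V) 0 := (C.phaseProb_pos hn 0).le
  have hsum : ∀ A : Finset V, ∑ _w ∈ A, C.phaseProb (Fintype.card V) 0 ≤ K := fun A => by
    rw [Finset.sum_const, nsmul_eq_mul, hp]
    calc (A.card : ℝ) * (K / Fintype.card V) ≤ Fintype.card V * (K / Fintype.card V) := by
          have : (A.card : ℝ) ≤ Fintype.card V := by exact_mod_cast A.card_le_univ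
          gcongr
      _ = K := by field_simp
  have hact : ∀ x, ∑ w ∈ near pos x (1 / 6),
      act (C.phaseProb (Fintype.card V) 0) (initState C s) w ≤ K := fun x =>
    (Finset.sum_le_sum fun w _ => act_le hp0 _ w).trans (hsum _)
  refine ⟨fun v => ⟨rfl, rfl⟩, fun v => rfl, fun v c h => by simp [initState] at h, hact,
    fun x => Or.inr ?_, fun x => ?_, fun v h => absurd rfl h⟩
  · have := sum_near_le pos hX (act_nonneg hp0 (initState C s)) (x := x) (d := 1 / 12) (k := K)
      (by norm_num) (c := 4) (by norm_num) hK.le (fun y _ => by norm_num; simpa using hact y)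
    norm_num at this ⊢
    exact this
  · simpa [initState] using hsum (near pos x (1 / 6))

theorem act_anti {V : Type*} {p : ℝ} (hp : 0 ≤ p) {σ₀ σ : V → Station} (h : IterOutcome p σ₀ σ) (v : V) :
    act p σ v ≤ act p σ₀ v := by
  by_cases hv : (σ₀ v).color = none
  · rw [act, act, if_pos hv]; split_ifs <;> simp [hp]
  · rw [act, act, if_neg hv, h.color_eq v hv, if_neg hv]

/-- A station that quits takes as color the current `p`, the very value with which `getD` counts an
active station. Sums of these values are therefore not changed by quitting. -/
theorem IterOutcome.getD_eq {V : Type*} {p : ℝ} {σ₀ σ : V → Station} (h : IterOutcome p σ₀ σ) (v : V) {q : ℝ}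
    (hq : q = p) : (σ v).color.getD q = (σ₀ v).color.getD q := by
  by_cases hv : (σ₀ v).color = none
  · rcases h.color_new v hv with h' | h' <;> simp [hv, h', hq]
  · rw [h.color_eq v hv]

/-- For `progress`: if a ball still has mass above `K / 2`, all stations of some small ball quit,
which removes mass `k / cε` from the ball of radius `1 / 3`. For `lower`: a station that has just
quit had success probabilities above `K / 128` and `k / 64`. The first bounds the mass of its unit
ball from below, and then the second leaves Playoff mass `k / 64 - k / 128` within `ε / 3`. -/
theorem Tuned.colorInv_succ (hT : Tuned M C K k L E) (hX : BoundedGrowth X M.γ M.κ)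
    {i l : ℕ} (hi : i < C.numPhases (Fintype.card V)) {σ₀ σ : V → Station}
    (h₀ : ColorInv M C pos s K k i l σ₀)
    (h : IterGood M C pos K k (C.phaseProb (Fintype.card V) i) σ₀ σ) :
    ColorInv M C pos s K k i (l + 1) σ := by
  have hn : 0 < Fintype.card V := Fintype.card_pos_iff.2 ⟨s⟩
  have hκ := hX.one_le (pos s)
  have hε := C.cε_pos
  have hpm := Constants.phaseProb_lt hi
  have hpMax := C.pMax_pos
  set p := C.phaseProb (Fintype.card V) i with hp
  have hp0 : 0 ≤ p := (C.phaseProb_pos hn i).le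
  have ha0 := act_nonneg hp0 σ₀
  have hanti := act_anti hp0 h.toIterOutcome
  have ham : ∀ v, act p σ₀ v ≤ C.pMax := fun v => (act_le hp0 σ₀ v).trans hpm.le
  -- The cap `2 * pMax`, the final color of stations that never quit, is inactive inside the loop.
  -- It makes `lower` usable at the end.
  have hmin : min p (2 * C.pMax) = p := min_eq_left (by linarith)
  refine ⟨h.clean, fun v => (h.relayFrom_eq v).trans (h₀.relayFrom_eq v), fun v c hc => ?_,
    fun x => (Finset.sum_le_sum fun w _ => hanti w).trans (h₀.act_le x), fun x => ?_, fun x => ?_,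
    fun v hv => ?_⟩
  · by_cases hv : (σ₀ v).color = none
    · rcases h.color_new v hv with h' | h'
      · rw [h'] at hc; exact absurd hc (by simp)
      · rw [h', Option.some_inj] at hc; exact hc ▸ hp0
    · exact h₀.color_nonneg v c (h.color_eq v hv ▸ hc)
  · by_cases hx : ∑ w ∈ near pos x (1 / 6), act p σ w ≤ K / 2
    · exact Or.inl hx
    refine Or.inr ?_
    have hx' : K / 2 < ∑ w ∈ near pos x (1 / 6), act p σ₀ w :=
      (not_le.1 hx).trans_le (Finset.sum_le_sum fun w _ => hanti w)
    have h2 := (h₀.progress x).resolve_left (not_le.2 hx')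
    obtain ⟨y, r, hsub, hmass, hrec⟩ := hT.exists_playoff_ball pos hX ha0 ham h₀.act_le hx'.le
    have hzero : ∀ u ∈ near pos y r, act p σ u = 0 := fun u hu => by
      by_cases hu0 : (σ₀ u).color = none
      · rw [act, if_neg]
        exact h.quit u hu0 (hT.le_density_receives pos hX ha0 ham h₀.act_le hx'.le
          ((mem_near pos).1 (hsub hu))) (hrec u hu)
      · refine le_antisymm ((hanti u).trans ?_) (act_nonneg hp0 _ _)
        rw [act, if_neg hu0]
    have hsplit : ∀ f : V → ℝ, ∑ w ∈ near pos x (1 / 3), f w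
        = ∑ w ∈ near pos x (1 / 3) \ near pos y r, f w + ∑ w ∈ near pos y r, f w := fun f =>
      (Finset.sum_sdiff hsub).symm
    rw [hsplit, Finset.sum_eq_zero hzero, add_zero]
    rw [hsplit] at h2
    have h3 : k / C.cε ≤ ∑ w ∈ near pos y r, act p σ₀ w := by
      rw [div_le_iff₀ hε, mul_comm, Finset.mul_sum]
      exact hmass
    have h4 : ∑ w ∈ near pos x (1 / 3) \ near pos y r, act p σ w
        ≤ ∑ w ∈ near pos x (1 / 3) \ near pos y r, act p σ₀ w :=
      Finset.sum_le_sum fun w _ => hanti w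
    push_cast
    linarith
  · rw [Finset.sum_congr rfl fun w _ => h.getD_eq w rfl]
    exact h₀.upper x
  · rw [Finset.sum_congr rfl fun w _ => h.getD_eq w hmin]
    by_cases hv0 : (σ₀ v).color = none
    · have h1 := h.density_of_quit v hv0 hv
      have h2 := h.playoff_of_quit v hv0 hv
      have h3 := avgProb_receives_le pos M ha0 v
      have h4 := hT.playoff_receives_le pos hκ ha0 ham (u := v)
        (by unfold densityProb at h1; linarith)
      unfold playoffProb at h2
      have h5 : k / (128 * C.cε) ≤ ∑ w ∈ near pos v (M.ε / 3), act p σ₀ w := by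
        rw [div_le_iff₀ (by positivity)]
        linarith
      refine h5.trans (Finset.sum_le_sum fun w _ => ?_)
      rw [hmin, act]
      cases hc : (σ₀ w).color with
      | none => simp
      | some c => simpa using h₀.color_nonneg w c hc
    · exact h₀.lower v hv0

theorem getD_mono {o : Option ℝ} {a b : ℝ} (h : a ≤ b) : o.getD a ≤ o.getD b := by
  cases o <;> simp [h]

/-- After `c'` repetitions the second alternative of `progress` would bound a mass by a negative
number. So all balls are down to `K / 2`, and doubling restores the bound `K`. It adds to the color
mass only the active mass, at most `K / 2`. -/
theorem Tuned.colorInv_phase (hT : Tuned M C K k L E) (hX : BoundedGrowth X M.γ M.κ)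
    {i : ℕ} {σ : V → Station} (h : ColorInv M C pos s K k i C.c' σ) :
    ColorInv M C pos s K k (i + 1) 0 σ := by
  have hn : 0 < Fintype.card V := Fintype.card_pos_iff.2 ⟨s⟩
  have hK := hT.K_pos
  have hsucc := C.phaseProb_succ (Fintype.card V) i
  have hp0 : 0 ≤ C.phaseProb (Fintype.card V) i := (C.phaseProb_pos hn i).le
  have hp0' : 0 ≤ C.phaseProb (Fintype.card V) (i + 1) := (C.phaseProb_pos hn _).le
  have hhalf : ∀ x, ∑ w ∈ near pos x (1 / 6), act (C.phaseProb (Fintype.card V) i) σ w ≤ K / 2 := by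
    refine fun x => (h.progress x).resolve_right fun h' => ?_
    have h1 : 0 ≤ ∑ w ∈ near pos x (1 / 3), act (C.phaseProb (Fintype.card V) i) σ w :=
      Finset.sum_nonneg fun w _ => act_nonneg hp0 σ w
    linarith [hT.repetitions]
  have hact : ∀ w, act (C.phaseProb (Fintype.card V) (i + 1)) σ w
      = 2 * act (C.phaseProb (Fintype.card V) i) σ w := fun w => by
    unfold act; rw [hsucc]; split_ifs <;> ring
  have hK' : ∀ x, ∑ w ∈ near pos x (1 / 6),
      act (C.phaseProb (Fintype.card V) (i + 1)) σ w ≤ K := fun x => by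
    simp only [hact]
    rw [← Finset.mul_sum]
    linarith [hhalf x]
  refine ⟨h.clean, h.relayFrom_eq, h.color_nonneg, hK', fun x => Or.inr ?_, fun x => ?_,
    fun v hv => ?_⟩
  · have := sum_near_le pos hX (act_nonneg hp0' σ) (x := x) (d := 1 / 12) (k := K)
      (by norm_num) (c := 4) (by norm_num) hK.le (fun y _ => by norm_num; simpa using hK' y)
    norm_num at this ⊢
    exact this
  · have e : ∀ w, (σ w).color.getD (C.phaseProb (Fintype.card V) (i + 1))
        = (σ w).color.getD (C.phaseProb (Fintype.card V) i)
          + act (C.phaseProb (Fintype.card V) i) σ w := fun w => by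
      unfold act
      cases (σ w).color with
      | none => simp [hsucc, two_mul]
      | some c => simp
    simp only [e]
    rw [Finset.sum_add_distrib]
    push_cast
    linarith [h.upper x, hhalf x]
  · exact (h.lower v hv).trans (Finset.sum_le_sum fun w _ =>
      getD_mono (min_le_min_right _ (by linarith)))

/-- Stations that never quit get `2 * pMax`, at most twice the last phase probability; this turns `5
K log n` into `10 K log n`. For the lower bound such a station suffices by itself, since `cε * pMax
= k / 8`. -/
theorem Tuned.goodColoring (hT : Tuned M C K k L E) (hn : 2 ≤ Fintype.card V)
    {σ : V → Station} (h : ColorInv M C pos s K k (C.numPhases (Fintype.card V)) 0 σ) :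
    GoodColoring M C pos K k σ := by
  have hK := hT.K_pos
  have hk := hT.k_pos
  have hε := C.cε_pos
  have hpMax := C.pMax_pos
  have hmax := hT.pMax_le_phaseProb_numPhases (n := Fintype.card V) (by omega)
  have h0 : ∀ v, 0 ≤ (σ v).finalColor C := fun v => by
    unfold Station.finalColor
    cases hc : (σ v).color with
    | none => simp [hpMax.le]
    | some c => simpa using h.color_nonneg v c hc
  refine ⟨h0, fun x => ?_, fun v => ?_⟩
  · calc ∑ w ∈ near pos x (1 / 6), (σ w).finalColor C
        ≤ ∑ w ∈ near pos x (1 / 6), 2 * (σ w).color.getD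
            (C.phaseProb (Fintype.card V) (C.numPhases (Fintype.card V))) := by
          refine Finset.sum_le_sum fun w _ => ?_
          unfold Station.finalColor
          cases hc : (σ w).color with
          | none => simpa using hmax
          | some c =>
            have := h.color_nonneg w c hc
            simp only [Option.getD_some]
            linarith
      _ ≤ 2 * ((C.numPhases (Fintype.card V) + 1) * K) := by
          rw [← Finset.mul_sum]
          linarith [h.upper x]
      _ ≤ _ := by
          have := mul_le_mul_of_nonneg_right (hT.numPhases_add_one_le hn) hK.le
          linarith
  · by_cases hv : (σ v).color = none
    · have h1 : (σ v).finalColor C = 2 * C.pMax := by simp [Station.finalColor, hv]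
      have h2 := Finset.single_le_sum (f := fun w => (σ w).finalColor C)
        (fun w _ => h0 w) ((mem_near pos).2 (by simpa using (by linarith [M.ε_pos]) : dist (pos v)
          (pos v) ≤ M.ε / 3))
      simp only [h1] at h2
      refine le_trans ?_ h2
      rw [div_le_iff₀ (by positivity)]
      have := hT.cε_mul_pMax
      nlinarith
    · exact (h.lower v hv).trans (Finset.sum_le_sum fun w _ => getD_mono (min_le_right _ _))

theorem Tuned.eprob_not_colorInv_le (hT : Tuned M C K k L E) (hX : BoundedGrowth X M.γ M.κ)
    (hn : 2 ≤ Fintype.card V) (s : V) (i : ℕ) (hi : i ≤ C.numPhases (Fintype.card V)) :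
    eprob (exec M C pos s (C.iterStart (Fintype.card V) i 0)) {σ | ColorInv M C pos s K k i 0 σ}ᶜ
      ≤ (i * C.c' : ℕ) * ENNReal.ofReal
        (4 * Fintype.card V * Real.exp (-(E * Real.log (Fintype.card V)))) := by
  set e := ENNReal.ofReal (4 * Fintype.card V * Real.exp (-(E * Real.log (Fintype.card V))))
    with he
  induction i with
  | zero =>
    have : C.iterStart (Fintype.card V) 0 0 = 0 := by simp [Constants.iterStart]
    rw [this, exec, eprob, mean_pure, Set.indicator_of_notMem]
    · exact zero_le
    · exact fun h => h (hT.colorInv_init pos hX)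
  | succ i ih =>
    have hi' : i < C.numPhases (Fintype.card V) := hi
    have key : ∀ l ≤ C.c', eprob (exec M C pos s (C.iterStart (Fintype.card V) i l))
        {σ | ColorInv M C pos s K k i l σ}ᶜ ≤ (i * C.c' + l : ℕ) * e := by
      intro l
      induction l with
      | zero => intro _; simpa using ih hi'.le
      | succ l ihl =>
        intro hl
        have e1 : C.iterStart (Fintype.card V) i (l + 1)
            = C.iterStart (Fintype.card V) i l + C.iterRounds (Fintype.card V) := by
          unfold Constants.iterStart; ring
        rw [e1, exec_add]
        refine (eprob_bind_compl_le _ _ {σ | ColorInv M C pos s K k i l σ} _ e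
          fun σ₀ h₀ => ?_).trans ?_
        · refine (eprob_compl_anti _ fun σ hgood => ?_).trans
            (hT.eprob_not_iterGood_le pos hn (ColorInv.clean h₀) hi' (Nat.lt_of_succ_le hl))
          exact hT.colorInv_succ pos hX hi' h₀ hgood
        · refine (add_le_add_left (ihl (Nat.le_of_succ_le hl)) e).trans (le_of_eq ?_)
          push_cast
          ring
    have e2 : C.iterStart (Fintype.card V) (i + 1) 0 = C.iterStart (Fintype.card V) i C.c' := by
      unfold Constants.iterStart; ring
    rw [e2]
    refine (eprob_compl_anti _ fun σ hgood => ?_).trans ((key C.c' le_rfl).trans (le_of_eq ?_))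
    · exact hT.colorInv_phase pos hX hgood
    · congr 2; ring

/-- With high probability, `StabilizeProbability` computes a good coloring. -/
theorem Tuned.eprob_not_goodColoring_le (hT : Tuned M C K k L E) (hX : BoundedGrowth X M.γ M.κ)
    (hn : 2 ≤ Fintype.card V) (s : V) :
    eprob (exec M C pos s (C.colorRounds (Fintype.card V)))
        {σ | GoodColoring M C pos K k σ ∧ ∀ v, (σ v).relayFrom = (initState C s v).relayFrom}ᶜ
      ≤ ENNReal.ofReal (1 / (2 * Fintype.card V)) := by
  have hn' : (2 : ℝ) ≤ Fintype.card V := by exact_mod_cast hn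
  have e1 : C.colorRounds (Fintype.card V)
      = C.iterStart (Fintype.card V) (C.numPhases (Fintype.card V)) 0 := by
    unfold Constants.iterStart Constants.colorRounds Constants.phaseRounds; ring
  rw [e1]
  refine (eprob_compl_anti _ fun σ h => ?_).trans
    ((hT.eprob_not_colorInv_le pos hX hn s _ le_rfl).trans ?_)
  · exact ⟨hT.goodColoring pos hn h, h.relayFrom_eq⟩
  rw [← ENNReal.ofReal_natCast, ← ENNReal.ofReal_mul (by positivity)]
  refine ENNReal.ofReal_le_ofReal ?_
  set n := Fintype.card V with hnV
  set ℓ := Real.log n with hℓ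
  have hc' : (0 : ℝ) < C.c' := by exact_mod_cast C.c'_pos
  have hlog : Real.log 2 ≤ ℓ := Real.log_le_log two_pos hn'
  have hlog1 : ℓ ≤ n := (Real.log_le_sub_one_of_pos (by linarith)).trans (by linarith)
  have hlog0 : 0 ≤ ℓ := (Real.log_nonneg one_le_two).trans hlog
  have hl2 : 0 < Real.log 2 := Real.log_pos one_lt_two
  -- At most `5 n c'` iterations fail with probability at most `4 n exp (-(E ℓ))` each; this bound
  -- makes the total `1 / (2 n)`.
  have hE : Real.exp (-(E * ℓ)) ≤ 1 / (40 * C.c' * (n : ℝ) ^ 3) := by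
    rw [one_div, ← Real.exp_log (by positivity : (0 : ℝ) < 40 * C.c' * (n : ℝ) ^ 3), ← Real.exp_neg,
      Real.log_mul (by positivity) (by positivity), Real.log_pow]
    refine Real.exp_le_exp.2 (neg_le_neg ?_)
    have h1 := hT.log_le_E
    have hc1 : (1 : ℝ) ≤ C.c' := by exact_mod_cast C.c'_pos
    have h2 : 0 ≤ Real.log (40 * C.c') := Real.log_nonneg (by linarith)
    have h3 : 0 ≤ E - 3 := by
      by_contra! h
      nlinarith
    have h4 := mul_le_mul_of_nonneg_left hlog h3
    push_cast
    linarith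
  have hN : (C.numPhases n : ℝ) ≤ 5 * n := by
    have := hT.numPhases_add_one_le (n := n) hn
    linarith
  calc ((C.numPhases n * C.c' : ℕ) : ℝ) * (4 * n * Real.exp (-(E * ℓ)))
      ≤ (5 * n * C.c') * (4 * n * (1 / (40 * C.c' * (n : ℝ) ^ 3))) := by
        push_cast
        gcongr
    _ = 1 / (2 * n) := by field_simp; norm_num

end Coloring

/-- The relations between the constants of the algorithm that are needed for the relaying of the
message. A station set whose members have transmitted `A log n` times on average has been
successful. -/
structure RelayTuned (M : Model) (C : Constants) (K k A : ℝ) : Prop where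
  K_pos : 0 < K
  k_pos : 0 < k
  near_le : M.κ * 24 ^ M.γ * (10 * K / (C.c * M.ε)) ≤ 1 / 4
  outer_le : 1 + M.β * 2 ^ M.α * (4 * (10 * K / (C.c * M.ε) * M.outerConst))
    ≤ (1 - M.ε / 3) ^ (-M.α)
  relay : 2 * A * (C.c * M.ε) ≤ C.a * (k / (128 * C.cε))
  log_le_A : Real.log (4 * (5 * (8 * (C.c * M.ε) / (k / (128 * C.cε))) + 1))
    ≤ (A / 2 - 6) * Real.log 2

/-! ### Progress of the message in one relaying round. -/

section Relay

open Classical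

variable {X : Type*} [MetricSpace X] {V : Type*} [Fintype V]

/-- All stations within distance `ε / 3` of `u` know the message. -/
def BallInformed (M : Model) (pos : V ↪ X) (u : V) (σ : V → Station) : Prop :=
  ∀ w, dist (pos u) (pos w) ≤ M.ε / 3 → (σ w).Informed

/-- The probability with which a station transmits while it relays the message. -/
noncomputable def rate (M : Model) (C : Constants) (n : ℕ) (σ : Station) : ℝ :=
  σ.finalColor C / (C.c * M.ε * Real.log n)

/-- The probability with which a station relays the message in round `t`. -/
noncomputable def relayProb (M : Model) (C : Constants) (n t : ℕ) (σ : Station) : ℝ :=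
  if σ.Relaying C n t then rate M C n σ else 0

variable {M : Model} {C : Constants} (pos : V ↪ X) {K k A : ℝ} {s : V}

theorem Station.transmitProb_of_lt {n t : ℕ} (ht : C.colorRounds n < t) (P : Prop) (σ : Station) :
    σ.transmitProb M C n P t = relayProb M C n t σ := by
  rw [Station.transmitProb, if_neg (by omega), if_neg (by omega), relayProb, rate]

theorem Station.update_of_le {n t : ℕ} (ht : C.colorRounds n ≤ t) (σ : Station) (heard : Prop) :
    σ.update C n t heard
      = if σ.relayFrom = none ∧ heard then { σ with relayFrom := some (t + 1) } else σ := by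
  rw [Station.update, if_neg (by omega)]

theorem Station.update_color {n t : ℕ} (ht : C.colorRounds n ≤ t) (σ : Station) (heard : Prop) :
    (σ.update C n t heard).color = σ.color := by
  rw [Station.update_of_le ht]
  split_ifs <;> rfl

theorem Station.update_relayFrom {n t : ℕ} {σ : Station} {heard : Prop} {r : ℕ}
    (h : σ.relayFrom = some r) : (σ.update C n t heard).relayFrom = some r := by
  unfold Station.update
  simp only [h]
  split_ifs <;> simp_all

theorem Station.Informed.update {n t : ℕ} {σ : Station} (h : σ.Informed) (heard : Prop) :
    (σ.update C n t heard).Informed := by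
  obtain ⟨r, hr⟩ := Option.isSome_iff_exists.1 h
  exact Option.isSome_iff_exists.2 ⟨r, Station.update_relayFrom hr⟩

theorem Station.informed_update_of_heard {n t : ℕ} (ht : C.colorRounds n ≤ t) (σ : Station)
    {heard : Prop} (h : heard) : (σ.update C n t heard).Informed := by
  by_cases hr : σ.relayFrom = none
  · rw [Station.update_of_le ht, if_pos ⟨hr, h⟩]
    rfl
  · exact Station.Informed.update (Option.isSome_iff_ne_none.2 hr) heard

theorem GoodColoring.congr {σ₀ σ : V → Station} (h : GoodColoring M C pos K k σ₀)
    (hc : ∀ v, (σ v).color = (σ₀ v).color) : GoodColoring M C pos K k σ := by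
  have e : ∀ v, (σ v).finalColor C = (σ₀ v).finalColor C := fun v => by
    unfold Station.finalColor; rw [hc]
  exact ⟨fun v => (e v).symm ▸ h.nonneg v, fun x => by simpa only [e] using h.upper x,
    fun v => by simpa only [e] using h.lower v⟩

theorem eprob_step (t : ℕ) (σ : V → Station) (A : Set (V → Station)) :
    eprob (step M C pos s t σ) A
      = ENNReal.ofReal (avgProb (fun v => (σ v).transmitProb M C (Fintype.card V) (v = s) t)
        fun T => (fun v => (σ v).update C (Fintype.card V) t (Receives M pos T v)) ∈ A) := by
  have hind : A.indicator (1 : (V → Station) → ENNReal)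
      = fun σ => ENNReal.ofReal (if σ ∈ A then 1 else 0) := by
    ext σ
    by_cases h : σ ∈ A <;> simp [h]
  rw [eprob, hind, mean_step _ _ _ _ _ _ (fun σ => if σ ∈ A then 1 else 0)
    (fun σ => by split_ifs <;> norm_num)]
  rfl

theorem rate_nonneg (hn : 2 ≤ Fintype.card V) {σ : V → Station}
    (h : GoodColoring M C pos K k σ) (v : V) : 0 ≤ rate M C (Fintype.card V) (σ v) := by
  have hn' : (2 : ℝ) ≤ Fintype.card V := by exact_mod_cast hn
  have h1 : 0 < Real.log (Fintype.card V) := Real.log_pos (by linarith)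
  have h2 := C.c_pos
  have h3 := M.ε_pos
  exact div_nonneg (h.nonneg v) (by positivity)

theorem relayProb_nonneg (hn : 2 ≤ Fintype.card V) {σ : V → Station}
    (h : GoodColoring M C pos K k σ) (t : ℕ) (v : V) :
    0 ≤ relayProb M C (Fintype.card V) t (σ v) := by
  unfold relayProb
  split_ifs
  · exact rate_nonneg pos hn h v
  · exact le_rfl

/-- The message advances from the neighborhood of `v` to that of `u` with probability at least half
of the sum of the transmission probabilities of the relaying stations close to `v`. -/
theorem RelayTuned.half_sum_le_avgProb (hT : RelayTuned M C K k A) (hX : BoundedGrowth X M.γ M.κ)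
    (hn : 2 ≤ Fintype.card V) {σ : V → Station} (h : GoodColoring M C pos K k σ) {t : ℕ}
    (ht : C.colorRounds (Fintype.card V) < t) {v u : V}
    (hvu : dist (pos v) (pos u) ≤ 1 - M.ε) :
    (∑ w ∈ near pos v (M.ε / 3), relayProb M C (Fintype.card V) t (σ w)) / 2
      ≤ avgProb (fun v => (σ v).transmitProb M C (Fintype.card V) (v = s) t) fun T =>
        BallInformed M pos u fun v => (σ v).update C (Fintype.card V) t (Receives M pos T v) := by
  have hn' : (2 : ℝ) ≤ Fintype.card V := by exact_mod_cast hn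
  have hlog : 0 < Real.log (Fintype.card V) := Real.log_pos (by linarith)
  have hc := C.c_pos
  have hε := M.ε_pos
  have hε1 := M.ε_lt_one
  have hα := M.γ_pos.trans M.γ_lt_α
  have hκ := hX.one_le (pos s)
  have hΩ := M.outerConst_pos hκ
  have hK := hT.K_pos
  simp only [Station.transmitProb_of_lt ht]
  set p : V → ℝ := fun v => relayProb M C (Fintype.card V) t (σ v) with hp
  have hp0 : ∀ v, 0 ≤ p v := relayProb_nonneg pos hn h t
  set K' := 10 * K / (C.c * M.ε) with hK'
  have hK'0 : 0 < K' := by positivity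
  have hup : ∀ x, ∑ w ∈ near pos x (1 / 6), p w ≤ K' := fun x => by
    calc ∑ w ∈ near pos x (1 / 6), p w
        ≤ ∑ w ∈ near pos x (1 / 6), (σ w).finalColor C / (C.c * M.ε * Real.log (Fintype.card V)) := by
          refine Finset.sum_le_sum fun w _ => ?_
          simp only [hp, relayProb]
          split_ifs
          · exact le_rfl
          · exact rate_nonneg pos hn h w
      _ ≤ 10 * K * Real.log (Fintype.card V) / (C.c * M.ε * Real.log (Fintype.card V)) := by
          rw [← Finset.sum_div]
          exact div_le_div_of_nonneg_right (h.upper x) (by positivity)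
      _ = K' := by rw [hK']; field_simp
  -- Radius `2`, since the receivers are within `1 - ε + ε / 3 ≤ 1` of `v`.
  have hN : ∑ w ∈ near pos v 2, p w ≤ 1 / 4 := by
    have := sum_near_le pos hX hp0 (x := v) (d := 1 / 12) (k := K') (by norm_num)
      (c := 24) (by norm_num) hK'0.le (fun y _ => by norm_num; simpa using hup y)
    norm_num at this
    exact this.trans hT.near_le
  have hout : outerSum pos M.α p v 2 ≤ K' * M.outerConst := by
    have := outerSum_le pos M hX hp0 hK'0.le hup v (R := 1) one_pos le_rfl
    rw [Real.one_rpow, mul_one] at this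
    exact (outerSum_anti pos hp0 v one_le_two).trans this
  set θ := 4 * (K' * M.outerConst) with hθ
  have hθ0 : 0 < θ := by positivity
  -- Restricting to relaying stations loses no mass and ensures that the transmitter is informed,
  -- which matters when it lies in the ball of `u` itself.
  have hS : (near pos v (M.ε / 3)).filter (fun w => (σ w).Relaying C (Fintype.card V) t)
      ⊆ near pos v 2 :=
    (Finset.filter_subset _ _).trans (near_mono pos (by linarith))
  have hmain := SINRBroadcast.half_sum_le_avgProb hp0 hS hN
    (g := fun z => dist (pos v) (pos z) ^ (-M.α)) (fun z => by positivity) hθ0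
    (by rw [hθ]; unfold outerSum at hout; linarith)
  have hsum : ∑ w ∈ near pos v (M.ε / 3), p w = ∑ w ∈ (near pos v (M.ε / 3)).filter
      (fun w => (σ w).Relaying C (Fintype.card V) t), p w := by
    rw [Finset.sum_filter]
    refine Finset.sum_congr rfl fun w _ => ?_
    simp only [hp, relayProb]
    split_ifs <;> rfl
  rw [hsum]
  refine hmain.trans (avgProb_mono fun T hTr => ?_)
  obtain ⟨v₀, hv₀, hTv, hI⟩ := hTr
  obtain ⟨hv₀, r, hr, -, -⟩ := Finset.mem_filter.1 hv₀
  rw [mem_near] at hv₀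
  intro w hw
  by_cases hwv : w = v₀
  · rw [hwv]
    exact Station.Informed.update (Option.isSome_iff_exists.2 ⟨r, hr⟩) _
  refine Station.informed_update_of_heard ht.le _ ?_
  refine receives_of_inter_eq_singleton pos M hTv hI
    (by linarith [dist_triangle (pos v) (pos u) (pos w)]) hwv ?_
  -- The distance is at most `ε / 3 + (1 - ε) + ε / 3 = 1 - ε / 3`; this slack below the range `1`
  -- pays for the interference.
  refine hT.outer_le.trans ?_
  have hd0 : 0 < dist (pos v₀) (pos w) := dist_pos.2 fun h => hwv (pos.injective h).symm
  refine Real.rpow_le_rpow_of_nonpos hd0 ?_ (by linarith)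
  linarith [dist_triangle (pos v₀) (pos v) (pos w), dist_triangle (pos v) (pos u) (pos w),
    dist_comm (pos v) (pos v₀)]

/-- If all stations close to `v` relay, the message advances with probability `Ω(1 / log n)`. -/
theorem RelayTuned.div_log_le_prob (hT : RelayTuned M C K k A) (hX : BoundedGrowth X M.γ M.κ)
    (hn : 2 ≤ Fintype.card V) {σ : V → Station} (h : GoodColoring M C pos K k σ) {t : ℕ}
    (ht : C.colorRounds (Fintype.card V) < t) {v u : V}
    (hvu : dist (pos v) (pos u) ≤ 1 - M.ε)
    (hv : ∀ w, dist (pos v) (pos w) ≤ M.ε / 3 → (σ w).Relaying C (Fintype.card V) t) :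
    k / (128 * C.cε) / (2 * (C.c * M.ε)) / Real.log (Fintype.card V)
      ≤ prob (step M C pos s t σ) {σ' | BallInformed M pos u σ'} := by
  have hn' : (2 : ℝ) ≤ Fintype.card V := by exact_mod_cast hn
  have hlog : 0 < Real.log (Fintype.card V) := Real.log_pos (by linarith)
  have hc := C.c_pos
  have hε := M.ε_pos
  rw [prob_eq_toReal_eprob, eprob_step, ENNReal.toReal_ofReal (avgProb_nonneg _ _)]
  refine le_trans ?_ (hT.half_sum_le_avgProb pos hX hn h ht hvu)
  have e : ∑ w ∈ near pos v (M.ε / 3), relayProb M C (Fintype.card V) t (σ w)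
      = (∑ w ∈ near pos v (M.ε / 3), (σ w).finalColor C)
        / (C.c * M.ε * Real.log (Fintype.card V)) := by
    rw [Finset.sum_div]
    refine Finset.sum_congr rfl fun w hw => ?_
    rw [relayProb, if_pos (hv w ((mem_near pos).1 hw)), rate]
  rw [e]
  calc k / (128 * C.cε) / (2 * (C.c * M.ε)) / Real.log (Fintype.card V)
      = k / (128 * C.cε) / (C.c * M.ε * Real.log (Fintype.card V)) / 2 := by
        field_simp
    _ ≤ _ := by
        have := h.lower v
        gcongr

end Relay

/-! ### Supermartingale bounds along an execution. -/

section Supermartingale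

variable {X : Type*} [MetricSpace X] {V : Type*} [Fintype V]
  {M : Model} {C : Constants} {pos : V ↪ X} {s : V}

theorem mean_run_le_of_step {t₀ : ℕ} {σ₀ : V → Station} (g : ℕ → (V → Station) → ENNReal)
    (h : ∀ j, ∀ σ ∈ (run M C pos s t₀ σ₀ j).support,
      mean (step M C pos s (t₀ + j) σ) (g (j + 1)) ≤ g j σ) (j : ℕ) :
    mean (run M C pos s t₀ σ₀ j) (g j) ≤ g 0 σ₀ := by
  induction j with
  | zero => rw [run, mean_pure]
  | succ j ih =>
    rw [run, mean_bind]
    exact (mean_mono (h j)).trans ih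

/-- A supermartingale outside the events `B j` controls, up to the probabilities of these events,
the probability that it is at least `1` at the end. -/
theorem eprob_run_le_of_step {t₀ : ℕ} {σ₀ : V → Station} {J : ℕ}
    (g : ℕ → (V → Station) → ENNReal) (B : ℕ → Set (V → Station))
    (h : ∀ j < J, ∀ σ ∈ (run M C pos s t₀ σ₀ j).support, σ ∉ B j →
      mean (step M C pos s (t₀ + j) σ) (g (j + 1)) ≤ g j σ)
    {A : Set (V → Station)} (hA : ∀ σ ∈ A, 1 ≤ g J σ) :
    eprob (run M C pos s t₀ σ₀ J) A
      ≤ g 0 σ₀ + ∑ j ∈ Finset.range J, eprob (run M C pos s t₀ σ₀ j) (B j) := by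
  -- With `g` truncated at `1`, a visit to `B j` costs at most its probability.
  have key : ∀ j ≤ J, mean (run M C pos s t₀ σ₀ j) (fun σ => min (g j σ) 1)
      ≤ g 0 σ₀ + ∑ i ∈ Finset.range j, eprob (run M C pos s t₀ σ₀ i) (B i) := by
    intro j
    induction j with
    | zero =>
      intro _
      rw [run, mean_pure]
      simp
    | succ j ih =>
      intro hj
      rw [Finset.sum_range_succ, ← add_assoc, run, mean_bind]
      refine le_trans ?_ (add_le_add_left (ih (Nat.le_of_succ_le hj)) _)
      rw [eprob, ← mean_add]
      refine mean_mono fun σ hσ => ?_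
      have h1 : mean (step M C pos s (t₀ + j) σ) (fun σ => min (g (j + 1) σ) 1) ≤ 1 := by
        refine (mean_mono fun σ _ => min_le_right _ _).trans (le_of_eq (mean_const _ 1))
      by_cases hB : σ ∈ B j
      · rw [Set.indicator_of_mem hB, Pi.one_apply]
        exact h1.trans le_add_self
      · rw [Set.indicator_of_notMem hB, add_zero]
        exact le_min ((mean_mono fun σ _ => min_le_left _ _).trans (h j hj σ hσ hB)) h1
  exact (eprob_le_mean fun σ _ hσ => le_min (hA σ hσ) le_rfl).trans (key J le_rfl)

end Supermartingale

/-! ### Exposure and the progress of the message along a path. -/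

section Broadcast

open Classical

variable {X : Type*} [MetricSpace X] {V : Type*} [Fintype V]

/-- The properties of the states at the beginning of round `t` of the last part of SBroadcast. -/
structure RelayInv (M : Model) (C : Constants) (pos : V ↪ X) (s : V) (K k : ℝ) (t : ℕ)
    (σ : V → Station) : Prop where
  good : GoodColoring M C pos K k σ
  relayFrom_mem : ∀ v r, (σ v).relayFrom = some r → C.colorRounds (Fintype.card V) + 1 ≤ r ∧ r ≤ t
  source : BallInformed M pos s σ

/-- The number of rounds before round `t` in which a station has relayed the message. -/
noncomputable def relayed (C : Constants) (n t : ℕ) (σ : Station) : ℕ :=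
  match σ.relayFrom with
  | none => 0
  | some r => min (t - r) (C.relayRounds n)

/-- The expected number of transmissions of the message by stations close to `u` before
round `t`. -/
noncomputable def exposure (M : Model) (C : Constants) (pos : V ↪ X) (t : ℕ) (σ : V → Station)
    (u : V) : ℝ :=
  ∑ w ∈ near pos u (M.ε / 3), rate M C (Fintype.card V) (σ w) *
    relayed C (Fintype.card V) t (σ w)

variable {M : Model} {C : Constants} (pos : V ↪ X) {K k A : ℝ} {s : V}

theorem BallInformed.update {V : Type*} (pos : V ↪ X) {n t : ℕ} {u : V} {σ : V → Station} (h : BallInformed M pos u σ)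
    (T : Finset V) : BallInformed M pos u fun v => (σ v).update C n t (Receives M pos T v) :=
  fun w hw => Station.Informed.update (h w hw) _

theorem RelayInv.update {t : ℕ} (ht : C.colorRounds (Fintype.card V) < t) {σ : V → Station}
    (h : RelayInv M C pos s K k t σ) (T : Finset V) :
    RelayInv M C pos s K k (t + 1)
      fun v => (σ v).update C (Fintype.card V) t (Receives M pos T v) := by
  refine ⟨h.good.congr pos fun v => Station.update_color ht.le _ _, fun v r hr => ?_,
    BallInformed.update pos h.source T⟩
  beta_reduce at hr
  rw [Station.update_of_le ht.le] at hr
  split_ifs at hr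
  · simp only [Option.some_inj] at hr
    omega
  · have := h.relayFrom_mem v r hr
    omega

theorem rate_update {n t : ℕ} (ht : C.colorRounds n ≤ t) (σ : Station) (heard : Prop) :
    rate M C n (σ.update C n t heard) = rate M C n σ := by
  unfold rate Station.finalColor
  rw [Station.update_color ht]

/-- The growth does not depend on `heard`: a station informed in round `t` relays from `t + 1` on
and has not relayed before round `t + 1`. Thus the exposure grows by an amount known before the
round. -/
theorem rate_mul_relayed_update {n t : ℕ} (ht : C.colorRounds n ≤ t) (σ : Station)
    (hσ : ∀ r, σ.relayFrom = some r → r ≤ t) (heard : Prop) :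
    rate M C n (σ.update C n t heard) * relayed C n (t + 1) (σ.update C n t heard)
      = rate M C n σ * relayed C n t σ + relayProb M C n t σ := by
  rw [rate_update ht]
  cases hr : σ.relayFrom with
  | none =>
    have h1 : relayed C n (t + 1) (σ.update C n t heard) = 0 := by
      rw [Station.update_of_le ht]
      by_cases hh : heard <;> simp [hr, hh, relayed]
    have h2 : ¬ σ.Relaying C n t := fun ⟨r, h, _⟩ => by simp [hr] at h
    rw [h1, relayProb, if_neg h2, relayed, hr]
    simp
  | some r =>
    have hrt := hσ r hr
    have h1 := Station.update_relayFrom (C := C) (n := n) (t := t) (heard := heard) hr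
    rw [relayProb, relayed, relayed, h1, hr]
    by_cases hR : σ.Relaying C n t
    · obtain ⟨r', h, h2, h3⟩ := hR
      have : r' = r := by rw [hr] at h; exact (Option.some_inj.1 h).symm
      subst this
      have e1 : min (t + 1 - r') (C.relayRounds n) = t - r' + 1 := by omega
      have e2 : min (t - r') (C.relayRounds n) = t - r' := by omega
      simp only [e1, e2]
      rw [if_pos ⟨r', h, h2, h3⟩]
      push_cast
      ring
    · have h3 : ¬ t < r + C.relayRounds n := fun h => hR ⟨r, hr, hrt, h⟩
      have e1 : min (t + 1 - r) (C.relayRounds n) = C.relayRounds n := by omega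
      have e2 : min (t - r) (C.relayRounds n) = C.relayRounds n := by omega
      simp only [e1, e2]
      rw [if_neg hR, add_zero]

theorem RelayInv.exposure_update {t : ℕ} (ht : C.colorRounds (Fintype.card V) < t)
    {σ : V → Station} (h : RelayInv M C pos s K k t σ) (T : Finset V) (u : V) :
    exposure M C pos (t + 1) (fun v => (σ v).update C (Fintype.card V) t (Receives M pos T v)) u
      = exposure M C pos t σ u
        + ∑ w ∈ near pos u (M.ε / 3), relayProb M C (Fintype.card V) t (σ w) := by
  rw [exposure, exposure, ← Finset.sum_add_distrib]
  exact Finset.sum_congr rfl fun w _ =>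
    rate_mul_relayed_update ht.le (σ w) (fun r hr => (h.relayFrom_mem w r hr).2) _

theorem RelayInv.run {σ₁ : V → Station}
    (h : RelayInv M C pos s K k (C.colorRounds (Fintype.card V) + 1) σ₁) (j : ℕ) :
    ∀ σ ∈ (run M C pos s (C.colorRounds (Fintype.card V) + 1) σ₁ j).support,
      RelayInv M C pos s K k (C.colorRounds (Fintype.card V) + 1 + j) σ :=
  run_support_induction M C pos s
    (fun j σ => RelayInv M C pos s K k (C.colorRounds (Fintype.card V) + 1 + j) σ) h
    (fun _ _ _ hσ T => hσ.update pos (by omega) T) j le_rfl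

/-- It is unlikely that the stations close to `u` have transmitted the message many times without
informing those close to `u'`. -/
theorem RelayTuned.eprob_exposure_le (hT : RelayTuned M C K k A) (hX : BoundedGrowth X M.γ M.κ)
    (hn : 2 ≤ Fintype.card V) {σ₁ : V → Station}
    (h : RelayInv M C pos s K k (C.colorRounds (Fintype.card V) + 1) σ₁) {u u' : V}
    (huu' : dist (pos u) (pos u') ≤ 1 - M.ε) (j : ℕ) (x : ℝ) :
    eprob (run M C pos s (C.colorRounds (Fintype.card V) + 1) σ₁ j)
      {σ | x ≤ exposure M C pos (C.colorRounds (Fintype.card V) + 1 + j) σ u ∧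
        ¬ BallInformed M pos u' σ} ≤ ENNReal.ofReal (Real.exp (-(x / 2))) := by
  set t₁ := C.colorRounds (Fintype.card V) + 1 with ht₁
  -- In a round whose relay probabilities near `u` sum to `μ`, the exponential grows by `exp (μ /
  -- 2)`, while the ball of `u'` stays uninformed with probability at most `1 - μ / 2 ≤ exp (-(μ /
  -- 2))`.
  let g : ℕ → (V → Station) → ℝ := fun j σ =>
    if BallInformed M pos u' σ then 0 else Real.exp (exposure M C pos (t₁ + j) σ u / 2)
  have hg : ∀ j σ, 0 ≤ g j σ := fun j σ => by simp only [g]; split_ifs <;> positivity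
  have hstep : ∀ j, ∀ σ ∈ (SINRBroadcast.run M C pos s t₁ σ₁ j).support,
      mean (step M C pos s (t₁ + j) σ) (fun σ => ENNReal.ofReal (g (j + 1) σ))
        ≤ ENNReal.ofReal (g j σ) := by
    intro j σ hσ
    have hinv := h.run pos j σ hσ
    have ht : C.colorRounds (Fintype.card V) < t₁ + j := by omega
    rw [mean_step _ _ _ _ _ _ (g (j + 1)) (hg _)]
    refine ENNReal.ofReal_le_ofReal ?_
    by_cases hb : BallInformed M pos u' σ
    · have : ∀ T : Finset V, g (j + 1) (fun v => (σ v).update C (Fintype.card V) (t₁ + j)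
          (Receives M pos T v)) = 0 := fun T => if_pos (BallInformed.update pos hb T)
      simp only [this, avg_const]
      exact hg j σ
    · set μ := ∑ w ∈ near pos u (M.ε / 3), relayProb M C (Fintype.card V) (t₁ + j) (σ w) with hμ
      have e : ∀ T : Finset V, g (j + 1) (fun v => (σ v).update C (Fintype.card V) (t₁ + j)
          (Receives M pos T v)) = if BallInformed M pos u' (fun v =>
            (σ v).update C (Fintype.card V) (t₁ + j) (Receives M pos T v)) then 0
          else Real.exp ((exposure M C pos (t₁ + j) σ u + μ) / 2) := fun T => by
        simp only [g]
        rw [← add_assoc t₁, hinv.exposure_update pos ht T u]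
      simp only [e]
      rw [avg_ite]
      have h1 := hT.half_sum_le_avgProb pos hX hn hinv.good ht huu' (s := s)
      rw [← hμ] at h1
      have h2 : g j σ = Real.exp (exposure M C pos (t₁ + j) σ u / 2) := if_neg hb
      rw [h2, add_div, Real.exp_add]
      have h3 := Real.exp_pos (exposure M C pos (t₁ + j) σ u / 2)
      set π := avgProb (fun v => (σ v).transmitProb M C (Fintype.card V) (v = s) (t₁ + j)) fun T =>
        BallInformed M pos u' fun v => (σ v).update C (Fintype.card V) (t₁ + j)
          (Receives M pos T v)
      have h4 : Real.exp (μ / 2) * (1 - π) ≤ 1 := by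
        have h5 : 1 - π ≤ Real.exp (-(μ / 2)) := by
          linarith [Real.add_one_le_exp (-(μ / 2))]
        calc Real.exp (μ / 2) * (1 - π) ≤ Real.exp (μ / 2) * Real.exp (-(μ / 2)) :=
              mul_le_mul_of_nonneg_left h5 (Real.exp_pos _).le
          _ = 1 := by rw [← Real.exp_add, add_neg_cancel, Real.exp_zero]
      have := mul_le_mul_of_nonneg_left h4 h3.le
      linarith
  have hmean := mean_run_le_of_step (fun j σ => ENNReal.ofReal (g j σ)) hstep j
  have hzero : g 0 σ₁ ≤ 1 := by
    have h0 : exposure M C pos (t₁ + 0) σ₁ u = 0 := by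
      refine Finset.sum_eq_zero fun w _ => ?_
      rw [mul_eq_zero]
      right
      unfold relayed
      cases hr : (σ₁ w).relayFrom with
      | none => simp
      | some r =>
        have := h.relayFrom_mem w r hr
        have e : t₁ + 0 - r = 0 := by omega
        simp only [e, Nat.zero_min, Nat.cast_zero]
    simp only [g, h0]
    split_ifs <;> simp
  calc eprob (SINRBroadcast.run M C pos s t₁ σ₁ j)
        {σ | x ≤ exposure M C pos (t₁ + j) σ u ∧ ¬ BallInformed M pos u' σ}
      ≤ mean (SINRBroadcast.run M C pos s t₁ σ₁ j)
          (fun σ => ENNReal.ofReal (Real.exp (-(x / 2))) * ENNReal.ofReal (g j σ)) := by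
        refine eprob_le_mean fun σ _ hσ => ?_
        rw [← ENNReal.ofReal_mul (Real.exp_pos _).le, ENNReal.one_le_ofReal]
        simp only [g]
        rw [if_neg hσ.2, ← Real.exp_add]
        exact Real.one_le_exp (by linarith [hσ.1])
    _ ≤ ENNReal.ofReal (Real.exp (-(x / 2))) * ENNReal.ofReal (g 0 σ₁) := by
        rw [mean_const_mul]
        exact mul_le_mul_right hmean _
    _ ≤ ENNReal.ofReal (Real.exp (-(x / 2))) * 1 :=
        mul_le_mul_right (ENNReal.ofReal_le_one.2 hzero) _
    _ = _ := mul_one _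

/-- If the stations close to `u` are informed and have not transmitted often, most of them are still
relaying. -/
theorem RelayTuned.le_sum_relayProb (hT : RelayTuned M C K k A) (hn : 2 ≤ Fintype.card V)
    {t : ℕ} {σ : V → Station} (h : RelayInv M C pos s K k t σ) {u : V}
    (hu : BallInformed M pos u σ)
    (hexp : exposure M C pos t σ u < A * Real.log (Fintype.card V)) :
    k / (128 * C.cε) / (2 * (C.c * M.ε)) / Real.log (Fintype.card V)
      ≤ ∑ w ∈ near pos u (M.ε / 3), relayProb M C (Fintype.card V) t (σ w) := by
  have hn' : (2 : ℝ) ≤ Fintype.card V := by exact_mod_cast hn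
  have hlog : 0 < Real.log (Fintype.card V) := Real.log_pos (by linarith)
  have hc := C.c_pos
  have hε := M.ε_pos
  have ha := C.a_pos
  set ℓ := Real.log (Fintype.card V) with hℓ
  have hr0 := rate_nonneg pos hn h.good
  -- A station that has finished has relayed for at least `a log² n` rounds, so the rates of the
  -- finished stations sum to at most `exposure / (a log² n)`. By `relay` this is at most half of
  -- the lower bound for the total rate.
  have h1 : ∀ w ∈ near pos u (M.ε / 3), rate M C (Fintype.card V) (σ w)
      ≤ relayProb M C (Fintype.card V) t (σ w) + rate M C (Fintype.card V) (σ w) *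
        relayed C (Fintype.card V) t (σ w) / (C.a * ℓ ^ 2) := by
    intro w hw
    have hnn : 0 ≤ rate M C (Fintype.card V) (σ w) *
        relayed C (Fintype.card V) t (σ w) / (C.a * ℓ ^ 2) :=
      div_nonneg (mul_nonneg (hr0 w) (Nat.cast_nonneg _)) (by positivity)
    by_cases hR : (σ w).Relaying C (Fintype.card V) t
    · rw [relayProb, if_pos hR]
      linarith
    · obtain ⟨r, hr⟩ := Option.isSome_iff_exists.1 (hu w ((mem_near pos).1 hw))
      have hrt := (h.relayFrom_mem w r hr).2
      have h2 : ¬ t < r + C.relayRounds (Fintype.card V) := fun h => hR ⟨r, hr, hrt, h⟩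
      have h3 : relayed C (Fintype.card V) t (σ w) = C.relayRounds (Fintype.card V) := by
        unfold relayed
        simp only [hr]
        omega
      have h4 : C.a * ℓ ^ 2 ≤ (C.relayRounds (Fintype.card V) : ℝ) := Nat.le_ceil _
      rw [relayProb, if_neg hR, zero_add, h3, le_div_iff₀ (by positivity)]
      exact mul_le_mul_of_nonneg_left h4 (hr0 w)
  have h2 := Finset.sum_le_sum h1
  rw [Finset.sum_add_distrib, ← Finset.sum_div] at h2
  have h3 : ∑ w ∈ near pos u (M.ε / 3), rate M C (Fintype.card V) (σ w)
      = (∑ w ∈ near pos u (M.ε / 3), (σ w).finalColor C) / (C.c * M.ε * ℓ) := by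
    rw [Finset.sum_div]; rfl
  have h4 : exposure M C pos t σ u / (C.a * ℓ ^ 2)
      ≤ k / (128 * C.cε) / (2 * (C.c * M.ε)) / ℓ := by
    rw [div_div _ _ ℓ, div_le_div_iff₀ (by positivity) (by positivity)]
    have h5 := mul_le_mul_of_nonneg_right hT.relay (by positivity : 0 ≤ ℓ ^ 2)
    have h6 := mul_le_mul_of_nonneg_right hexp.le (by positivity : 0 ≤ 2 * (C.c * M.ε) * ℓ)
    calc _ ≤ _ := h6
      _ = 2 * A * (C.c * M.ε) * ℓ ^ 2 := by ring
      _ ≤ _ := h5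
      _ = _ := by ring
  have h5 : k / (128 * C.cε) / (C.c * M.ε * ℓ)
      ≤ (∑ w ∈ near pos u (M.ε / 3), (σ w).finalColor C) / (C.c * M.ε * ℓ) :=
    div_le_div_of_nonneg_right (h.good.lower u) (by positivity)
  have h6 : k / (128 * C.cε) / (C.c * M.ε * ℓ)
      = 2 * (k / (128 * C.cε) / (2 * (C.c * M.ε)) / ℓ) := by field_simp
  rw [h3] at h2
  unfold exposure at h4
  linarith

/-- Along a path of length `D`, the message arrives in time, unless stations have transmitted often
without success. -/
theorem RelayTuned.eprob_not_ballInformed_le (hT : RelayTuned M C K k A)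
    (hX : BoundedGrowth X M.γ M.κ) (hn : 2 ≤ Fintype.card V) {σ₁ : V → Station}
    (h : RelayInv M C pos s K k (C.colorRounds (Fintype.card V) + 1) σ₁)
    {D : ℕ} (v : ℕ → V) (hv0 : v 0 = s)
    (hv : ∀ i < D, dist (pos (v i)) (pos (v (i + 1))) ≤ 1 - M.ε) (J : ℕ) {lam : ℝ}
    (hlam0 : 0 ≤ lam)
    (hlam : 1 - k / (128 * C.cε) / (8 * (C.c * M.ε)) / Real.log (Fintype.card V) ≤ lam) :
    eprob (run M C pos s (C.colorRounds (Fintype.card V) + 1) σ₁ J)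
        {σ | ¬ BallInformed M pos (v D) σ}
      ≤ ENNReal.ofReal (2 ^ D * lam ^ J)
        + ∑ _j ∈ Finset.range J, ∑ _i ∈ Finset.range D,
          ENNReal.ofReal (Real.exp (-(A * Real.log (Fintype.card V) / 2))) := by
  set t₁ := C.colorRounds (Fintype.card V) + 1 with ht₁
  set ℓ := Real.log (Fintype.card V) with hℓ
  -- The default `0` of `findGreatest` is correct, as the ball of `v 0 = s` is informed. An advance
  -- of the front at least halves `2 ^ (D - front)`, so outside `B j` the power of two shrinks in
  -- expectation by a factor `1 - π / 2 ≤ lam`, with `π` the probability of informing the next ball.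
  -- The event `B j` is a large exposure at some vertex whose successor is uninformed.
  let front : (V → Station) → ℕ := fun σ => Nat.findGreatest (fun i => BallInformed M pos (v i) σ) D
  let g : ℕ → (V → Station) → ℝ := fun j σ =>
    if BallInformed M pos (v D) σ then 0 else 2 ^ (D - front σ) * lam ^ (J - j)
  let B : ℕ → Set (V → Station) := fun j => ⋃ i : Fin D,
    {σ | A * ℓ ≤ exposure M C pos (t₁ + j) σ (v i) ∧ ¬ BallInformed M pos (v (i + 1)) σ}
  have hg : ∀ j σ, 0 ≤ g j σ := fun j σ => by simp only [g]; split_ifs <;> positivity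
  have hstep : ∀ j < J, ∀ σ ∈ (SINRBroadcast.run M C pos s t₁ σ₁ j).support, σ ∉ B j →
      mean (step M C pos s (t₁ + j) σ) (fun σ => ENNReal.ofReal (g (j + 1) σ))
        ≤ ENNReal.ofReal (g j σ) := by
    intro j hj σ hσ hB
    have hinv := h.run pos j σ hσ
    have ht : C.colorRounds (Fintype.card V) < t₁ + j := by omega
    rw [mean_step _ _ _ _ _ _ (g (j + 1)) (hg _)]
    refine ENNReal.ofReal_le_ofReal ?_
    by_cases hb : BallInformed M pos (v D) σ
    · have : ∀ T : Finset V, g (j + 1) (fun v => (σ v).update C (Fintype.card V) (t₁ + j)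
          (Receives M pos T v)) = 0 := fun T => if_pos (BallInformed.update pos hb T)
      simp only [this, avg_const]
      exact hg j σ
    set f := front σ with hf
    have hfs : BallInformed M pos (v f) σ :=
      Nat.findGreatest_spec (P := fun i => BallInformed M pos (v i) σ) (Nat.zero_le D)
        (by rw [hv0]; exact hinv.source)
    have hfD : f ≤ D := Nat.findGreatest_le D
    have hfD' : f < D := lt_of_le_of_ne hfD fun e => hb (e ▸ hfs)
    have hnext : ¬ BallInformed M pos (v (f + 1)) σ :=
      Nat.findGreatest_is_greatest (P := fun i => BallInformed M pos (v i) σ) (Nat.lt_succ_self f)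
        hfD'
    have hexp : exposure M C pos (t₁ + j) σ (v f) < A * ℓ := by
      by_contra! hc
      exact hB (Set.mem_iUnion.2 ⟨⟨f, hfD'⟩, hc, hnext⟩)
    have h1 := hT.le_sum_relayProb pos hn hinv hfs hexp
    have h2 := hT.half_sum_le_avgProb pos hX hn hinv.good ht (hv f hfD') (s := s)
    have e : ∀ T : Finset V, g (j + 1) (fun v => (σ v).update C (Fintype.card V) (t₁ + j)
        (Receives M pos T v)) ≤ if BallInformed M pos (v (f + 1)) (fun v =>
          (σ v).update C (Fintype.card V) (t₁ + j) (Receives M pos T v))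
        then 2 ^ (D - (f + 1)) * lam ^ (J - (j + 1))
        else 2 ^ (D - f) * lam ^ (J - (j + 1)) := fun T => by
      simp only [g]
      by_cases hD : BallInformed M pos (v D) (fun v =>
          (σ v).update C (Fintype.card V) (t₁ + j) (Receives M pos T v))
      · rw [if_pos hD]; split_ifs <;> positivity
      · rw [if_neg hD]
        have hpow : ∀ a b : ℕ, a ≤ b → (2 : ℝ) ^ (D - b) * lam ^ (J - (j + 1))
            ≤ 2 ^ (D - a) * lam ^ (J - (j + 1)) := fun a b hab =>
          mul_le_mul_of_nonneg_right (pow_le_pow_right₀ one_le_two (by omega)) (by positivity)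
        split_ifs with hs
        · exact hpow _ _ (Nat.le_findGreatest hfD' hs)
        · exact hpow _ _ (Nat.le_findGreatest hfD (BallInformed.update pos hfs T))
    refine (avg_mono e).trans ?_
    rw [avg_ite]
    have h3 : g j σ = 2 ^ (D - f) * lam ^ (J - j) := if_neg hb
    have e1 : D - f = (D - (f + 1)) + 1 := by omega
    have e2 : J - j = (J - (j + 1)) + 1 := by omega
    rw [h3, e1, e2, pow_succ, pow_succ]
    set π := avgProb (fun v => (σ v).transmitProb M C (Fintype.card V) (v = s) (t₁ + j)) fun T =>
      BallInformed M pos (v (f + 1)) fun v => (σ v).update C (Fintype.card V) (t₁ + j)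
        (Receives M pos T v)
    have h4 : 1 - π / 2 ≤ lam := by
      have e3 : k / (128 * C.cε) / (8 * (C.c * M.ε)) / ℓ
          = k / (128 * C.cε) / (2 * (C.c * M.ε)) / ℓ / 4 := by
        have := C.c_pos
        have := M.ε_pos
        have := C.cε_pos
        ring
      linarith
    have h5 : (0 : ℝ) ≤ 2 ^ (D - (f + 1)) * lam ^ (J - (j + 1)) := by positivity
    have h6 := mul_le_mul_of_nonneg_left h4 h5
    linarith
  refine (eprob_run_le_of_step (fun j σ => ENNReal.ofReal (g j σ)) B hstep
    (A := {σ | ¬ BallInformed M pos (v D) σ}) fun σ hσ => ?_).trans (add_le_add ?_ ?_)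
  · rw [ENNReal.one_le_ofReal]
    simp only [g]
    rw [if_neg hσ, Nat.sub_self, pow_zero, mul_one]
    exact one_le_pow₀ one_le_two
  · refine ENNReal.ofReal_le_ofReal ?_
    simp only [g]
    split_ifs
    · positivity
    · exact mul_le_mul_of_nonneg_right (pow_le_pow_right₀ one_le_two (Nat.sub_le _ _))
        (by positivity)
  · refine Finset.sum_le_sum fun j _ => ?_
    refine (eprob_iUnion_le _ _).trans ?_
    rw [← Fin.sum_univ_eq_sum_range (fun _ => ENNReal.ofReal (Real.exp (-(A * ℓ / 2)))) D]
    exact Finset.sum_le_sum fun i _ => hT.eprob_exposure_le pos hX hn h (hv i i.2) j (A * ℓ)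

end Broadcast

/-! ### The round of the source, union bounds and the total running time. -/

section Final

open Classical

variable {X : Type*} [MetricSpace X] {V : Type*} [Fintype V]
  {M : Model} {C : Constants} (pos : V ↪ X) {K k A : ℝ} {s : V}

theorem mem_of_mem_support_transmitters {p : V → ℝ} {T : Finset V}
    (hT : T ∈ (transmitters p).support) {v : V} (hv : p v = 1) : v ∈ T := by
  by_contra h
  rw [PMF.mem_support_iff, transmitters_apply] at hT
  refine hT ?_
  rw [weight, Finset.prod_eq_zero (i := v) (s := Finset.univ \ T) (by simp [h]), mul_zero,
    ENNReal.ofReal_zero]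
  rw [hv, coe_clip_eq zero_le_one le_rfl, sub_self]

theorem notMem_of_mem_support_transmitters {p : V → ℝ} {T : Finset V}
    (hT : T ∈ (transmitters p).support) {v : V} (hv : p v = 0) : v ∉ T := by
  intro h
  rw [PMF.mem_support_iff, transmitters_apply] at hT
  refine hT ?_
  rw [weight, Finset.prod_eq_zero h, zero_mul, ENNReal.ofReal_zero]
  rw [hv, coe_clip_eq le_rfl zero_le_one]

/-- The effect of the deterministic transmission of the source. -/
theorem relayInv_source {σ₀ σ : V → Station} (h : GoodColoring M C pos K k σ₀)
    (hr : ∀ v, (σ₀ v).relayFrom = (initState C s v).relayFrom)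
    (hσ : σ ∈ (step M C pos s (C.colorRounds (Fintype.card V)) σ₀).support) :
    RelayInv M C pos s K k (C.colorRounds (Fintype.card V) + 1) σ := by
  have hα := M.γ_pos.trans M.γ_lt_α
  rw [step, PMF.support_map] at hσ
  obtain ⟨T, hT, rfl⟩ := hσ
  have hp : ∀ v, (σ₀ v).transmitProb M C (Fintype.card V) (v = s) (C.colorRounds (Fintype.card V))
      = if v = s then 1 else 0 := fun v => by
    rw [Station.transmitProb, if_neg (lt_irrefl _), if_pos rfl]
  have hTs : T = {s} := by
    ext v
    rw [Finset.mem_singleton]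
    by_cases hv : v = s
    · exact iff_of_true (mem_of_mem_support_transmitters hT (by rw [hp, if_pos hv])) hv
    · exact iff_of_false (notMem_of_mem_support_transmitters hT (by rw [hp, if_neg hv])) hv
  subst hTs
  have hs : (σ₀ s).relayFrom = some (C.colorRounds (Fintype.card V) + 1) := by
    rw [hr]; simp [initState]
  refine ⟨h.congr pos fun v => Station.update_color le_rfl _ _, fun v r hvr => ?_, fun w hw => ?_⟩
  · beta_reduce at hvr
    rw [Station.update_of_le le_rfl] at hvr
    split_ifs at hvr
    · simp only [Option.some_inj] at hvr
      omega
    · rw [hr] at hvr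
      simp only [initState] at hvr
      split_ifs at hvr
      · simp only [Option.some_inj] at hvr
        omega
  · by_cases hws : w = s
    · rw [hws]
      exact Station.Informed.update (by rw [Station.Informed, hs]; rfl) _
    refine Station.informed_update_of_heard le_rfl _ ?_
    have hw1 : dist (pos s) (pos w) ≤ 1 := by linarith [M.ε_lt_one]
    refine receives_of_inter_eq_singleton pos M (x := s) (v := s) (R := 2) (θ := 0) ?_ ?_
      (by linarith) hws ?_
    · rw [Finset.singleton_inter_of_mem ((mem_near pos).2 (by simp))]
    · rw [Finset.sdiff_eq_empty_iff_subset.2 (Finset.singleton_subset_iff.2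
        ((mem_near pos).2 (by simp))), Finset.sum_empty]
    · rw [mul_zero, add_zero]
      exact Real.one_le_rpow_of_pos_of_le_one_of_nonpos
        (dist_pos.2 fun h => hws (pos.injective h).symm) hw1 (by linarith)

/-- The number of rounds after which the message has reached all stations, in terms of the inverse
`b` of the rate of progress. -/
noncomputable def spreadRounds (b ℓ : ℝ) (D : ℕ) : ℕ := ⌈b * (D * ℓ + 4 * ℓ ^ 2)⌉₊

/-- For each target, use a shortest path from `s` and `lam = exp (-(1 / (b ℓ)))`. The number of
rounds gives `2 ^ D * lam ^ J ≤ exp D * exp (-(D + 4 ℓ)) = n ^ (-4)`, and large exposures cost at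
most `1 / (4 n ^ 3)`. The sum is at most `1 / (2 n ^ 2)`, to be multiplied by the `n` targets. -/
theorem RelayTuned.eprob_run_not_informed_le (hT : RelayTuned M C K k A)
    (hX : BoundedGrowth X M.γ M.κ) (hn : 2 ≤ Fintype.card V)
    (hcon : (commGraph M pos).Connected) {σ₁ : V → Station}
    (h : RelayInv M C pos s K k (C.colorRounds (Fintype.card V) + 1) σ₁) :
    eprob (run M C pos s (C.colorRounds (Fintype.card V) + 1) σ₁
        (spreadRounds (8 * (C.c * M.ε) / (k / (128 * C.cε))) (Real.log (Fintype.card V))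
          (commGraph M pos).diam)) {σ | ∀ v, (σ v).Informed}ᶜ
      ≤ ENNReal.ofReal (1 / (2 * Fintype.card V)) := by
  have hn' : (2 : ℝ) ≤ Fintype.card V := by exact_mod_cast hn
  have hn0 : (0 : ℝ) < Fintype.card V := by linarith
  have hlog : 0 < Real.log (Fintype.card V) := Real.log_pos (by linarith)
  have hlog1 : Real.log (Fintype.card V) ≤ Fintype.card V :=
    (Real.log_le_sub_one_of_pos hn0).trans (by linarith)
  have hlog2 : Real.log 2 ≤ Real.log (Fintype.card V) := Real.log_le_log two_pos hn'
  have hl2 : 0 < Real.log 2 := Real.log_pos one_lt_two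
  have hc := C.c_pos
  have hε := M.ε_pos
  have hcε := C.cε_pos
  have hk := hT.k_pos
  set b := 8 * (C.c * M.ε) / (k / (128 * C.cε)) with hb
  have hb0 : 0 < b := by positivity
  set n := Fintype.card V with hnV
  set ℓ := Real.log n with hℓ
  have : Nonempty V := ⟨s⟩
  have hdist : ∀ u v : V, (commGraph M pos).dist u v ≤ n := fun u v => by
    obtain ⟨p, hp, hlen⟩ := hcon.exists_path_of_dist u v
    exact hlen ▸ hp.length_lt.le
  set D := (commGraph M pos).diam with hD
  have hDn : (D : ℝ) ≤ n := by
    obtain ⟨u, v, huv⟩ := (commGraph M pos).exists_dist_eq_diam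
    exact_mod_cast huv ▸ hdist u v
  set J := spreadRounds b ℓ D with hJ
  have hJ1 : b * (D * ℓ + 4 * ℓ ^ 2) ≤ J := Nat.le_ceil _
  have hJ2 : (J : ℝ) ≤ (5 * b + 1) * (n : ℝ) ^ 2 := by
    have h1 : (J : ℝ) < b * (D * ℓ + 4 * ℓ ^ 2) + 1 := Nat.ceil_lt_add_one (by positivity)
    have h2 : D * ℓ + 4 * ℓ ^ 2 ≤ 5 * (n : ℝ) ^ 2 := by
      have h3 : D * ℓ ≤ (n : ℝ) * n := mul_le_mul hDn hlog1 hlog.le hn0.le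
      have h4 : ℓ * ℓ ≤ (n : ℝ) * n := mul_le_mul hlog1 hlog1 hlog.le hn0.le
      nlinarith
    have h5 := mul_le_mul_of_nonneg_left h2 hb0.le
    nlinarith
  -- The exposure bound is summed over at most `(5 b + 1) n ^ 2` rounds and `n` path edges.
  have hexp : Real.exp (-(A * ℓ / 2)) ≤ 1 / (4 * (5 * b + 1) * (n : ℝ) ^ 6) := by
    rw [one_div, ← Real.exp_log (by positivity : (0 : ℝ) < 4 * (5 * b + 1) * (n : ℝ) ^ 6),
      ← Real.exp_neg, Real.log_mul (by positivity) (by positivity), Real.log_pow]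
    refine Real.exp_le_exp.2 (neg_le_neg ?_)
    have h1 := hT.log_le_A
    rw [← hb] at h1
    have h2 : 0 ≤ Real.log (4 * (5 * b + 1)) := Real.log_nonneg (by linarith)
    have h3 : 0 ≤ A / 2 - 6 := by
      by_contra! h
      nlinarith
    have h4 := mul_le_mul_of_nonneg_left hlog2 h3
    push_cast
    linarith
  have htarget : ∀ z, eprob (SINRBroadcast.run M C pos s (C.colorRounds n + 1) σ₁ J)
      {σ | ¬ BallInformed M pos z σ} ≤ ENNReal.ofReal (1 / (2 * (n : ℝ) ^ 2)) := by
    intro z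
    obtain ⟨p, hp, hlen⟩ := hcon.exists_path_of_dist s z
    have hpn : p.length ≤ n := hp.length_lt.le
    have hpD : p.length ≤ D := hlen ▸ SimpleGraph.dist_le_diam
      (SimpleGraph.connected_iff_ediam_ne_top.1 hcon)
    have hmain := hT.eprob_not_ballInformed_le pos hX hn h (D := p.length) p.getVert
      p.getVert_zero (fun i hi => (p.adj_getVert_succ hi).2) J
      (lam := Real.exp (-(k / (128 * C.cε) / (8 * (C.c * M.ε)) / ℓ))) (Real.exp_pos _).le
      (by linarith [Real.add_one_le_exp (-(k / (128 * C.cε) / (8 * (C.c * M.ε)) / ℓ))])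
    rw [p.getVert_length] at hmain
    refine hmain.trans ?_
    rw [Finset.sum_const, Finset.sum_const, Finset.card_range, Finset.card_range, nsmul_eq_mul,
      nsmul_eq_mul, ← ENNReal.ofReal_natCast J, ← ENNReal.ofReal_natCast p.length,
      ← ENNReal.ofReal_mul (by positivity), ← ENNReal.ofReal_mul (by positivity),
      ← ENNReal.ofReal_add (by positivity) (by positivity)]
    refine ENNReal.ofReal_le_ofReal ?_
    have h1 : (2 : ℝ) ^ p.length * Real.exp (-(k / (128 * C.cε) / (8 * (C.c * M.ε)) / ℓ)) ^ J
        ≤ 1 / (n : ℝ) ^ 4 := by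
      have e1 : k / (128 * C.cε) / (8 * (C.c * M.ε)) / ℓ = 1 / (b * ℓ) := by
        rw [hb]; field_simp
      have h2 : (2 : ℝ) ^ p.length ≤ Real.exp D := by
        calc (2 : ℝ) ^ p.length ≤ 2 ^ D := pow_le_pow_right₀ one_le_two hpD
          _ ≤ Real.exp 1 ^ D := by
              gcongr
              linarith [Real.add_one_le_exp (1 : ℝ)]
          _ = Real.exp D := by rw [← Real.exp_nat_mul, mul_one]
      have h3 : Real.exp (-(1 / (b * ℓ))) ^ J ≤ Real.exp (-(D + 4 * ℓ)) := by
        rw [← Real.exp_nat_mul]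
        refine Real.exp_le_exp.2 ?_
        rw [mul_neg, neg_le_neg_iff, mul_one_div, le_div_iff₀ (by positivity)]
        calc (D + 4 * ℓ) * (b * ℓ) = b * (D * ℓ + 4 * ℓ ^ 2) := by ring
          _ ≤ J := hJ1
      rw [e1]
      calc _ ≤ Real.exp D * Real.exp (-(D + 4 * ℓ)) :=
            mul_le_mul h2 h3 (by positivity) (by positivity)
        _ = 1 / (n : ℝ) ^ 4 := by
            rw [← Real.exp_add, one_div, ← Real.exp_log (by positivity : (0 : ℝ) < (n : ℝ) ^ 4),
              ← Real.exp_neg, Real.log_pow]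
            congr 1
            push_cast
            ring
    have h2 : (J : ℝ) * (p.length * Real.exp (-(A * ℓ / 2))) ≤ 1 / (4 * (n : ℝ) ^ 3) := by
      have h3 : (p.length : ℝ) ≤ n := by exact_mod_cast hpn
      calc (J : ℝ) * (p.length * Real.exp (-(A * ℓ / 2)))
          ≤ ((5 * b + 1) * (n : ℝ) ^ 2) * (n * (1 / (4 * (5 * b + 1) * (n : ℝ) ^ 6))) := by
            gcongr
        _ = 1 / (4 * (n : ℝ) ^ 3) := by field_simp
    refine (add_le_add h1 h2).trans ?_
    rw [div_add_div _ _ (by positivity) (by positivity), div_le_div_iff₀ (by positivity)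
      (by positivity)]
    have h4 : (0 : ℝ) ≤ (n : ℝ) ^ 5 := by positivity
    have h5 : (0 : ℝ) ≤ (n : ℝ) ^ 5 * (n - 2) := mul_nonneg h4 (by linarith)
    have h6 : (0 : ℝ) ≤ (n : ℝ) ^ 5 * (n - 2) * n := mul_nonneg h5 hn0.le
    nlinarith
  have hsub : eprob (SINRBroadcast.run M C pos s (C.colorRounds n + 1) σ₁ J)
      {σ | ∀ v, (σ v).Informed}ᶜ ≤ eprob (SINRBroadcast.run M C pos s (C.colorRounds n + 1) σ₁ J)
      (⋃ z, {σ | ¬ BallInformed M pos z σ}) := by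
    refine eprob_mono fun σ _ hσ => ?_
    obtain ⟨z, hz⟩ := not_forall.1 hσ
    exact Set.mem_iUnion.2 ⟨z, fun hb => hz (hb z (by rw [dist_self]; linarith))⟩
  refine hsub.trans ((eprob_iUnion_le _ _).trans ((Finset.sum_le_sum fun z _ => htarget z).trans ?_))
  rw [Finset.sum_const, Finset.card_univ, nsmul_eq_mul, ← ENNReal.ofReal_natCast,
    ← ENNReal.ofReal_mul (by positivity)]
  refine ENNReal.ofReal_le_ofReal (le_of_eq ?_)
  rw [← hnV]
  field_simp

theorem Constants.colorRounds_le (C : Constants) {n : ℕ} (hn : 2 ≤ n)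
    (hN : (C.numPhases n : ℝ) ≤ 5 * Real.log n) :
    (C.colorRounds n : ℝ) ≤ 5 * C.c' * (C.c₀ + C.c₂ + 4) * Real.log n ^ 2 := by
  have hn' : (2 : ℝ) ≤ n := by exact_mod_cast hn
  have hlog2 : Real.log 2 ≤ Real.log n := Real.log_le_log two_pos hn'
  have hl2 := Real.log_two_gt_d9
  have h0 := C.c₀_pos
  have h2 := C.c₂_pos
  set ℓ := Real.log n with hℓ
  have hℓ0 : 0 < ℓ := by linarith
  have e1 : (C.densityRounds n : ℝ) ≤ C.c₀ * ℓ + 1 := (Nat.ceil_lt_add_one (by positivity)).le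
  have e2 : (C.playoffRounds n : ℝ) ≤ C.c₂ * ℓ + 1 := (Nat.ceil_lt_add_one (by positivity)).le
  have e3 : (C.densityRounds n : ℝ) + C.playoffRounds n ≤ (C.c₀ + C.c₂ + 4) * ℓ := by nlinarith
  unfold colorRounds phaseRounds iterRounds
  push_cast
  calc (C.numPhases n : ℝ) * (C.c' * (C.densityRounds n + C.playoffRounds n))
      ≤ (5 * ℓ) * (C.c' * ((C.c₀ + C.c₂ + 4) * ℓ)) := by gcongr
    _ = _ := by ring

/-- Stations never forget the message, so a single suitable time before `T` suffices. -/
theorem eprob_exec_not_informed_anti (t j : ℕ) :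
    eprob (exec M C pos s (t + j)) {σ | ∀ v, (σ v).Informed}ᶜ
      ≤ eprob (exec M C pos s t) {σ | ∀ v, (σ v).Informed}ᶜ := by
  induction j with
  | zero => exact le_rfl
  | succ j ih =>
    refine le_trans ?_ ih
    have := eprob_bind_compl_le (exec M C pos s (t + j)) (step M C pos s (t + j))
      {σ | ∀ v, (σ v).Informed} {σ | ∀ v, (σ v).Informed} 0 fun σ hσ => ?_
    · rwa [add_zero] at this
    · refine (eprob_compl_eq_zero fun σ' hσ' => ?_).le
      obtain ⟨T, rfl⟩ := exists_update_of_mem_support_step M C pos s hσ'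
      exact fun v => Station.Informed.update (hσ v) _

/-- SBroadcast informs all stations in time `O(D log n + log² n)`, with high probability. -/
theorem RelayTuned.one_sub_le_prob_informed {L : ℕ} {E : ℝ} (hR : RelayTuned M C K k A)
    (hT : Tuned M C K k L E) (hX : BoundedGrowth X M.γ M.κ) (hn : 2 ≤ Fintype.card V)
    (hcon : (commGraph M pos).Connected) (s : V) {T : ℕ}
    (hTr : (5 * C.c' * (C.c₀ + C.c₂ + 4) + 8 + 4 * (8 * (C.c * M.ε) / (k / (128 * C.cε)))) *
      ((commGraph M pos).diam * Real.log (Fintype.card V) + Real.log (Fintype.card V) ^ 2) ≤ T) :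
    1 - 1 / (Fintype.card V : ℝ) ≤ prob (exec M C pos s T) {σ | ∀ v, (σ v).Informed} := by
  have hn' : (2 : ℝ) ≤ Fintype.card V := by exact_mod_cast hn
  have hlog2 : Real.log 2 ≤ Real.log (Fintype.card V) := Real.log_le_log two_pos hn'
  have hl2 := Real.log_two_gt_d9
  have hc := C.c_pos
  have hε := M.ε_pos
  have hcε := C.cε_pos
  have hk := hR.k_pos
  have h0 := C.c₀_pos
  have h2 := C.c₂_pos
  have hcol := C.colorRounds_le hn (by linarith [hT.numPhases_add_one_le hn])
  set b := 8 * (C.c * M.ε) / (k / (128 * C.cε)) with hb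
  have hb0 : 0 < b := by positivity
  set ℓ := Real.log (Fintype.card V) with hℓ
  have hℓ0 : 0 < ℓ := by linarith
  set D := (commGraph M pos).diam with hD
  set t₁ := C.colorRounds (Fintype.card V) + 1 with ht₁
  have hJ : (spreadRounds b ℓ D : ℝ) ≤ b * (D * ℓ + 4 * ℓ ^ 2) + 1 :=
    (Nat.ceil_lt_add_one (by positivity)).le
  -- The summand `8` of the constant pays for the round of the source and the rounding in
  -- `spreadRounds`, as `1 ≤ 4 ℓ ^ 2`.
  have hle : t₁ + spreadRounds b ℓ D ≤ T := by
    have h3 : 1 ≤ 4 * ℓ ^ 2 := by nlinarith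
    have h4 : 0 ≤ D * ℓ := by positivity
    have h5 : 0 ≤ 5 * C.c' * (C.c₀ + C.c₂ + 4) + 8 + 3 * b := by positivity
    have h6 : 0 ≤ (5 * C.c' * (C.c₀ + C.c₂ + 4) + 8 + 3 * b) * (D * ℓ) := mul_nonneg h5 h4
    have : ((t₁ + spreadRounds b ℓ D : ℕ) : ℝ) ≤ T := by
      rw [ht₁]
      push_cast
      linarith
    exact_mod_cast this
  obtain ⟨j, rfl⟩ := Nat.exists_eq_add_of_le hle
  refine one_sub_le_prob (by positivity) ((eprob_exec_not_informed_anti pos _ j).trans ?_)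
  have hinv : eprob (exec M C pos s t₁) {σ | RelayInv M C pos s K k t₁ σ}ᶜ
      ≤ ENNReal.ofReal (1 / (2 * Fintype.card V)) := by
    have := eprob_bind_compl_le (exec M C pos s (C.colorRounds (Fintype.card V)))
      (step M C pos s (C.colorRounds (Fintype.card V)))
      {σ | GoodColoring M C pos K k σ ∧ ∀ v, (σ v).relayFrom = (initState C s v).relayFrom}
      {σ | RelayInv M C pos s K k t₁ σ} 0 fun σ hσ => ?_
    · rw [add_zero] at this
      exact this.trans (hT.eprob_not_goodColoring_le pos hX hn s)
    · refine (eprob_compl_eq_zero fun σ' hσ' => ?_).le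
      exact relayInv_source pos hσ.1 hσ.2 hσ'
  rw [exec_add]
  refine (eprob_bind_compl_le _ _ {σ | RelayInv M C pos s K k t₁ σ} _
    (ENNReal.ofReal (1 / (2 * Fintype.card V)))
    fun σ hσ => hR.eprob_run_not_informed_le pos hX hn hcon hσ).trans ?_
  refine (add_le_add_left hinv _).trans ?_
  rw [← ENNReal.ofReal_add (by positivity) (by positivity)]
  refine ENNReal.ofReal_le_ofReal (le_of_eq ?_)
  field_simp
  norm_num

end Final

/-! ### The choice of the constants. -/

section Existence

open Filter Topology

/-- Take `G = g L ^ α`, with `g` making the interference term exactly `1 / 2`, and `k` of order `L ^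
(-γ)`, making the mass of the sparse surrounding exactly `1 / 4`. The remaining requirements hold
for large `L`: `κ (8 L) ^ γ k` stays constant while `G K` grows, and `exp (-(G K / 256))` decays
faster than `k`. -/
theorem exists_playoff_scale (M : Model) (hκ : 1 ≤ M.κ) {K : ℝ} (hK : 0 < K) :
    ∃ (L : ℕ) (G k : ℝ), 2 ≤ L ∧ 0 < G ∧ 0 < k ∧ M.κ * (4 * L : ℝ) ^ M.γ * k ≤ 1 / 4 ∧
      (1 / (12 * L) : ℝ) ^ M.α
        + 4 * M.β * 4 ^ M.α * (G * K * M.outerConst) * (L : ℝ) ^ (-M.α) ≤ 1 ∧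
      M.κ * (8 * L : ℝ) ^ M.γ * k < G * K / 2 ∧
      2 ^ ((M.ε / 3) ^ (-M.α) + 1) * Real.exp (-(G * K / 256)) ≤ k / 128 ∧
      k / 8 / G ≤ K / 4 := by
  have hα := M.γ_pos.trans M.γ_lt_α
  have hγ := M.γ_pos
  have hβ := M.one_le_β
  have hΩ := M.outerConst_pos hκ
  set g := 1 / (8 * M.β * 4 ^ M.α * (K * M.outerConst)) with hg
  have hg0 : 0 < g := by positivity
  set Q : ℝ := 2 ^ ((M.ε / 3) ^ (-M.α) + 1) * (512 * M.κ * 4 ^ M.γ) with hQ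
  have hQ0 : 0 < Q := by positivity
  set c := g * K / 256 with hc
  have hc0 : 0 < c := by positivity
  have hy : Tendsto (fun L : ℕ => (L : ℝ) ^ M.α) atTop atTop :=
    (tendsto_rpow_atTop hα).comp tendsto_natCast_atTop_atTop
  have hexp : Tendsto (fun y : ℝ => (c * y) ^ 1 * Real.exp (-(c * y))) atTop (𝓝 0) :=
    (Real.tendsto_pow_mul_exp_neg_atTop_nhds_zero 1).comp (tendsto_id.const_mul_atTop hc0)
  have hev : ∀ᶠ y : ℝ in atTop, 2 * (1 / 12) ^ M.α ≤ y ∧ 2 ^ M.γ / 4 < g * y * K / 2 ∧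
      (c * y) ^ 1 * Real.exp (-(c * y)) < c / Q ∧ 1 / (8 * K) ≤ g * y := by
    refine (eventually_ge_atTop _).and (Eventually.and ?_ ((hexp.eventually_lt_const
      (by positivity)).and ?_))
    · have : Tendsto (fun y : ℝ => g * y * K / 2) atTop atTop :=
        ((tendsto_id.const_mul_atTop hg0).atTop_mul_const hK).atTop_div_const two_pos
      exact this.eventually_gt_atTop _
    · exact (tendsto_id.const_mul_atTop hg0).eventually_ge_atTop _
  obtain ⟨L, ⟨h1, h2, h3, h4⟩, hL⟩ := ((hy.eventually hev).and (eventually_ge_atTop 2)).exists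
  have hL2 : (2 : ℝ) ≤ L := by exact_mod_cast hL
  have hL0 : (0 : ℝ) < L := by linarith
  set y := (L : ℝ) ^ M.α with hyd
  have hy0 : 0 < y := by positivity
  have hLγ : (L : ℝ) ^ M.γ ≤ y := Real.rpow_le_rpow_of_exponent_le (by linarith) M.γ_lt_α.le
  have h4L : (1 : ℝ) ≤ (4 * L : ℝ) ^ M.γ := Real.one_le_rpow (by linarith) hγ.le
  refine ⟨L, g * y, 1 / (4 * M.κ * (4 * L) ^ M.γ), hL, by positivity, by positivity,
    le_of_eq (by field_simp), ?_, ?_, ?_, ?_⟩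
  · have e1 : (1 / (12 * L) : ℝ) ^ M.α = (1 / 12) ^ M.α / y := by
      rw [← Real.div_rpow (by norm_num) hL0.le]
      congr 1
      field_simp
    have e2 : 4 * M.β * 4 ^ M.α * (g * y * K * M.outerConst) * (L : ℝ) ^ (-M.α) = 1 / 2 := by
      rw [Real.rpow_neg hL0.le, ← hyd, hg]
      field_simp
      norm_num
    rw [e1, e2]
    have : (1 / 12 : ℝ) ^ M.α / y ≤ 1 / 2 := by
      rw [div_le_div_iff₀ hy0 two_pos]
      linarith
    linarith
  · have e : M.κ * (8 * L : ℝ) ^ M.γ * (1 / (4 * M.κ * (4 * L) ^ M.γ)) = 2 ^ M.γ / 4 := by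
      have : (8 * L : ℝ) ^ M.γ = 2 ^ M.γ * (4 * L) ^ M.γ := by
        rw [← Real.mul_rpow zero_le_two (by positivity)]
        congr 1
        ring
      rw [this]
      field_simp
    rw [e]
    exact h2
  · have h5 : c * y * Real.exp (-(c * y)) * Q < c := by
      rw [pow_one, lt_div_iff₀ hQ0] at h3
      exact h3
    have h6 : y * Real.exp (-(c * y)) * Q < 1 := by
      by_contra! h
      have := mul_le_mul_of_nonneg_left h hc0.le
      linarith
    have e1 : g * y * K / 256 = c * y := by rw [hc]; ring
    rw [e1, div_div, le_div_iff₀ (by positivity), Real.mul_rpow (by norm_num) hL0.le]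
    refine le_trans ?_ h6.le
    calc 2 ^ ((M.ε / 3) ^ (-M.α) + 1) * Real.exp (-(c * y)) *
          (4 * M.κ * (4 ^ M.γ * (L : ℝ) ^ M.γ) * 128)
        = (L : ℝ) ^ M.γ * Real.exp (-(c * y)) * Q := by rw [hQ]; ring
      _ ≤ y * Real.exp (-(c * y)) * Q := by gcongr
  · have h5 : 1 / (4 * M.κ * (4 * L : ℝ) ^ M.γ) ≤ 1 / 4 := by
      refine one_div_le_one_div_of_le (by norm_num) ?_
      have := one_le_mul_of_one_le_of_one_le hκ h4L
      nlinarith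
    rw [div_le_iff₀ (by positivity)]
    have h6 := mul_le_mul_of_nonneg_left h4 hK.le
    have h7 : K * (1 / (8 * K)) = 1 / 8 := by field_simp
    linarith

/-- There are constants with all the required relations. -/
theorem exists_tuned (M : Model) (hκ : 1 ≤ M.κ) :
    ∃ (C : Constants) (K k : ℝ) (L : ℕ) (E A : ℝ), Tuned M C K k L E ∧ RelayTuned M C K k A := by
  have hα := M.γ_pos.trans M.γ_lt_α
  have hγ := M.γ_pos
  have hβ := M.one_le_β
  have hε := M.ε_pos
  have hε1 := M.ε_lt_one
  have hΩ := M.outerConst_pos hκ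
  have hl2 : 0 < Real.log 2 := Real.log_pos one_lt_two
  have h2α : (1 : ℝ) < 2 ^ M.α := Real.one_lt_rpow one_lt_two hα
  -- There is no circularity: `K` comes first, then the Playoff scale `L`, `G`, `k`, then `c'`, the
  -- exponent `E` and the test lengths, then `c`, and finally `A` and `a`.
  set K := min (1 / (4 * (M.κ * 8 ^ M.γ)))
    ((2 ^ M.α - 1) / (4 * M.β * 2 ^ M.α * (M.outerConst * (2 / 3) ^ (-M.α)))) with hKdef
  have hK : 0 < K := lt_min (by positivity) (div_pos (by linarith) (by positivity))
  have hK1 : M.κ * 8 ^ M.γ * K ≤ 1 / 4 := by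
    have := min_le_left (1 / (4 * (M.κ * 8 ^ M.γ)))
      ((2 ^ M.α - 1) / (4 * M.β * 2 ^ M.α * (M.outerConst * (2 / 3) ^ (-M.α))))
    rw [← hKdef, le_div_iff₀ (by positivity)] at this
    linarith
  have hK2 : 1 + M.β * 2 ^ M.α * (4 * (K * M.outerConst * (2 / 3) ^ (-M.α))) ≤ 2 ^ M.α := by
    have := min_le_right (1 / (4 * (M.κ * 8 ^ M.γ)))
      ((2 ^ M.α - 1) / (4 * M.β * 2 ^ M.α * (M.outerConst * (2 / 3) ^ (-M.α))))
    rw [← hKdef, le_div_iff₀ (by positivity)] at this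
    linarith
  obtain ⟨L, G, k, hL, hG, hk, hnear, houter, hdense, hsilent, hpMax⟩ :=
    exists_playoff_scale M hκ hK
  obtain ⟨c', hc'⟩ := exists_nat_gt (M.κ * 4 ^ M.γ * K / (k / G))
  have hc'0 : (0 : ℝ) < c' := lt_of_le_of_lt (by positivity) hc'
  set E := 3 + Real.log (40 * c') / Real.log 2 with hE
  have hElog : Real.log (40 * c') ≤ (E - 3) * Real.log 2 := by
    rw [hE, add_sub_cancel_left, div_mul_cancel₀ _ hl2.ne']
  set c₀ := max (1 / Real.log 2) (24 * E / (K / 8)) with hc₀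
  set c₂ := max (1 / Real.log 2) (24 * E / (k / 4)) with hc₂
  have hc₀p : 0 < c₀ := lt_max_of_lt_left (by positivity)
  have hc₂p : 0 < c₂ := lt_max_of_lt_left (by positivity)
  have hτ : 0 < (1 - M.ε / 3) ^ (-M.α) - 1 := sub_pos.2
    (Real.one_lt_rpow_of_pos_of_lt_one_of_neg (by linarith) (by linarith) (by linarith))
  set K' := min (1 / (4 * (M.κ * 24 ^ M.γ)))
    (((1 - M.ε / 3) ^ (-M.α) - 1) / (4 * M.β * 2 ^ M.α * M.outerConst)) with hK'def
  have hK' : 0 < K' := lt_min (by positivity) (div_pos hτ (by positivity))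
  have hK'1 : M.κ * 24 ^ M.γ * K' ≤ 1 / 4 := by
    have := min_le_left (1 / (4 * (M.κ * 24 ^ M.γ)))
      (((1 - M.ε / 3) ^ (-M.α) - 1) / (4 * M.β * 2 ^ M.α * M.outerConst))
    rw [← hK'def, le_div_iff₀ (by positivity)] at this
    linarith
  have hK'2 : 1 + M.β * 2 ^ M.α * (4 * (K' * M.outerConst)) ≤ (1 - M.ε / 3) ^ (-M.α) := by
    have := min_le_right (1 / (4 * (M.κ * 24 ^ M.γ)))
      (((1 - M.ε / 3) ^ (-M.α) - 1) / (4 * M.β * 2 ^ M.α * M.outerConst))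
    rw [← hK'def, le_div_iff₀ (by positivity)] at this
    linarith
  -- This scales the `10 K log n` of the coloring down to the relay density `K'`.
  set c := 10 * K / (K' * M.ε) with hcdef
  have hc : 0 < c := by positivity
  have hcK' : 10 * K / (c * M.ε) = K' := by rw [hcdef]; field_simp
  set b := 8 * (c * M.ε) / (k / (128 * G)) with hb
  set A := 2 * (6 + Real.log (4 * (5 * b + 1)) / Real.log 2) with hA
  have hAlog : Real.log (4 * (5 * b + 1)) ≤ (A / 2 - 6) * Real.log 2 := by
    have e : A / 2 - 6 = Real.log (4 * (5 * b + 1)) / Real.log 2 := by rw [hA]; ring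
    rw [e, div_mul_cancel₀ _ hl2.ne']
  set a := max 1 (2 * A * (c * M.ε) / (k / (128 * G))) with ha
  refine ⟨{ c₀ := c₀, c₁ := K / 8 / 4 * c₀, c₂ := c₂, c₃ := k / 4 / 4 * c₂, cε := G, c' := c',
            C₁ := 2 * K, C₂ := k / 8, c := c, a := a, c₀_pos := hc₀p, c₁_pos := by positivity,
            c₂_pos := hc₂p, c₃_pos := by positivity, cε_pos := hG,
            c'_pos := by exact_mod_cast hc'0, C₁_pos := by positivity, C₂_pos := by positivity,
            c_pos := hc, a_pos := lt_max_of_lt_left one_pos }, K, k, L, E, A, ?_, ?_⟩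
  · exact
      { K_pos := hK
        k_pos := hk
        two_le_L := hL
        density_near := hK1
        density_outer := hK2
        playoff_near := hnear
        playoff_outer := houter
        playoff_dense := hdense
        playoff_silent := hsilent
        C₁_eq := rfl
        C₂_eq := rfl
        pMax_le := hpMax
        repetitions := (div_lt_iff₀ (by positivity)).1 hc'
        c₁_eq := rfl
        c₃_eq := rfl
        one_le_c₀ := (div_le_iff₀ hl2).1 (le_max_left _ _)
        one_le_c₂ := (div_le_iff₀ hl2).1 (le_max_left _ _)
        density_tail := (div_le_iff₀' (by positivity)).1 (le_max_right _ _)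
        playoff_tail := (div_le_iff₀' (by positivity)).1 (le_max_right _ _)
        log_le_E := hElog }
  · exact
      { K_pos := hK
        k_pos := hk
        near_le := by rw [hcK']; exact hK'1
        outer_le := by rw [hcK']; exact hK'2
        relay := (div_le_iff₀ (by positivity)).1 (le_max_right _ _)
        log_le_A := hAlog }

end Existence

end SINRBroadcast

theorem mainTheorem2 (M : SINRBroadcast.Model) :
    ∃ (C : SINRBroadcast.Constants) (K δ : ℝ), 0 < K ∧ 0 < δ ∧
      ∀ (X : Type*) [MetricSpace X], SINRBroadcast.BoundedGrowth X M.γ M.κ →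
      ∀ (V : Type*) [Fintype V] (pos : V ↪ X) (s : V),
        (SINRBroadcast.commGraph M pos).Connected →
        -- within `O(D log n + log² n)` rounds all stations know the message, whp
        (∀ T : ℕ,
          K * ((SINRBroadcast.commGraph M pos).diam * Real.log (Fintype.card V)
            + Real.log (Fintype.card V) ^ 2) ≤ T →
          1 - 1 / (Fintype.card V : ℝ) ≤
            SINRBroadcast.prob (SINRBroadcast.exec M C pos s T) {σ | ∀ v, (σ v).Informed}) ∧
        -- whp the coloring is such that in each later round the message advances along each
        -- edge `v u`, from the `ε / 3`-ball of `v` to that of `u`, with probability `Ω(1 / log n)`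
        1 - 1 / (Fintype.card V : ℝ) ≤
          SINRBroadcast.prob
            (SINRBroadcast.exec M C pos s (C.colorRounds (Fintype.card V)))
            {σ₀ | ∀ σ : V → SINRBroadcast.Station, (∀ v, (σ v).color = (σ₀ v).color) →
              ∀ t : ℕ, C.colorRounds (Fintype.card V) < t →
              ∀ v u : V, (SINRBroadcast.commGraph M pos).Adj v u →
                (∀ w, dist (pos v) (pos w) ≤ M.ε / 3 →
                  (σ w).Relaying C (Fintype.card V) t) →
                δ / Real.log (Fintype.card V) ≤
                  SINRBroadcast.prob (SINRBroadcast.step M C pos s t σ)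
                    {σ' | ∀ w, dist (pos u) (pos w) ≤ M.ε / 3 → (σ' w).Informed}} := by
  by_cases hκ : 1 ≤ M.κ
  swap
  · -- bounded growth fails for a nonempty space
    refine ⟨⟨1, 1, 1, 1, 1, 1, 1, 1, 1, 1, one_pos, one_pos, one_pos, one_pos, one_pos, one_pos,
      one_pos, one_pos, one_pos, one_pos⟩, 1, 1, one_pos, one_pos, ?_⟩
    intro X _ hX V _ pos s
    exact absurd (hX.one_le (pos s)) hκ
  obtain ⟨C, K, k, L, E, A, hT, hR⟩ := SINRBroadcast.exists_tuned M hκ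
  have hk := hR.k_pos
  have hc := C.c_pos
  have hε := M.ε_pos
  have hcε := C.cε_pos
  have hc₀ := C.c₀_pos
  have hc₂ := C.c₂_pos
  refine ⟨C, 5 * C.c' * (C.c₀ + C.c₂ + 4) + 8 + 4 * (8 * (C.c * M.ε) / (k / (128 * C.cε))),
    k / (128 * C.cε) / (2 * (C.c * M.ε)), by positivity, by positivity, ?_⟩
  intro X _ hX V _ pos s hcon
  have hpos : 0 < Fintype.card V := Fintype.card_pos_iff.2 ⟨s⟩
  rcases (show Fintype.card V = 1 ∨ 2 ≤ Fintype.card V by omega) with hn | hn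
  -- For a single station both probability bounds are trivial; otherwise `log n > 0`.
  · have h0 : 1 - 1 / (Fintype.card V : ℝ) = 0 := by rw [hn]; norm_num
    rw [h0]
    exact ⟨fun T _ => ENNReal.toReal_nonneg, ENNReal.toReal_nonneg⟩
  refine ⟨fun T hTr => hR.one_sub_le_prob_informed pos hT hX hn hcon s hTr, ?_⟩
  refine SINRBroadcast.one_sub_le_prob (by positivity)
    ((SINRBroadcast.eprob_compl_anti _ fun σ₀ h₀ => ?_).trans
      ((hT.eprob_not_goodColoring_le pos hX hn s).trans (ENNReal.ofReal_le_ofReal ?_)))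
  -- A good coloring depends on the colors only, so it passes to any state with the same colors.
  · intro σ hσ t ht v u hvu hrel
    exact hR.div_log_le_prob pos hX hn (h₀.1.congr pos hσ) ht hvu.2 hrel
  · have hn0 : (0 : ℝ) < Fintype.card V := by exact_mod_cast hpos
    refine one_div_le_one_div_of_le hn0 ?_
    linarith
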